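/- Let $K$ be a number field with ring of integers $\mathcal O_K$ and $X=\operatorname{Spec}\mathcal O_K$. For a closed point $x$ of $X$ write $\mathfrak m_x\subset\mathcal O_{X,x}$ for the maximal ideal, $\kappa(x)$ for the residue field, $v_x$ for the normalized valuation, and $\nu_x=(\mathfrak m_x/\mathfrak m_x^2)^\vee$. For a field $k$ and a one-dimensional $k$-vector space $L$ let $\mathrm{GW}(k,L)$ be the Grothendieck group of nondegenerate symmetric bilinear forms over $k$ with values in $L$; for $u\in k^\times$ and $0\ne\ell\in L$ let $\langle u\rangle\otimes\ell$ be the class of $(s,t)\mapsto ust\,\ell$ on $k$, let $h_L=\langle 1\rangle\otimes\ell+\langle -1\rangle\otimes\ell$ (independent of $\ell$), and for $n\ge 0$ let $n_\epsilon\langle u\rangle\otimes\ell=\sum_{i=1}^{n}\langle(-1)^{i-1}u\rangle\otimes\ell$ and $(-n)_\epsilon\langle u\rangle\otimes\ell=-\,n_\epsilon\langle -u\rangle\otimes\ell$. Let $K^{MW}_*(K)$ be the Milnor–Witt K-theory of $K$: the graded ring generated by $[u]$ $(u\in K^\times)$ in degree $1$ and $\eta$ in degree $-1$ with relations $[a][1-a]=0$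 for $a\neq 0,1$, $[ab]=[a]+[b]+\eta[a][b]$, $\eta[a]=[a]\eta$, $\eta(2+\eta[-1])=0$. Let $\partial_x:K^{MW}_1(K)\to\mathrm{GW}(\kappa(x),\nu_x)$ be the residue homomorphism, characterized by $$\partial_x([u])=n_\epsilon\langle\overline{u\pi^{-n}}\rangle\otimes\bar\pi^\vee,\qquad n=v_x(u),$$ for any uniformizer $\pi$ at $x$, where $\bar\pi^\vee\in\nu_x$ is dual to the class of $\pi$. Put $$\mathrm{CH}^1(\mathcal O_K)=\operatorname{coker}\Bigl(K^\times\xrightarrow{\ \mathrm{div}\ }\bigoplus_x\mathbb Z\Bigr),\qquad \widetilde{\mathrm{CH}}{}^1(\mathcal O_K)=\operatorname{coker}\Bigl(K^{MW}_1(K)\xrightarrow{\ \sum_x\partial_x\ }\bigoplus_x\mathrm{GW}(\kappa(x),\nu_x)\Bigr),$$ the sums being over the closed points $x$ of $X$. Then there is an exact sequence $$\mathrm{CH}^1(\mathcal O_K)\longrightarrow\widetilde{\mathrm{CH}}{}^1(\mathcal O_K)\longrightarrow\mathrm{CH}^1(\mathcal O_K)/2\longrightarrow 0,$$ where the first map is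 induced by multiplication by the hyperbolic form, $[x]\mapsto h_{\nu_x}$ at $x$, and the second is induced by reduction modulo $h$, i.e. it sends the class of $\varphi\in\mathrm{GW}(\kappa(x),\nu_x)$ at $x$ to $r\cdot[x]$, where $r\in\mathbb Z/2$ is the rank modulo $2$ of the image of $\varphi$ in the Witt group $\mathrm{GW}(\kappa(x),\nu_x)/h$. In particular the Chow–Witt group $\widetilde{\mathrm{CH}}{}^1(\mathcal O_K)$ is finite. -/

import Mathlib

/-- A nondegenerate symmetric bilinear form on `k^n` with values in the `k`-vector space `L`
(`L` will be one-dimensional; `L = k` gives ordinary forms). -/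
structure SymForm (k L : Type*) [Field k] [AddCommGroup L] [Module k L] where
  /-- the dimension of the underlying space -/
  n : ℕ
  /-- the bilinear form -/
  B : (Fin n → k) →ₗ[k] (Fin n → k) →ₗ[k] L
  symm : ∀ x y, B x y = B y x
  nondeg : ∀ x, (∀ y, B x y = 0) → x = 0

/-- `B` is isometric to the orthogonal sum of `B₁` and `B₂`. -/
def SymForm.IsOrthSum {k L : Type*} [Field k] [AddCommGroup L] [Module k L]
    (B B₁ B₂ : SymForm k L) : Prop :=
  ∃ e : ((Fin B₁.n → k) × (Fin B₂.n → k)) ≃ₗ[k] (Fin B.n → k),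
    ∀ x y, B.B (e x) (e y) = B₁.B x.1 y.1 + B₂.B x.2 y.2

/-- The Grothendieck-Witt group `GW(k, L)`: the abelian group generated by the nondegenerate
symmetric bilinear forms with values in `L`, with a relation `[B] = [B₁] + [B₂]` for each
isometry `B ≃ B₁ ⊥ B₂`.  (With `B₂ = 0` this contains `[B] = [B₁]` for `B ≃ B₁`.) -/
def GW (k L : Type*) [Field k] [AddCommGroup L] [Module k L] : Type _ :=
  FreeAbelianGroup (SymForm k L) ⧸ AddSubgroup.closure
    {a | ∃ B B₁ B₂ : SymForm k L, B.IsOrthSum B₁ B₂ ∧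
      a = FreeAbelianGroup.of B - FreeAbelianGroup.of B₁ - FreeAbelianGroup.of B₂}

namespace GW

section

variable {k L : Type*} [Field k] [AddCommGroup L] [Module k L]

noncomputable instance : AddCommGroup (GW k L) :=
  inferInstanceAs (AddCommGroup (_ ⧸ AddSubgroup.closure _))

/-- The class of a form. -/
noncomputable def mk (B : SymForm k L) : GW k L :=
  QuotientAddGroup.mk (FreeAbelianGroup.of B)

theorem mk_orthSum {B B₁ B₂ : SymForm k L} (h : B.IsOrthSum B₁ B₂) : mk B = mk B₁ + mk B₂ := by
  have : (QuotientAddGroup.mk (FreeAbelianGroup.of B - FreeAbelianGroup.of B₁ -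
      FreeAbelianGroup.of B₂) : GW k L) = 0 :=
    (QuotientAddGroup.eq_zero_iff _).2 (AddSubgroup.subset_closure ⟨B, B₁, B₂, h, rfl⟩)
  change mk B - mk B₁ - mk B₂ = 0 at this
  rw [sub_sub, sub_eq_zero] at this
  exact this

/-- The rank homomorphism `GW(k, L) → ℤ`. -/
noncomputable def rank : GW k L →+ ℤ :=
  QuotientAddGroup.lift _ (FreeAbelianGroup.lift fun B : SymForm k L => (B.n : ℤ)) <| by
    rw [AddSubgroup.closure_le]
    rintro _ ⟨B, B₁, B₂, ⟨e, -⟩, rfl⟩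
    have := e.finrank_eq
    simp only [Module.finrank_prod, Module.finrank_fin_fun] at this
    simp [← this]

@[simp]
theorem rank_mk (B : SymForm k L) : rank (mk B) = B.n :=
  FreeAbelianGroup.lift_apply_of _ _

/-- The form `⟨u⟩ ⊗ ℓ`, that is `(x, y) ↦ u x y ℓ` on the line `k¹`. -/
noncomputable def _root_.SymForm.unary {ℓ : L} (hℓ : ℓ ≠ 0) (u : kˣ) : SymForm k L where
  n := 1
  B := LinearMap.mk₂ k (fun x y => ((u : k) * x 0 * y 0) • ℓ)
    (by intros; simp [mul_add, add_mul, add_smul])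
    (by intros; simp [smul_smul]; ring_nf) (by intros; simp [mul_add, add_smul])
    (by intros; simp [smul_smul]; ring_nf)
  symm x y := by simp only [LinearMap.mk₂_apply]; ring_nf
  nondeg x hx := by
    have := hx 1
    funext i
    fin_cases i
    simpa [hℓ] using this

/-- The class `⟨u⟩ ⊗ ℓ` in `GW(k, L)` of the rank one form `(x, y) ↦ u x y ℓ`. -/
noncomputable def angle {ℓ : L} (hℓ : ℓ ≠ 0) (u : kˣ) : GW k L := mk (SymForm.unary hℓ u)

@[simp]
theorem rank_angle {ℓ : L} (hℓ : ℓ ≠ 0) (u : kˣ) : rank (angle hℓ u) = 1 := by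
  simp [angle, SymForm.unary]

theorem angle_smul {ℓ m : L} (hℓ : ℓ ≠ 0) (hm : m ≠ 0) (a u : kˣ) (h : m = (a : k) • ℓ) :
    angle hm u = angle hℓ (u * a) := by
  have : SymForm.unary hm u = SymForm.unary hℓ (u * a) := by
    subst h
    simp only [SymForm.unary, smul_smul, Units.val_mul]
    congr 2
    ext x y
    ring_nf
  rw [angle, angle, this]

/-- If `e, f` is an orthogonal basis of `⟨a⟩ ⊥ ⟨b⟩` with values `c, d`,
then `⟨a⟩ + ⟨b⟩ = ⟨c⟩ + ⟨d⟩`. -/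
theorem angle_add_angle {ℓ : L} (hℓ : ℓ ≠ 0) (a b c d : kˣ) (e₁ e₂ f₁ f₂ : k)
    (hc : (c : k) = a * e₁ ^ 2 + b * e₂ ^ 2) (hd : (d : k) = a * f₁ ^ 2 + b * f₂ ^ 2)
    (h0 : a * e₁ * f₁ + b * e₂ * f₂ = 0) :
    angle hℓ a + angle hℓ b = angle hℓ c + angle hℓ d := by
  let D : SymForm k L :=
    { n := 2
      B := LinearMap.mk₂ k (fun x y => ((a : k) * x 0 * y 0 + b * x 1 * y 1) • ℓ)
        (by intros; simp only [Pi.add_apply, ← add_smul]; ring_nf)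
        (by intros; simp only [Pi.smul_apply, smul_smul, smul_eq_mul]; ring_nf)
        (by intros; simp only [Pi.add_apply, ← add_smul]; ring_nf)
        (by intros; simp only [Pi.smul_apply, smul_smul, smul_eq_mul]; ring_nf)
      symm := fun x y => by simp only [LinearMap.mk₂_apply]; ring_nf
      nondeg := fun x hx => by
        have h₁ := hx ![1, 0]
        have h₂ := hx ![0, 1]
        simp [hℓ] at h₁ h₂
        funext i
        fin_cases i <;> simp [h₁, h₂] }
  have key : ∀ (c d : kˣ) (e₁ e₂ f₁ f₂ : k)
      (_ : (c : k) = a * e₁ ^ 2 + b * e₂ ^ 2) (_ : (d : k) = a * f₁ ^ 2 + b * f₂ ^ 2)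
      (_ : a * e₁ * f₁ + b * e₂ * f₂ = 0), mk D = angle hℓ c + angle hℓ d := by
    intro c d e₁ e₂ f₁ f₂ hc hd h0
    let f : ((Fin 1 → k) × (Fin 1 → k)) →ₗ[k] (Fin 2 → k) :=
      { toFun := fun x => ![x.1 0 * e₁ + x.2 0 * f₁, x.1 0 * e₂ + x.2 0 * f₂]
        map_add' := fun x y => by
          funext i
          fin_cases i <;> simp <;> ring
        map_smul' := fun r x => by
          funext i
          fin_cases i <;> simp <;> ring }
    have hf : ∀ x y, D.B (f x) (f y) =
        ((c : k) * x.1 0 * y.1 0) • ℓ + ((d : k) * x.2 0 * y.2 0) • ℓ := by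
      intro x y
      change ((a : k) * (x.1 0 * e₁ + x.2 0 * f₁) * (y.1 0 * e₁ + y.2 0 * f₁) +
        b * (x.1 0 * e₂ + x.2 0 * f₂) * (y.1 0 * e₂ + y.2 0 * f₂)) • ℓ = _
      rw [← add_smul]
      congr 1
      rw [hc, hd]
      linear_combination (x.1 0 * y.2 0 + x.2 0 * y.1 0) * h0
    have inj : Function.Injective f := by
      rw [← LinearMap.ker_eq_bot, LinearMap.ker_eq_bot']
      intro x hx
      have h₁ := hf x (1, 0)
      have h₂ := hf x (0, 1)
      rw [hx] at h₁ h₂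
      simp only [map_zero, LinearMap.zero_apply] at h₁ h₂
      simp [hℓ, eq_comm (a := (0 : L))] at h₁ h₂
      refine Prod.ext (funext fun i => ?_) (funext fun i => ?_) <;> fin_cases i
      · exact h₁
      · exact h₂
    let e : ((Fin 1 → k) × (Fin 1 → k)) ≃ₗ[k] (Fin 2 → k) :=
      LinearEquiv.ofInjectiveOfFinrankEq f inj (by simp)
    exact mk_orthSum ⟨e, hf⟩
  rw [← key c d e₁ e₂ f₁ f₂ hc hd h0, ← key a b 1 0 0 1 (by simp) (by simp) (by simp)]

theorem angle_mul_sq {ℓ : L} (hℓ : ℓ ≠ 0) (a u : kˣ) : angle hℓ (a * u ^ 2) = angle hℓ a := by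
  have := angle_add_angle hℓ a 1 (a * u ^ 2) 1 u 0 0 1 (by simp) (by simp) (by simp)
  exact (add_right_cancel this).symm

theorem angle_steinberg {ℓ : L} (hℓ : ℓ ≠ 0) (g a b : kˣ) (h : (a : k) + b = 1) :
    angle hℓ (g * a) + angle hℓ (g * b) = angle hℓ g + angle hℓ (g * a * b) :=
  angle_add_angle hℓ (g * a) (g * b) g (g * a * b) 1 1 (b : k) (-a : k)
    (by push_cast; linear_combination -(g : k) * h)
    (by push_cast; linear_combination -(g * a * b : k) * h) (by push_cast; ring)

theorem angle_add_neg {ℓ : L} (hℓ : ℓ ≠ 0) (g g' : kˣ) :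
    angle hℓ g + angle hℓ (-g) = angle hℓ g' + angle hℓ (-g') := by
  by_cases hg : g = g'
  · rw [hg]
  let a : kˣ := g * g'⁻¹
  have ha : (a : k) ≠ 1 := by
    intro h
    have : a = 1 := Units.ext h
    exact hg (mul_inv_eq_one.1 this)
  let b : kˣ := Units.mk0 (1 - (a : k)) (sub_ne_zero.2 (Ne.symm ha))
  have hb : (b : k) = 1 - a := rfl
  have h1 := angle_steinberg hℓ (g' * b⁻¹) a b (by rw [hb]; ring)
  have h2 := angle_steinberg hℓ (g' * b⁻¹) a⁻¹ (-b * a⁻¹) (by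
    push_cast
    rw [hb]
    field_simp
    ring)
  have e1 : g' * b⁻¹ * b = g' := by group
  have e2 : g' * b⁻¹ * a * b = g := by
    simp only [a]
    rw [mul_right_comm, e1]
    simp
  have e3 : angle hℓ (g' * b⁻¹ * a⁻¹) = angle hℓ (g' * b⁻¹ * a) := by
    rw [← angle_mul_sq hℓ _ a]
    congr 1
    rw [mul_assoc, pow_two, inv_mul_cancel_left]
  have e4 : angle hℓ (g' * b⁻¹ * (-b * a⁻¹)) = angle hℓ (-g) := by
    rw [← angle_mul_sq hℓ _ a]
    congr 1
    rw [← e2]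
    ext
    push_cast
    field_simp
  have e5 : angle hℓ (g' * b⁻¹ * a⁻¹ * (-b * a⁻¹)) = angle hℓ (-g') := by
    rw [← angle_mul_sq hℓ _ a]
    congr 1
    ext
    push_cast
    field_simp
  rw [e1, e2] at h1
  rw [e3, e4, e5] at h2
  have h3 : angle hℓ g - angle hℓ g' = angle hℓ (-g') - angle hℓ (-g) := by
    rw [sub_eq_sub_iff_add_eq_add] at *
    rw [eq_sub_iff_add_eq'.2 h1.symm, eq_sub_iff_add_eq'.2 h2.symm]
    abel
  rw [← sub_eq_zero] at h3 ⊢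
  rw [← h3]
  abel

/-- The hyperbolic class `h · ⟨ℓ⟩ = ⟨ℓ⟩ + ⟨-ℓ⟩` in `GW(k, L)`, where `h = ⟨1⟩ + ⟨-1⟩`.
If `L` is a line, it does not depend on `ℓ` (see `hyp_eq`). -/
noncomputable def hyp {ℓ : L} (hℓ : ℓ ≠ 0) : GW k L := angle hℓ (1 : kˣ) + angle hℓ (-1 : kˣ)

@[simp]
theorem rank_hyp {ℓ : L} (hℓ : ℓ ≠ 0) : rank (hyp (k := k) hℓ) = 2 := by
  simp [hyp]

theorem angle_add_neg_eq_hyp {ℓ : L} (hℓ : ℓ ≠ 0) (u : kˣ) :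
    angle hℓ u + angle hℓ (-u) = hyp hℓ := angle_add_neg hℓ u 1

theorem hyp_eq {ℓ m : L} (hℓ : ℓ ≠ 0) (hm : m ≠ 0) (a : k) (h : m = a • ℓ) :
    hyp (k := k) hm = hyp (k := k) hℓ := by
  have ha : a ≠ 0 := by
    rintro rfl
    simp [hm] at h
  rw [hyp, angle_smul hℓ hm (Units.mk0 a ha) 1 h, angle_smul hℓ hm (Units.mk0 a ha) (-1) h,
    neg_one_mul, one_mul, angle_add_neg_eq_hyp]

/-- The class `n_ε · ⟨u⟩ ⊗ ℓ` for an integer `n`, where `n_ε = ∑_{i=1}^{n} ⟨-1⟩^{i-1}` for `n ≥ 0`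
and `(-n)_ε = -⟨-1⟩ · n_ε`. -/
noncomputable def nEps {ℓ : L} (hℓ : ℓ ≠ 0) (u : kˣ) : ℤ → GW k L
  | .ofNat n => ∑ i ∈ Finset.range n, angle hℓ ((-1) ^ i * u)
  | .negSucc n => -∑ i ∈ Finset.range (n + 1), angle hℓ ((-1) ^ (i + 1) * u)

theorem rank_nEps {ℓ : L} (hℓ : ℓ ≠ 0) (u : kˣ) (n : ℤ) : rank (nEps hℓ u n) = n := by
  cases n with
  | ofNat n => simp [nEps]
  | negSucc n => simp [nEps, Int.negSucc_eq]

end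

end GW

/-- The Witt group `W(k, L) = GW(k, L) / h`, the quotient by the multiples of `h`. -/
def Witt (k L : Type*) [Field k] [AddCommGroup L] [Module k L] : Type _ :=
  GW k L ⧸ AddSubgroup.closure {a : GW k L | ∃ (ℓ : L) (hℓ : ℓ ≠ 0), a = GW.hyp (k := k) hℓ}

namespace Witt

section

variable {k L : Type*} [Field k] [AddCommGroup L] [Module k L]

noncomputable instance : AddCommGroup (Witt k L) :=
  inferInstanceAs (AddCommGroup (_ ⧸ AddSubgroup.closure _))

/-- Reduction modulo `h`. -/
noncomputable def ofGW : GW k L →+ Witt k L := QuotientAddGroup.mk' _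

theorem ofGW_hyp {ℓ : L} (hℓ : ℓ ≠ 0) : ofGW (GW.hyp (k := k) hℓ) = 0 :=
  (QuotientAddGroup.eq_zero_iff _).2 (AddSubgroup.subset_closure ⟨ℓ, hℓ, rfl⟩)

theorem ofGW_surjective : Function.Surjective (ofGW : GW k L →+ Witt k L) :=
  QuotientAddGroup.mk'_surjective _

/-- The rank modulo two of a Witt class. -/
noncomputable def rankModTwo : Witt k L →+ ZMod 2 :=
  QuotientAddGroup.lift _ ((Int.castAddHom (ZMod 2)).comp GW.rank) <| by
    rw [AddSubgroup.closure_le]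
    rintro _ ⟨ℓ, hℓ, rfl⟩
    have : ((2 : ℤ) : ZMod 2) = 0 := rfl
    simpa using this

@[simp]
theorem rankModTwo_ofGW (a : GW k L) : rankModTwo (ofGW a) = (GW.rank a : ZMod 2) := rfl

theorem ofGW_neg {ℓ : L} (hℓ : ℓ ≠ 0) (u : kˣ) :
    ofGW (GW.angle hℓ (-u)) = -ofGW (GW.angle hℓ u) := by
  rw [eq_neg_iff_add_eq_zero, ← map_add, add_comm, GW.angle_add_neg_eq_hyp, ofGW_hyp]

theorem ofGW_sum {ℓ : L} (hℓ : ℓ ≠ 0) (u : kˣ) (n : ℕ) :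
    ofGW (∑ i ∈ Finset.range n, GW.angle hℓ ((-1) ^ i * u)) =
      if Odd n then ofGW (GW.angle hℓ u) else 0 := by
  induction n with
  | zero => simp
  | succ n ih =>
    rw [Finset.sum_range_succ, map_add, ih]
    rcases Nat.even_or_odd n with h | h
    · simp [Nat.not_odd_iff_even.2 h, h.neg_one_pow, h.add_one]
    · simp [h, h.neg_one_pow, ofGW_neg, Nat.not_odd_iff_even.2 h.add_one]

open Classical in
theorem ofGW_nEps {ℓ : L} (hℓ : ℓ ≠ 0) (u : kˣ) (n : ℤ) :
    ofGW (GW.nEps hℓ u n) = if Odd n then ofGW (GW.angle hℓ u) else 0 := by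
  cases n with
  | ofNat n =>
    have h2 : Odd (Int.ofNat n) ↔ Odd n := Int.odd_coe_nat n
    simp only [GW.nEps, h2, ofGW_sum]
  | negSucc n =>
    have h1 : ∀ i : ℕ, (-1 : kˣ) ^ (i + 1) * u = (-1) ^ i * (-u) := fun i => by
      rw [pow_succ, mul_assoc, neg_one_mul]
    have h2 : Odd (Int.negSucc n) ↔ Odd (n + 1) := by
      rw [Int.negSucc_eq, odd_neg]
      exact_mod_cast Iff.rfl
    simp only [GW.nEps, h1, map_neg, h2, ofGW_sum]
    split_ifs
    · rw [ofGW_neg, neg_neg]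
    · simp

/-- Over a line `L`, a class of rank zero that is trivial modulo `h` is trivial. -/
theorem eq_zero_of_rank_of_ofGW {ℓ : L} (hℓ : ℓ ≠ 0) (h1 : ∀ m : L, ∃ a : k, m = a • ℓ)
    {x : GW k L} (hr : GW.rank x = 0) (hw : ofGW x = 0) : x = 0 := by
  have hx := (QuotientAddGroup.eq_zero_iff _).1 hw
  have : AddSubgroup.closure {a : GW k L | ∃ (ℓ : L) (hℓ : ℓ ≠ 0), a = GW.hyp (k := k) hℓ} ≤
      AddSubgroup.zmultiples (GW.hyp (k := k) hℓ) := by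
    rw [AddSubgroup.closure_le]
    rintro _ ⟨m, hm, rfl⟩
    obtain ⟨a, ha⟩ := h1 m
    rw [GW.hyp_eq hℓ hm a ha]
    exact AddSubgroup.mem_zmultiples _
  obtain ⟨n, rfl⟩ := this hx
  simp at hr
  simp [hr]

end

end Witt

/-- The generators `η` and `[u]`, `u ∈ F^×`, of Milnor-Witt K-theory. -/
inductive KMWGen (F : Type*) [Field F] : Type _
  | eta : KMWGen F
  | symb (u : Fˣ) : KMWGen F

open FreeAlgebra KMWGen in
/-- The defining relations of Milnor-Witt K-theory. -/
inductive KMWRel (F : Type*) [Field F] :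
    FreeAlgebra ℤ (KMWGen F) → FreeAlgebra ℤ (KMWGen F) → Prop
  | steinberg (a b : Fˣ) (h : (a : F) + b = 1) : KMWRel F (ι ℤ (symb a) * ι ℤ (symb b)) 0
  | mul (a b : Fˣ) : KMWRel F (ι ℤ (symb (a * b)))
      (ι ℤ (symb a) + ι ℤ (symb b) + ι ℤ eta * ι ℤ (symb a) * ι ℤ (symb b))
  | comm (a : Fˣ) : KMWRel F (ι ℤ eta * ι ℤ (symb a)) (ι ℤ (symb a) * ι ℤ eta)
  | hyp : KMWRel F (ι ℤ eta * (ι ℤ eta * ι ℤ (symb (-1)) + 2)) 0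

/-- The Milnor-Witt K-theory ring of a field. -/
def KMW (F : Type*) [Field F] : Type _ := RingQuot (KMWRel F)

namespace KMW

section

variable {F : Type*} [Field F]

noncomputable instance : Ring (KMW F) := inferInstanceAs (Ring (RingQuot (KMWRel F)))

/-- The class of a generator. -/
noncomputable def gen (g : KMWGen F) : KMW F :=
  RingQuot.mkRingHom (KMWRel F) (FreeAlgebra.ι ℤ g)

/-- The element `η`. -/
noncomputable abbrev eta : KMW F := gen KMWGen.eta

/-- The symbol `[u]`. -/
noncomputable abbrev symb (u : Fˣ) : KMW F := gen (KMWGen.symb u)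

/-- The degree of a generator: `[u]` has degree `1` and `η` has degree `-1`. -/
def deg : KMWGen F → ℤ
  | .eta => -1
  | .symb _ => 1

variable (F) in
/-- `K^MW_d(F)`, the part of degree `d`: it is generated by the monomials of degree `d`
in the generators. -/
noncomputable def homog (d : ℤ) : AddSubgroup (KMW F) :=
  AddSubgroup.closure {a | ∃ w : List (KMWGen F), (w.map deg).sum = d ∧ a = (w.map gen).prod}

/-- The symbol `[u]` in `K^MW_1(F)`. -/
noncomputable def symb₁ (u : Fˣ) : homog F 1 :=
  ⟨symb u, AddSubgroup.subset_closure ⟨[KMWGen.symb u], by simp [deg], by simp⟩⟩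

theorem symb_mul (a b : Fˣ) : symb (a * b) = symb a + symb b + eta * symb a * symb b := by
  have := RingQuot.mkRingHom_rel (KMWRel.mul a b)
  simp only [map_add, map_mul] at this
  exact this

theorem eta_comm (a : Fˣ) : Commute eta (symb a) := by
  have := RingQuot.mkRingHom_rel (KMWRel.comm a)
  simp only [map_mul] at this
  exact this

theorem exists_normal_form (w : List (KMWGen F)) : ∃ (m : ℕ) (us : List Fˣ),
    (w.map gen).prod = eta ^ m * (us.map symb).prod ∧ (w.map deg).sum = us.length - m := by
  induction w with
  | nil => exact ⟨0, [], by simp, by simp⟩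
  | cons g w ih =>
    obtain ⟨m, us, h1, h2⟩ := ih
    cases g with
    | eta =>
      refine ⟨m + 1, us, ?_, ?_⟩
      · simp [h1, pow_succ', mul_assoc]
      · simp [h2, deg]; ring
    | symb u =>
      refine ⟨m, u :: us, ?_, ?_⟩
      · simp only [List.map_cons, List.prod_cons, h1]
        rw [← mul_assoc, ← mul_assoc, ((eta_comm u).pow_left m).eq]
      · simp [h2, deg]; ring

/-- `K^MW_1(F)` is generated by the symbols `[u]`. -/
theorem homog_one_le : homog F 1 ≤ AddSubgroup.closure (Set.range symb) := by
  rw [homog, AddSubgroup.closure_le]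
  rintro _ ⟨w, hw, rfl⟩
  obtain ⟨m, us, h1, h2⟩ := exists_normal_form w
  rw [SetLike.mem_coe, h1]
  have hl : us.length = m + 1 := by omega
  clear h1 h2 hw
  induction m generalizing us with
  | zero =>
    obtain ⟨u, rfl⟩ := List.length_eq_one_iff.1 hl
    simpa using AddSubgroup.subset_closure (Set.mem_range_self u)
  | succ m ih =>
    obtain _ | ⟨u, us⟩ := us
    · simp at hl
    have := ih us (by simpa using hl)
    rw [List.map_cons, List.prod_cons, pow_succ, mul_assoc, ← mul_assoc eta (symb u), ← mul_assoc,
      ((((Commute.refl eta).mul_right (eta_comm u))).pow_left m).eq, mul_assoc]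
    generalize (eta : KMW F) ^ m * (us.map symb).prod = z at this
    induction this using AddSubgroup.closure_induction with
    | mem x hx =>
      obtain ⟨v, rfl⟩ := hx
      have : eta * symb u * symb v = symb (u * v) - symb u - symb v := by
        rw [symb_mul]
        abel
      rw [this]
      exact sub_mem (sub_mem (AddSubgroup.subset_closure (Set.mem_range_self _))
        (AddSubgroup.subset_closure (Set.mem_range_self _)))
        (AddSubgroup.subset_closure (Set.mem_range_self _))
    | zero => simp
    | add x y _ _ hx hy =>
      rw [mul_add]
      exact add_mem hx hy
    | neg x _ hx =>
      rw [mul_neg]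
      exact neg_mem hx

theorem homog_one_induction {p : homog F 1 → Prop} (hs : ∀ u, p (symb₁ u)) (h0 : p 0)
    (ha : ∀ x y, p x → p y → p (x + y)) (hn : ∀ x, p x → p (-x)) (x : homog F 1) : p x := by
  obtain ⟨x, hx⟩ := x
  have key : ∀ y ∈ AddSubgroup.closure (Set.range (symb : Fˣ → KMW F)),
      ∃ h : y ∈ homog F 1, p ⟨y, h⟩ := by
    intro y hy
    induction hy using AddSubgroup.closure_induction with
    | mem y hy =>
      obtain ⟨u, rfl⟩ := hy
      exact ⟨(symb₁ u).2, hs u⟩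
    | zero => exact ⟨zero_mem _, h0⟩
    | add y z _ _ hy hz =>
      obtain ⟨h1, h2⟩ := hy
      obtain ⟨h3, h4⟩ := hz
      exact ⟨add_mem h1 h3, ha _ _ h2 h4⟩
    | neg y _ hy =>
      obtain ⟨h1, h2⟩ := hy
      exact ⟨neg_mem h1, hn _ h2⟩
  exact (key x (homog_one_le hx)).2

/-- Ring homomorphisms out of Milnor-Witt K-theory. -/
noncomputable def lift {T : Type*} [Ring T] (e : T) (s : Fˣ → T)
    (h1 : ∀ a b : Fˣ, (a : F) + b = 1 → s a * s b = 0)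
    (h2 : ∀ a b, s (a * b) = s a + s b + e * s a * s b) (h3 : ∀ a, e * s a = s a * e)
    (h4 : e * (e * s (-1) + 2) = 0) : KMW F →+* T :=
  RingQuot.lift ⟨(FreeAlgebra.lift ℤ (fun g : KMWGen F => match g with
    | .eta => e
    | .symb u => s u)).toRingHom, by
    intro x y h
    cases h with
    | steinberg a b h => simpa using h1 a b h
    | mul a b => simpa using h2 a b
    | comm a => simpa using h3 a
    | hyp =>
      have h5 : ∀ φ : FreeAlgebra ℤ (KMWGen F) →ₐ[ℤ] T, φ 2 = 2 := fun φ => by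
        rw [← one_add_one_eq_two, map_add, map_one, one_add_one_eq_two]
      simpa [h5] using h4⟩

theorem lift_symb {T : Type*} [Ring T] (e : T) (s : Fˣ → T) (h1 h2 h3 h4) (u : Fˣ) :
    lift (F := F) e s h1 h2 h3 h4 (symb u) = s u := by
  simp only [lift, symb, gen]
  erw [RingQuot.lift_mkRingHom_apply]
  simp

/-- The homomorphism `K^MW_1(F) → ℤ`, `[u] ↦ v(u)`, given by `K^MW_1(F) → K^M_1(F) = F^×`
and a homomorphism `v : F^× → ℤ`. -/
noncomputable def valHom (v : Fˣ →* Multiplicative ℤ) : homog F 1 →+ ℤ :=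
  AddMonoidHom.comp ⟨⟨fun x : DualNumber ℤ => x.snd, rfl⟩, fun _ _ => rfl⟩
    ((lift (T := DualNumber ℤ) 0 (fun u => TrivSqZeroExt.inr (v u).toAdd)
      (by intros; exact TrivSqZeroExt.inr_mul_inr _ _ _)
      (by intros; rw [map_mul, toAdd_mul, TrivSqZeroExt.inr_add, zero_mul, zero_mul, add_zero])
      (by intros; simp) (by simp)).toAddMonoidHom.comp
        (homog F 1).subtype)

theorem valHom_symb (v : Fˣ →* Multiplicative ℤ) (u : Fˣ) :
    valHom v (symb₁ u) = (v u).toAdd := by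
  simp only [valHom, symb₁, AddMonoidHom.comp_apply, AddSubgroup.subtype_apply,
    RingHom.toAddMonoidHom_eq_coe, AddMonoidHom.coe_coe]
  erw [lift_symb]
  rfl

/-- A function `f` on `F^×` that satisfies the relations of the Witt group extends to `K^MW_1(F)`
with `[u] ↦ f(u) - f(1)`. -/
theorem exists_wittHom {M : Type*} [AddCommGroup M] (f : Fˣ → M) (hneg : ∀ g, f (-g) = -f g)
    (hst : ∀ g a b : Fˣ, (a : F) + b = 1 → f (g * a) + f (g * b) = f g + f (g * a * b)) :
    ∃ φ : homog F 1 →+ M, ∀ u, φ (symb₁ u) = f u - f 1 := by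
  let of : Fˣ → FreeAbelianGroup Fˣ := FreeAbelianGroup.of
  let J : Ideal (FreeAbelianGroup Fˣ) := Ideal.span
    ({x | ∃ a b : Fˣ, (a : F) + b = 1 ∧ x = (of a - 1) * (of b - 1)} ∪ {1 + of (-1)})
  let ψ : FreeAbelianGroup Fˣ →+ M := FreeAbelianGroup.lift f
  have one : (1 : FreeAbelianGroup Fˣ) = of 1 := rfl
  have mulof : ∀ a b, of a * of b = of (a * b) := fun a b => FreeAbelianGroup.of_mul_of a b
  have ψof : ∀ u, ψ (of u) = f u := fun u => FreeAbelianGroup.lift_apply_of _ _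
  have hJ : ∀ x ∈ J, ∀ r, ψ (r * x) = 0 := by
    intro x hx
    induction hx using Submodule.span_induction with
    | mem x hx =>
      intro r
      induction r using FreeAbelianGroup.induction_on with
      | zero => simp
      | of g =>
        change ψ (of g * x) = 0
        rcases hx with ⟨a, b, hab, rfl⟩ | rfl
        · have : of g * ((of a - 1) * (of b - 1)) =
              of (g * a * b) - of (g * a) - of (g * b) + of g := by
            rw [← mulof, ← mulof, ← mulof]
            ring
          rw [this, map_add, map_sub, map_sub, ψof, ψof, ψof, ψof, sub_sub, hst g a b hab]
          abel
        · rw [mul_add, mul_one, mulof, map_add, ψof, ψof, mul_neg_one, hneg, add_neg_cancel]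
      | neg g h => rw [neg_mul, map_neg, h, neg_zero]
      | add r s hr hs => rw [add_mul, map_add, hr, hs, add_zero]
    | zero => simp
    | add x y _ _ hx hy =>
      intro r
      rw [mul_add, map_add, hx, hy, add_zero]
    | smul a x _ hx =>
      intro r
      rw [smul_eq_mul, ← mul_assoc]
      exact hx _
  let ψ' : (FreeAbelianGroup Fˣ ⧸ J) →+ M :=
    QuotientAddGroup.lift J.toAddSubgroup ψ fun x hx => by simpa using hJ x hx 1
  let q : FreeAbelianGroup Fˣ →+* FreeAbelianGroup Fˣ ⧸ J := Ideal.Quotient.mk J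
  let Φ : KMW F →+* FreeAbelianGroup Fˣ ⧸ J := lift 1 (fun u => q (of u - 1))
    (by
      intro a b h
      rw [← map_mul]
      exact Ideal.Quotient.eq_zero_iff_mem.2 (Ideal.subset_span (Or.inl ⟨a, b, h, rfl⟩)))
    (by
      intro a b
      rw [one_mul, ← map_mul, ← map_add, ← map_add, ← mulof]
      congr 1
      ring)
    (by intros; simp)
    (by
      rw [one_mul, one_mul, ← map_ofNat q 2, ← map_add]
      refine Ideal.Quotient.eq_zero_iff_mem.2 ?_
      have : of (-1) - 1 + 2 = 1 + of (-1) := by ring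
      rw [this]
      exact Ideal.subset_span (Or.inr rfl))
  refine ⟨ψ'.comp (Φ.toAddMonoidHom.comp (homog F 1).subtype), fun u => ?_⟩
  have : Φ (symb u) = q (of u - 1) := lift_symb _ _ _ _ _ _ _
  change ψ' (Φ (symb u)) = _
  rw [this]
  change ψ (of u - 1) = _
  rw [map_sub, one, ψof, ψof]

end

end KMW

open IsDedekindDomain in
/-- The local ring `𝒪_{X,x}` of `X = Spec R` at the closed point `x`, as a subring of the
fraction field `K` of `R`. -/
noncomputable abbrev locRing {R : Type*} [CommRing R] [IsDedekindDomain R] (K : Type*) [Field K]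
    [Algebra R K] [IsFractionRing R K] (x : HeightOneSpectrum R) : ValuationSubring K :=
  (x.valuation K).valuationSubring

namespace ClosedPoint

open IsDedekindDomain IsLocalRing

section

variable {R : Type*} [CommRing R] [IsDedekindDomain R] (K : Type*) [Field K]
  [Algebra R K] [IsFractionRing R K] (x : HeightOneSpectrum R)

/-- The residue field `κ(x)`. -/
abbrev κ : Type _ := ResidueField (locRing K x)

/-- The normal line `(𝔪_x / 𝔪_x²)^∨` of the point `x`. -/
abbrev Nor : Type _ := Module.Dual (κ K x) (CotangentSpace (locRing K x))

variable {K}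

/-- The order `v_x : K^× → ℤ` at the point `x`, normalized so that uniformizers have order `1`. -/
noncomputable def ord : Kˣ →* Multiplicative ℤ := (x.valuationOfNeZero (K := K))⁻¹

theorem valuation_eq (u : Kˣ) : x.valuation K (u : K) = WithZero.exp (-(ord x u).toAdd) := by
  rw [← HeightOneSpectrum.valuationOfNeZero_eq]
  simp [ord, WithZero.exp]

theorem ord_eq_zero_iff (u : Kˣ) : (ord x u).toAdd = 0 ↔ u ∈ (locRing K x).unitGroup := by
  rw [Valuation.mem_unitGroup_iff, valuation_eq, ← WithZero.exp_zero, WithZero.exp_inj]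
  omega

theorem ord_pos_iff (u : Kˣ) : 0 < (ord x u).toAdd ↔ x.valuation K (u : K) < 1 := by
  rw [valuation_eq, ← WithZero.exp_zero, WithZero.exp_lt_exp]
  omega

theorem exists_ord_eq_one : ∃ π : Kˣ, ord x π = Multiplicative.ofAdd 1 := by
  obtain ⟨π, hπ⟩ := x.valuation_exists_uniformizer K
  have h0 : π ≠ 0 := by
    rintro rfl
    rw [map_zero] at hπ
    exact WithZero.exp_ne_zero hπ.symm
  refine ⟨Units.mk0 π h0, ?_⟩
  have := valuation_eq x (Units.mk0 π h0)
  rw [Units.val_mk0, hπ, WithZero.exp_inj] at this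
  exact Multiplicative.toAdd.injective (by simpa using this.symm)

variable {x} in
/-- The class in `𝔪_x / 𝔪_x²` of a uniformizer. -/
noncomputable def cotangentClass {π : Kˣ} (hπ : ord x π = Multiplicative.ofAdd 1) :
    CotangentSpace (locRing K x) :=
  (maximalIdeal (locRing K x)).toCotangent
    ⟨⟨π, by
      change x.valuation K (π : K) ≤ 1
      exact ((ord_pos_iff x π).1 (by simp [hπ])).le⟩, by
      rw [Valuation.mem_maximalIdeal_iff]
      exact (ord_pos_iff x π).1 (by simp [hπ])⟩

theorem cotangentClass_ne_zero {π : Kˣ} (hπ : ord x π = Multiplicative.ofAdd 1) :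
    cotangentClass hπ ≠ 0 := by
  intro h
  rw [cotangentClass, Ideal.toCotangent_eq_zero, pow_two] at h
  have key : ∀ z ∈ maximalIdeal (locRing K x) * maximalIdeal (locRing K x),
      x.valuation K (z : K) ≤ WithZero.exp (-2 : ℤ) := by
    have hm : ∀ z ∈ maximalIdeal (locRing K x), x.valuation K (z : K) ≤ WithZero.exp (-1 : ℤ) := by
      intro z hz
      rw [Valuation.mem_maximalIdeal_iff] at hz
      by_cases h0 : (z : K) = 0
      · simp [h0]
      have := valuation_eq x (Units.mk0 _ h0)
      rw [Units.val_mk0] at this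
      rw [this, ← WithZero.exp_zero, WithZero.exp_lt_exp] at hz
      rw [this, WithZero.exp_le_exp]
      omega
    intro z hz
    induction hz using Submodule.mul_induction_on' with
    | mem_mul_mem a ha b hb =>
      have : (WithZero.exp (-2 : ℤ)) = WithZero.exp (-1 : ℤ) * WithZero.exp (-1 : ℤ) := by
        rw [← WithZero.exp_add]; rfl
      rw [this, MulMemClass.coe_mul, map_mul]
      exact mul_le_mul' (hm a ha) (hm b hb)
    | add a _ b _ ha hb => exact (Valuation.map_add _ _ _).trans (max_le ha hb)
  have := key _ h
  rw [valuation_eq, WithZero.exp_le_exp, hπ] at this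
  simp at this

theorem exists_dual {π : Kˣ} (hπ : ord x π = Multiplicative.ofAdd 1) :
    ∃ ℓ : Nor K x, ℓ (cotangentClass hπ) = 1 := by
  obtain ⟨ℓ, _, hℓ⟩ := LinearMap.exists_extend_of_notMem
    (0 : (⊥ : Submodule (κ K x) (CotangentSpace (locRing K x))) →ₗ[κ K x] κ K x)
    (v := cotangentClass hπ) (by simpa using cotangentClass_ne_zero x hπ) 1
  exact ⟨ℓ, hℓ⟩

variable {x}

/-- The element `π^∨` of `(𝔪_x / 𝔪_x²)^∨` dual to a uniformizer `π`, that is `π^∨(π) = 1`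
(it is unique because `𝔪_x / 𝔪_x²` is a line). -/
noncomputable def dualVec {π : Kˣ} (hπ : ord x π = Multiplicative.ofAdd 1) : Nor K x :=
  (exists_dual x hπ).choose

theorem dualVec_apply {π : Kˣ} (hπ : ord x π = Multiplicative.ofAdd 1) :
    dualVec hπ (cotangentClass hπ) = 1 := (exists_dual x hπ).choose_spec

theorem dualVec_ne_zero {π : Kˣ} (hπ : ord x π = Multiplicative.ofAdd 1) : dualVec hπ ≠ 0 := by
  intro h
  have := dualVec_apply hπ
  rw [h] at this
  simp at this

theorem exists_smul_dualVec {π : Kˣ} (hπ : ord x π = Multiplicative.ofAdd 1) (m : Nor K x) :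
    ∃ a : κ K x, m = a • dualVec hπ := by
  have h1 : Module.finrank (κ K x) (Nor K x) = 1 := by
    rw [Subspace.dual_finrank_eq]
    exact IsLocalRing.finrank_CotangentSpace_eq_one _
  obtain ⟨a, ha⟩ := (finrank_eq_one_iff_of_nonzero' _ (dualVec_ne_zero hπ)).1 h1 m
  exact ⟨a, ha.symm⟩

/-- The homomorphism `K^× → κ(x)^×`, `u ↦ class of u π^{-n}` with `n = v_x(u)`. -/
noncomputable def leadCoeff {π : Kˣ} (hπ : ord x π = Multiplicative.ofAdd 1) : Kˣ →* (κ K x)ˣ :=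
  (locRing K x).unitGroupToResidueFieldUnits.comp
    { toFun := fun u => ⟨u * π ^ (-(ord x u).toAdd), by
        rw [← ord_eq_zero_iff]
        simp [hπ]⟩
      map_one' := by ext; simp
      map_mul' := fun u v => by
        refine Subtype.ext ?_
        change u * v * π ^ (-(ord x (u * v)).toAdd) =
          u * π ^ (-(ord x u).toAdd) * (v * π ^ (-(ord x v).toAdd))
        rw [map_mul, toAdd_mul, neg_add, zpow_add, mul_mul_mul_comm] }

theorem leadCoeff_of_unit {π : Kˣ} (hπ : ord x π = Multiplicative.ofAdd 1) {u : Kˣ}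
    (hu : u ∈ (locRing K x).unitGroup) :
    leadCoeff hπ u = (locRing K x).unitGroupToResidueFieldUnits ⟨u, hu⟩ := by
  have h := (ord_eq_zero_iff x u).2 hu
  simp only [leadCoeff, MonoidHom.comp_apply, MonoidHom.coe_mk, OneHom.coe_mk]
  congr 1
  ext
  simp [h]

theorem coe_leadCoeff {π : Kˣ} (hπ : ord x π = Multiplicative.ofAdd 1) {u : Kˣ}
    (hu : u ∈ (locRing K x).unitGroup) : (leadCoeff hπ u : κ K x) =
      residue (locRing K x) ((locRing K x).unitGroupMulEquiv ⟨u, hu⟩ : locRing K x) := by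
  rw [leadCoeff_of_unit hπ hu]
  rfl

theorem leadCoeff_add {π : Kˣ} (hπ : ord x π = Multiplicative.ofAdd 1) {u v : Kˣ}
    (hu : (ord x u).toAdd = 0) (hv : (ord x v).toAdd = 0) (h : (u : K) + v = 1) :
    (leadCoeff hπ u : κ K x) + leadCoeff hπ v = 1 := by
  rw [coe_leadCoeff hπ ((ord_eq_zero_iff x u).1 hu), coe_leadCoeff hπ ((ord_eq_zero_iff x v).1 hv),
    ← map_add, ← map_one (residue (locRing K x))]
  congr 1
  ext
  exact h

theorem leadCoeff_eq_one {π : Kˣ} (hπ : ord x π = Multiplicative.ofAdd 1) {u v : Kˣ}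
    (hu : 0 < (ord x u).toAdd) (h : (u : K) + v = 1) :
    (ord x v).toAdd = 0 ∧ leadCoeff hπ v = 1 := by
  have hv : (v : K) = 1 - u := by rw [← h]; ring
  rw [ord_pos_iff] at hu
  have hv0 : v ∈ (locRing K x).unitGroup := by
    rw [Valuation.mem_unitGroup_iff, hv]
    exact Valuation.map_one_sub_of_lt _ hu
  refine ⟨(ord_eq_zero_iff x v).2 hv0, ?_⟩
  ext
  rw [coe_leadCoeff hπ hv0, Units.val_one, ← map_one (residue (locRing K x)), ← sub_eq_zero,
    ← map_sub, residue_eq_zero_iff, Valuation.mem_maximalIdeal_iff]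
  have : ((((locRing K x).unitGroupMulEquiv ⟨v, hv0⟩ : locRing K x) - 1 : locRing K x) : K) =
      -(u : K) := by
    push_cast
    rw [ValuationSubring.coe_unitGroupMulEquiv_apply, hv]
    ring
  rw [this, Valuation.map_neg]
  exact hu

theorem leadCoeff_neg_one {π : Kˣ} (hπ : ord x π = Multiplicative.ofAdd 1) :
    leadCoeff hπ (-1) = -1 := by
  have h : (-1 : Kˣ) ∈ (locRing K x).unitGroup := by
    rw [Valuation.mem_unitGroup_iff]
    simp
  ext
  rw [coe_leadCoeff hπ h, Units.val_neg, Units.val_one, ← map_one (residue (locRing K x)),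
    ← map_neg]
  congr 1

theorem ord_neg_one : ord x (-1 : Kˣ) = 1 := by
  have h : (-1 : Kˣ) ∈ (locRing K x).unitGroup := by
    rw [Valuation.mem_unitGroup_iff]
    simp
  exact (ord_eq_zero_iff x _).2 h

open Classical in
/-- The second residue `K^× → W(κ(x), (𝔪_x / 𝔪_x²)^∨)` of the rank one form `⟨u⟩`. -/
noncomputable def wittRes {π : Kˣ} (hπ : ord x π = Multiplicative.ofAdd 1) (u : Kˣ) :
    Witt (κ K x) (Nor K x) :=
  if Odd (ord x u).toAdd then Witt.ofGW (GW.angle (dualVec_ne_zero hπ) (leadCoeff hπ u)) else 0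

theorem wittRes_neg {π : Kˣ} (hπ : ord x π = Multiplicative.ofAdd 1) (u : Kˣ) :
    wittRes hπ (-u) = -wittRes hπ u := by
  have : -u = -1 * u := by simp
  simp only [wittRes, this, map_mul, ord_neg_one, leadCoeff_neg_one, one_mul]
  split_ifs
  · rw [neg_one_mul, Witt.ofGW_neg]
  · simp

theorem wittRes_mul_unit {π : Kˣ} (hπ : ord x π = Multiplicative.ofAdd 1) (g u : Kˣ)
    (h : (ord x u).toAdd = 0 ∧ leadCoeff hπ u = 1) : wittRes hπ (g * u) = wittRes hπ g := by
  simp [wittRes, map_mul, h.1, h.2]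

theorem wittRes_mul_sq {π : Kˣ} (hπ : ord x π = Multiplicative.ofAdd 1) (g u : Kˣ) :
    wittRes hπ (g * u ^ 2) = wittRes hπ g := by
  simp [wittRes, map_mul, GW.angle_mul_sq, parity_simps]

theorem wittRes_steinberg_of_neg {π : Kˣ} (hπ : ord x π = Multiplicative.ofAdd 1) (g a b : Kˣ)
    (h : (a : K) + b = 1) (ha : (ord x a).toAdd < 0) :
    wittRes hπ (g * a) + wittRes hπ (g * b) = wittRes hπ g + wittRes hπ (g * a * b) := by
  have h1 : ((a⁻¹ : Kˣ) : K) + ((-(b * a⁻¹) : Kˣ) : K) = 1 := by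
    push_cast
    field_simp
    linear_combination -h
  have hv := leadCoeff_eq_one hπ (u := a⁻¹) (by rw [map_inv, toAdd_inv]; omega) h1
  have e1 : g * b = -(g * a * -(b * a⁻¹)) := by
    ext
    push_cast
    field_simp
  have e2 : g * a * b = -(g * a ^ 2 * -(b * a⁻¹)) := by
    ext
    push_cast
    field_simp
  rw [e1, e2, wittRes_neg, wittRes_neg, wittRes_mul_unit hπ _ _ hv, wittRes_mul_unit hπ _ _ hv,
    wittRes_mul_sq]
  abel

theorem wittRes_steinberg {π : Kˣ} (hπ : ord x π = Multiplicative.ofAdd 1) (g a b : Kˣ)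
    (h : (a : K) + b = 1) :
    wittRes hπ (g * a) + wittRes hπ (g * b) = wittRes hπ g + wittRes hπ (g * a * b) := by
  rcases lt_trichotomy 0 (ord x a).toAdd with ha | ha | ha
  · have hb := leadCoeff_eq_one hπ ha h
    rw [wittRes_mul_unit hπ g b hb, wittRes_mul_unit hπ _ b hb, add_comm]
  · rcases lt_trichotomy 0 (ord x b).toAdd with hb | hb | hb
    · have ha := leadCoeff_eq_one hπ hb ((add_comm _ _).trans h)
      rw [wittRes_mul_unit hπ g a ha, mul_right_comm, wittRes_mul_unit hπ _ a ha]
    · have := GW.angle_steinberg (dualVec_ne_zero hπ) (leadCoeff hπ g) _ _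
        (leadCoeff_add hπ ha.symm hb.symm h)
      simp only [wittRes, map_mul, toAdd_mul, ← ha, ← hb, add_zero]
      split_ifs
      · rw [← map_add, ← map_add, this]
      · rfl
    · rw [add_comm, mul_right_comm]
      exact wittRes_steinberg_of_neg hπ g b a ((add_comm _ _).trans h) hb
  · exact wittRes_steinberg_of_neg hπ g a b h ha

theorem eq_of_rank_of_ofGW {a b : GW (κ K x) (Nor K x)} (hr : GW.rank a = GW.rank b)
    (hw : Witt.ofGW a = Witt.ofGW b) : a = b := by
  obtain ⟨π, hπ⟩ := exists_ord_eq_one (K := K) x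
  rw [← sub_eq_zero]
  exact Witt.eq_zero_of_rank_of_ofGW (dualVec_ne_zero hπ) (exists_smul_dualVec hπ)
    (by rw [map_sub, hr, sub_self]) (by rw [map_sub, hw, sub_self])

theorem ofGW_nEps_leadCoeff {π : Kˣ} (hπ : ord x π = Multiplicative.ofAdd 1) (u : Kˣ) :
    Witt.ofGW (GW.nEps (dualVec_ne_zero hπ) (leadCoeff hπ u) (ord x u).toAdd) = wittRes hπ u :=
  Witt.ofGW_nEps _ _ _

theorem exists_residue {π : Kˣ} (hπ : ord x π = Multiplicative.ofAdd 1) :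
    ∃ φ : KMW.homog K 1 →+ GW (κ K x) (Nor K x), ∀ u : Kˣ, φ (KMW.symb₁ u) =
      GW.nEps (dualVec_ne_zero hπ) (leadCoeff hπ u) (ord x u).toAdd := by
  obtain ⟨χ, hχ⟩ := KMW.exists_wittHom (wittRes hπ) (wittRes_neg hπ) (wittRes_steinberg hπ)
  have h1 : wittRes hπ (1 : Kˣ) = 0 := by simp [wittRes]
  have ex : ∀ α : KMW.homog K 1, ∃ a : GW (κ K x) (Nor K x),
      GW.rank a = KMW.valHom (ord x) α ∧ Witt.ofGW a = χ α := by
    intro α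
    induction α using KMW.homog_one_induction with
    | hs u =>
      refine ⟨GW.nEps (dualVec_ne_zero hπ) (leadCoeff hπ u) (ord x u).toAdd, ?_, ?_⟩
      · rw [GW.rank_nEps, KMW.valHom_symb]
      · rw [ofGW_nEps_leadCoeff, hχ, h1, sub_zero]
    | h0 => exact ⟨0, by simp, by simp⟩
    | ha α β ha hb =>
      obtain ⟨a, h1, h2⟩ := ha
      obtain ⟨b, h3, h4⟩ := hb
      exact ⟨a + b, by simp [h1, h3], by simp [h2, h4]⟩
    | hn α ha =>
      obtain ⟨a, h1, h2⟩ := ha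
      exact ⟨-a, by simp [h1], by simp [h2]⟩
  choose φ h2 h3 using ex
  refine ⟨AddMonoidHom.mk' φ fun α β => eq_of_rank_of_ofGW ?_ ?_, fun u => eq_of_rank_of_ofGW ?_ ?_⟩
  · simp [h2]
  · simp [h3]
  · rw [AddMonoidHom.mk'_apply, h2, GW.rank_nEps, KMW.valHom_symb]
  · rw [AddMonoidHom.mk'_apply, h3, ofGW_nEps_leadCoeff, hχ, h1, sub_zero]

variable (x)

/-- A chosen uniformizer at `x`. -/
noncomputable def unif : Kˣ := (exists_ord_eq_one x).choose

theorem ord_unif : ord x (unif (K := K) x) = Multiplicative.ofAdd 1 :=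
  (exists_ord_eq_one x).choose_spec

/-- The residue homomorphism `∂_x : K^MW_1(K) → GW(κ(x), (𝔪_x / 𝔪_x²)^∨)`: the unique homomorphism
with `∂_x [u] = n_ε · ⟨class of u π^{-n}⟩ ⊗ π^∨`, where `n = v_x(u)`. By `residue_symb` it does not
depend on the uniformizer `π`. -/
noncomputable def residueHom : KMW.homog K 1 →+ GW (κ K x) (Nor K x) :=
  (exists_residue (ord_unif x)).choose

theorem rank_residueHom_symb (u : Kˣ) :
    GW.rank (residueHom x (KMW.symb₁ u)) = (ord x u).toAdd := by
  rw [residueHom, (exists_residue (ord_unif x)).choose_spec, GW.rank_nEps]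

theorem wittRes_eq {π ρ : Kˣ} (hπ : ord x π = Multiplicative.ofAdd 1)
    (hρ : ord x ρ = Multiplicative.ofAdd 1) (u : Kˣ) : wittRes hπ u = wittRes hρ u := by
  have hc0 : (ord x (π * ρ⁻¹)).toAdd = 0 := by simp [hπ, hρ]
  have hc := (ord_eq_zero_iff x _).1 hc0
  have h1 : cotangentClass hπ = (leadCoeff hρ (π * ρ⁻¹) : κ K x) • cotangentClass hρ := by
    rw [coe_leadCoeff hρ hc]
    change _ = ((locRing K x).unitGroupMulEquiv ⟨_, hc⟩ : locRing K x) • cotangentClass hρ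
    rw [cotangentClass, cotangentClass, ← map_smul]
    congr 1
    ext
    simp
  have h2 : dualVec hρ = (leadCoeff hρ (π * ρ⁻¹) : κ K x) • dualVec hπ := by
    obtain ⟨a, ha⟩ := exists_smul_dualVec hπ (dualVec hρ)
    have h3 := congrArg (fun f : Nor K x => f (cotangentClass hπ)) ha
    simp only [LinearMap.smul_apply, dualVec_apply] at h3
    rw [h1, map_smul, dualVec_apply] at h3
    simp only [smul_eq_mul, mul_one] at h3
    rw [h3]
    exact ha
  have h4 : leadCoeff hρ u = leadCoeff hπ u * leadCoeff hρ (π * ρ⁻¹) ^ (ord x u).toAdd := by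
    have h5 : leadCoeff hπ u = leadCoeff hρ (u * π ^ (-(ord x u).toAdd)) :=
      (leadCoeff_of_unit hρ _).symm
    have h6 : leadCoeff hρ ρ = 1 := by
      have : (1 : Kˣ) ∈ (locRing K x).unitGroup := one_mem _
      rw [← map_one (leadCoeff hρ), leadCoeff_of_unit hρ this]
      simp only [leadCoeff, MonoidHom.comp_apply, MonoidHom.coe_mk, OneHom.coe_mk]
      congr 1
      ext
      simp [hρ]
    rw [h5, ← map_zpow, ← map_mul, mul_zpow, zpow_neg, mul_assoc, inv_mul_cancel_left, map_mul,
      map_zpow, map_inv, h6]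
    simp
  simp only [wittRes]
  split_ifs with h
  · obtain ⟨n, hn⟩ := h
    rw [GW.angle_smul (dualVec_ne_zero hπ) (dualVec_ne_zero hρ) _ _ h2, h4, hn]
    have h7 : ∀ a c : (κ K x)ˣ, a * c ^ (2 * n + 1) * c = a * (c ^ (n + 1)) ^ 2 := fun a c => by
      rw [mul_assoc, ← zpow_add_one, ← zpow_natCast, ← zpow_mul]
      congr 2
      push_cast
      ring
    rw [h7, GW.angle_mul_sq]
  · rfl

/-- The formula for the residue of a symbol, for an arbitrary uniformizer. -/
theorem residue_symb {π : Kˣ} (hπ : ord x π = Multiplicative.ofAdd 1) (u : Kˣ) :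
    residueHom x (KMW.symb₁ u) =
      GW.nEps (dualVec_ne_zero hπ) (leadCoeff hπ u) (ord x u).toAdd := by
  refine eq_of_rank_of_ofGW ?_ ?_
  · rw [rank_residueHom_symb, GW.rank_nEps]
  · rw [residueHom, (exists_residue (ord_unif x)).choose_spec, ofGW_nEps_leadCoeff,
      ofGW_nEps_leadCoeff, wittRes_eq]

end

end ClosedPoint

namespace ChowWitt

open IsDedekindDomain ClosedPoint

section

variable (R : Type*) [CommRing R] [IsDedekindDomain R] (K : Type*) [Field K]
  [Algebra R K] [IsFractionRing R K]

/-- The group `Z_0(X)` of zero-cycles on `X = Spec R`: the free abelian group on the closed points,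
that is on the maximal ideals of `R` (for `R` a Dedekind domain that is not a field). -/
abbrev ZeroCycles : Type _ := HeightOneSpectrum R →₀ ℤ

/-- The group `⨁_x GW(κ(x), (𝔪_x / 𝔪_x²)^∨)`, the sum over the closed points `x`. -/
abbrev GWCycles : Type _ := DirectSum (HeightOneSpectrum R) fun x => GW (κ K x) (Nor K x)

variable {K} in
theorem finite_ord_ne (u : Kˣ) : {x : HeightOneSpectrum R | (ord x u).toAdd ≠ 0}.Finite := by
  refine ((HeightOneSpectrum.Support.finite R (u : K)).union
    (HeightOneSpectrum.Support.finite R ((u⁻¹ : Kˣ) : K))).subset fun x hx => ?_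
  rcases lt_or_gt_of_ne hx with h | h
  · left
    change 1 < x.valuation K (u : K)
    rw [valuation_eq, ← WithZero.exp_zero, WithZero.exp_lt_exp]
    omega
  · right
    change 1 < x.valuation K ((u⁻¹ : Kˣ) : K)
    rw [valuation_eq, ← WithZero.exp_zero, WithZero.exp_lt_exp, map_inv, toAdd_inv]
    omega

/-- The divisor map `div : K^× → Z_0(X)`, `u ↦ ∑_x v_x(u) · x`. -/
noncomputable def divisor : Additive Kˣ →+ ZeroCycles R :=
  AddMonoidHom.mk' (fun u => Finsupp.ofSupportFinite (fun x => (ord x u.toMul).toAdd)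
    (finite_ord_ne R u.toMul)) fun u v => by
      ext x
      rw [Finsupp.add_apply]
      simp only [Finsupp.ofSupportFinite_coe, toMul_add, map_mul, toAdd_mul]
      rfl

theorem divisor_apply (u : Kˣ) (x : HeightOneSpectrum R) :
    divisor R K (Additive.ofMul u) x = (ord x u).toAdd := rfl

/-- The Chow group `CH^1(X) = Z_0(X) / div(K^×)`. -/
def CH1 : Type _ := ZeroCycles R ⧸ (divisor R K).range

noncomputable instance : AddCommGroup (CH1 R K) :=
  inferInstanceAs (AddCommGroup (_ ⧸ (divisor R K).range))

/-- The class of a cycle. -/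
noncomputable def CH1.mk : ZeroCycles R →+ CH1 R K := QuotientAddGroup.mk' _

variable {K} in
theorem finite_residue_ne (α : KMW.homog K 1) :
    {x : HeightOneSpectrum R | residueHom x α ≠ 0}.Finite := by
  induction α using KMW.homog_one_induction with
  | hs u =>
    refine (finite_ord_ne R u).subset fun x hx h => hx ?_
    rw [residue_symb x (ord_unif x), h]
    simp [GW.nEps]
  | h0 => simp
  | ha α β ha hb =>
    refine (ha.union hb).subset fun x hx => ?_
    by_contra h
    simp only [Set.mem_union, Set.mem_ofPred_eq, not_or, not_not] at h
    exact hx (by simp [h.1, h.2])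
  | hn α ha => simpa using ha

open Classical in
variable {K} in
/-- The element `∑_x ∂_x(α)` of `⨁_x GW(κ(x), (𝔪_x / 𝔪_x²)^∨)`. -/
noncomputable def residueCycle (α : KMW.homog K 1) : GWCycles R K :=
  DirectSum.mk (fun x : HeightOneSpectrum R => GW (κ K x) (Nor K x))
    (finite_residue_ne R α).toFinset fun x => residueHom x.1 α

variable {K} in
theorem residueCycle_apply (α : KMW.homog K 1) (x : HeightOneSpectrum R) :
    residueCycle R α x = residueHom x α := by
  classical
  by_cases h : x ∈ (finite_residue_ne R α).toFinset
  · exact DirectSum.mk_apply_of_mem h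
  · refine (DirectSum.mk_apply_of_notMem h).trans ?_
    simpa [eq_comm] using h

/-- The quadratic divisor map `K^MW_1(K) → ⨁_x GW(κ(x), (𝔪_x / 𝔪_x²)^∨)`, `α ↦ ∑_x ∂_x(α)`. -/
noncomputable def quadDivisor : KMW.homog K 1 →+ GWCycles R K :=
  AddMonoidHom.mk' (residueCycle R) fun α β => DFinsupp.ext fun x => by
    change residueCycle R (α + β) x = (residueCycle R α + residueCycle R β) x
    rw [DirectSum.add_apply, residueCycle_apply, residueCycle_apply, residueCycle_apply, map_add]

theorem quadDivisor_apply (α : KMW.homog K 1) (x : HeightOneSpectrum R) :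
    quadDivisor R K α x = residueHom x α := residueCycle_apply R α x

/-- The Chow-Witt group of codimension one cycles, `⨁_x GW(κ(x), (𝔪_x / 𝔪_x²)^∨) / K^MW_1(K)`. -/
def ChowWitt1 : Type _ := GWCycles R K ⧸ (quadDivisor R K).range

noncomputable instance : AddCommGroup (ChowWitt1 R K) :=
  inferInstanceAs (AddCommGroup (_ ⧸ (quadDivisor R K).range))

/-- The class of a cycle. -/
noncomputable def ChowWitt1.mk : GWCycles R K →+ ChowWitt1 R K := QuotientAddGroup.mk' _

open Classical in
/-- Multiplication by `h`, the homomorphism `Z_0(X) → ⨁_x GW(κ(x), (𝔪_x / 𝔪_x²)^∨)` that sends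
`x` to the hyperbolic class at `x`. -/
noncomputable def hypCycles : ZeroCycles R →+ GWCycles R K :=
  Finsupp.liftAddHom fun x => zmultiplesHom _ (DirectSum.of (fun x => GW (κ K x) (Nor K x)) x
    (GW.hyp (dualVec_ne_zero (ord_unif x))))

theorem hypCycles_apply (z : ZeroCycles R) (x : HeightOneSpectrum R) :
    hypCycles R K z x = z x • GW.hyp (k := κ K x) (dualVec_ne_zero (ord_unif (K := K) x)) := by
  classical
  induction z using Finsupp.induction_linear with
  | zero => simp
  | add z w hz hw => simp [hz, hw, add_smul]
  | single y n =>
    rw [hypCycles, Finsupp.liftAddHom_apply_single, zmultiplesHom_apply, DirectSum.smul_apply]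
    by_cases h : y = x
    · subst h
      simp [DirectSum.of_eq_same]
    · rw [DirectSum.of_eq_of_ne _ _ _ (Ne.symm h)]
      simp [h]

/-- `h · div(u) = ∑_x ∂_x(h [u])`, where `h [u] = [u²]`. -/
theorem hypCycles_divisor (u : Kˣ) :
    hypCycles R K (divisor R K (Additive.ofMul u)) = quadDivisor R K (KMW.symb₁ (u ^ 2)) := by
  refine DFinsupp.ext fun x => ?_
  change hypCycles R K _ x = quadDivisor R K _ x
  rw [hypCycles_apply, quadDivisor_apply, divisor_apply, residue_symb x (ord_unif x)]
  refine eq_of_rank_of_ofGW ?_ ?_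
  · rw [GW.rank_nEps]
    simp [mul_comm]
  · rw [ofGW_nEps_leadCoeff, map_zsmul, Witt.ofGW_hyp]
    simp [wittRes]

/-- The homomorphism `CH^1(X) → CH~^1(X)` induced by multiplication by `h`. -/
noncomputable def hypMap : CH1 R K →+ ChowWitt1 R K :=
  QuotientAddGroup.map _ _ (hypCycles R K) <| by
    rintro _ ⟨u, rfl⟩
    exact ⟨KMW.symb₁ (u.toMul ^ 2), (hypCycles_divisor R K u.toMul).symm⟩

open Classical in
/-- The homomorphism `⨁_x GW(κ(x), (𝔪_x / 𝔪_x²)^∨) → CH^1(X) / 2` that sends `a` at `x` to the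
class of `x` times the rank modulo two of the Witt class of `a`. -/
noncomputable def modHCycles : GWCycles R K →+ ModN (CH1 R K) 2 :=
  DirectSum.toAddMonoid fun x =>
    (((LinearMap.toSpanSingleton (ZMod 2) (ModN (CH1 R K) 2)
      (ModN.mkQ 2 (CH1.mk R K (Finsupp.single x 1)))).toAddMonoidHom).comp
      Witt.rankModTwo).comp Witt.ofGW

open Classical in
theorem modHCycles_eq (z : GWCycles R K) (d : ZeroCycles R)
    (h : ∀ x, GW.rank (z x) = d x) : modHCycles R K z = ModN.mkQ 2 (CH1.mk R K d) := by
  let r : GWCycles R K →+ ZeroCycles R :=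
    DirectSum.toAddMonoid fun x => (Finsupp.singleAddHom x).comp GW.rank
  have hr : ∀ z x, r z x = GW.rank (z x) := by
    intro z x
    induction z using DirectSum.induction_on with
    | zero => simp
    | of y a =>
      simp only [r, DirectSum.toAddMonoid_of]
      by_cases h : y = x
      · subst h
        simp [DirectSum.of_eq_same]
      · rw [DirectSum.of_eq_of_ne _ _ _ (Ne.symm h)]
        simp [h]
    | add z w hz hw => simp [hz, hw]
  have hd : d = r z := by
    ext x
    rw [hr, h]
  have : modHCycles R K = ((ModN.mkQ 2).comp (CH1.mk R K)).comp r := by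
    refine DirectSum.addHom_ext fun x a => ?_
    simp only [modHCycles, r, DirectSum.toAddMonoid_of, AddMonoidHom.comp_apply,
      Witt.rankModTwo_ofGW, Finsupp.singleAddHom_apply,
      LinearMap.toAddMonoidHom_coe, LinearMap.toSpanSingleton_apply]
    rw [Int.cast_smul_eq_zsmul, ← map_zsmul, ← map_zsmul, Finsupp.smul_single, smul_eq_mul, mul_one]
  rw [hd, this]
  rfl

/-- The homomorphism `CH~^1(X) → CH^1(X) / 2` induced by reduction modulo `h`. -/
noncomputable def modHMap : ChowWitt1 R K →+ ModN (CH1 R K) 2 :=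
  QuotientAddGroup.lift _ (modHCycles R K) <| by
    rintro _ ⟨α, rfl⟩
    rw [AddMonoidHom.mem_ker]
    induction α using KMW.homog_one_induction with
    | hs u =>
      rw [modHCycles_eq R K _ (divisor R K (Additive.ofMul u)) fun x => by
        rw [quadDivisor_apply, rank_residueHom_symb, divisor_apply]]
      have : CH1.mk R K (divisor R K (Additive.ofMul u)) = 0 :=
        (QuotientAddGroup.eq_zero_iff _).2 ⟨_, rfl⟩
      rw [this, map_zero]
    | h0 => simp
    | ha α β ha hb => rw [map_add, map_add, ha, hb, add_zero]
    | hn α ha => rw [map_neg, map_neg, ha, neg_zero]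

end

end ChowWitt

/-! Surjectivity onto `CH^1 / 2` and vanishing of the composite follow from ranks. If a cycle `z`
maps to zero, its rank divisor has the form `2e + div u`; subtracting `h · e` and the residues of
`[u]` leaves a cycle of rank zero at every point. Everything thus rests on
`mem_range_sup_range_of_rank_eq_zero`: rank-zero cycles lie in the subgroup `N` spanned by quadratic
divisors and hyperbolic cycles.

If this failed, some `ℚ/ℤ`-valued character would kill `N` but not the cycle. At `x` it restricts to
a homomorphism `φ` on `GW(κ(x))` that kills `h`. As `κ(x)` is finite, `u ↦ φ⟨u⟩ - φ⟨1⟩` is a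
homomorphism into the 2-torsion, that is, a sign character `ψ x` of `κ(x)^×`. Vanishing on the
residues of `[ac] - [a] - [c]` becomes a product formula for quadratic tame symbols at finite
places: `∏ ψ x (tame x a c) = 1` for all `a`, `c`. It must be shown that no such formula exists
unless every `ψ x` is trivial (`eq_one_of_finprod_tame_eq_one`). Then the character depends only on
ranks and kills the cycle.

Let `T` be the set of primes with `ψ p ≠ 1`, and suppose it is nonempty. It cannot be a single
prime, so there are two, and elements `a`, `b` with independent ramification at them. The product
formula makes `a`, `b`, `ab` define quadratic ideal characters whose values on principal ideals
depend only on residues of a generator (`symChar_span`). Their Dirichlet series stay bounded as `s →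
1` (`exists_tsum_char_le`); as the characters are trivial off `T`, this forces `T` to have density
at least 3/4. On the other hand, the elements with even divisor give more square classes than the
class group has quadratic characters, so some nonsquare `β` has trivial character
(`exists_not_isSquare_symChar_eq_one`). Outside finitely many exceptions the primes of `T` split in
`K(√β)`, so `T` has density at most 1/2. These two estimates contradict each other in
`false_of_split_of_char`.

The analytic bound avoids counting lattice points. A sum over principal ideals becomes a sum over
all integers, weighted by a Lipschitz partition of unity for the unit lattice; a periodic function
of mean zero then only sees differences of weights, which are summable uniformly in `s`. -/

set_option linter.unusedSectionVars false

/-! ### A Lipschitz partition of unity for the unit lattice -/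

namespace NumberField.UnitCutoff

open NumberField NumberField.InfinitePlace NumberField.mixedEmbedding NumberField.Units
  NumberField.Units.dirichletUnitTheorem Module

/-- The tent function `max (1 - |y|) 0`. -/
noncomputable def tent (y : ℝ) : ℝ := max (1 - |y|) 0

theorem tent_nonneg (y : ℝ) : 0 ≤ tent y := le_max_right _ _

theorem tent_le_one (y : ℝ) : tent y ≤ 1 :=
  max_le (by linarith [abs_nonneg y]) zero_le_one

theorem abs_lt_one_of_tent_ne_zero {y : ℝ} (h : tent y ≠ 0) : |y| < 1 := by
  by_contra h1
  exact h (max_eq_right (by linarith))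

theorem abs_tent_sub_tent_le (y z : ℝ) : |tent y - tent z| ≤ |y - z| := by
  refine (abs_max_sub_max_le_abs _ _ _).trans ?_
  rw [sub_sub_sub_cancel_left, abs_sub_comm]
  exact abs_abs_sub_abs_le _ _

theorem tent_add_int_eq_zero {y : ℝ} {k : ℤ} (h : k ∉ ({-⌊y⌋, -⌊y⌋ - 1} : Finset ℤ)) :
    tent (y + k) = 0 := by
  simp only [Finset.mem_insert, Finset.mem_singleton, not_or] at h
  refine max_eq_right ?_
  rw [sub_nonpos]
  have h1 := Int.floor_le y
  have h2 := Int.lt_floor_add_one y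
  rcases lt_or_gt_of_ne h.1 with h3 | h3
  · have : k ≤ -⌊y⌋ - 2 := by omega
    have : (k : ℝ) ≤ -⌊y⌋ - 2 := by exact_mod_cast this
    rw [le_abs]
    right
    linarith
  · have : -⌊y⌋ + 1 ≤ k := by omega
    have : -(⌊y⌋ : ℝ) + 1 ≤ k := by exact_mod_cast this
    rw [le_abs]
    left
    linarith

/-- If `f` is the fractional part of `y`, the only translates that can meet the support are `f` and
`f - 1`, where the tent takes the values `1 - f` and `f`. -/
theorem sum_tent_add_int (y : ℝ) :
    ∑ k ∈ ({-⌊y⌋, -⌊y⌋ - 1} : Finset ℤ), tent (y + k) = 1 := by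
  have h1 := Int.floor_le y
  have h2 := Int.lt_floor_add_one y
  rw [Finset.sum_pair (by omega), tent, tent]
  push_cast
  rw [abs_of_nonneg (by linarith), abs_of_nonpos (by linarith), max_eq_left (by linarith),
    max_eq_left (by linarith)]
  ring

theorem hasSum_prod_tent {ι : Type*} [Fintype ι] (y : ι → ℝ) :
    HasSum (fun k : ι → ℤ => ∏ i, tent (y i + k i)) 1 := by
  classical
  have h := Finset.prod_univ_sum (fun i => ({-⌊y i⌋, -⌊y i⌋ - 1} : Finset ℤ))
    (fun i k => tent (y i + k))
  simp only [sum_tent_add_int, Finset.prod_const_one] at h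
  rw [h]
  refine hasSum_sum_of_ne_finset_zero fun k hk => ?_
  simp only [Fintype.mem_piFinset, not_forall] at hk
  obtain ⟨i, hi⟩ := hk
  exact Finset.prod_eq_zero (Finset.mem_univ i) (tent_add_int_eq_zero hi)

/-- Telescoping, one factor exchanged at a time; this makes the product `cutoff` Lipschitz. -/
theorem abs_prod_sub_prod_le {ι : Type*} (s : Finset ι) (f g : ι → ℝ)
    (hf : ∀ i, |f i| ≤ 1) (hg : ∀ i, |g i| ≤ 1) :
    |∏ i ∈ s, f i - ∏ i ∈ s, g i| ≤ ∑ i ∈ s, |f i - g i| := by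
  classical
  induction s using Finset.induction_on with
  | empty => simp
  | insert a s ha ih =>
    rw [Finset.prod_insert ha, Finset.prod_insert ha, Finset.sum_insert ha]
    have h1 : |∏ i ∈ s, g i| ≤ 1 := by
      rw [Finset.abs_prod]
      exact Finset.prod_le_one (fun _ _ => abs_nonneg _) fun i _ => hg i
    calc |f a * ∏ i ∈ s, f i - g a * ∏ i ∈ s, g i|
        = |f a * (∏ i ∈ s, f i - ∏ i ∈ s, g i) + (f a - g a) * ∏ i ∈ s, g i| := by ring_nf
      _ ≤ |f a| * |∏ i ∈ s, f i - ∏ i ∈ s, g i| + |f a - g a| * |∏ i ∈ s, g i| := by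
        rw [← abs_mul, ← abs_mul]
        exact abs_add_le _ _
      _ ≤ 1 * |∏ i ∈ s, f i - ∏ i ∈ s, g i| + |f a - g a| * 1 := by
        gcongr
        exact hf a
      _ ≤ _ := by linarith

section

open scoped Classical

variable (K : Type*) [Field K] [NumberField K]

/-- A basis of the logarithmic space that is a `ℤ`-basis of the unit lattice. -/
noncomputable def unitBasis : Basis (Fin (Units.rank K)) ℝ (logSpace K) :=
  (basisUnitLattice K).ofZLatticeBasis ℝ (unitLattice K)

variable {K} in
/-- A compactly supported Lipschitz function on the logarithmic space, whose translates by the unit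
lattice form a partition of unity. -/
noncomputable def cutoff (y : logSpace K) : ℝ := ∏ i, tent ((unitBasis K).repr y i)

theorem cutoff_nonneg (y : logSpace K) : 0 ≤ cutoff y :=
  Finset.prod_nonneg fun _ _ => tent_nonneg _

theorem cutoff_le_one (y : logSpace K) : cutoff y ≤ 1 :=
  Finset.prod_le_one (fun _ _ => tent_nonneg _) fun _ _ => tent_le_one _

theorem exists_norm_le_of_cutoff_ne_zero :
    ∃ R : ℝ, ∀ y : logSpace K, cutoff y ≠ 0 → ‖y‖ ≤ R := by
  refine ⟨∑ i, ‖unitBasis K i‖, fun y hy => ?_⟩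
  rw [cutoff, Finset.prod_ne_zero_iff] at hy
  rw [← (unitBasis K).sum_repr y]
  refine (norm_sum_le _ _).trans (Finset.sum_le_sum fun i hi => ?_)
  rw [_root_.norm_smul, Real.norm_eq_abs]
  exact mul_le_of_le_one_left (norm_nonneg _) (abs_lt_one_of_tent_ne_zero (hy i hi)).le

theorem exists_abs_cutoff_sub_le :
    ∃ C : ℝ, 0 ≤ C ∧ ∀ y z : logSpace K, |cutoff y - cutoff z| ≤ C * ‖y - z‖ := by
  have : ∀ i, ∃ C : ℝ, 0 ≤ C ∧ ∀ y, |(unitBasis K).repr y i| ≤ C * ‖y‖ := fun i => by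
    let f := LinearMap.toContinuousLinearMap ((unitBasis K).coord i)
    exact ⟨‖f‖, norm_nonneg _, fun y => f.le_opNorm y⟩
  choose C hC0 hC using this
  refine ⟨∑ i, C i, Finset.sum_nonneg fun i _ => hC0 i, fun y z => ?_⟩
  rw [cutoff, cutoff, Finset.sum_mul]
  refine (abs_prod_sub_prod_le _ _ _ (fun i => ?_) fun i => ?_).trans
    (Finset.sum_le_sum fun i _ => ?_)
  · rw [abs_of_nonneg (tent_nonneg _)]
    exact tent_le_one _
  · rw [abs_of_nonneg (tent_nonneg _)]
    exact tent_le_one _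
  · refine (abs_tent_sub_tent_le _ _).trans ?_
    have := hC i (y - z)
    rwa [map_sub, Finsupp.sub_apply] at this

theorem logEmbedding_prod_fundSystem (k : Fin (Units.rank K) → ℤ) :
    logEmbedding K (Additive.ofMul (∏ i, fundSystem K i ^ k i)) =
      ∑ i, (k i : ℝ) • unitBasis K i := by
  rw [ofMul_prod, map_sum]
  refine Finset.sum_congr rfl fun i _ => ?_
  rw [ofMul_zpow, map_zsmul, logEmbedding_fundSystem, unitBasis, Basis.ofZLatticeBasis_apply,
    Int.cast_smul_eq_zsmul]

theorem cutoff_torsion_mul (ζ : torsion K) (k : Fin (Units.rank K) → ℤ) (y : logSpace K) :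
    cutoff (logEmbedding K (Additive.ofMul ((ζ : (𝓞 K)ˣ) * ∏ i, fundSystem K i ^ k i)) + y) =
      ∏ i, tent ((unitBasis K).repr y i + k i) := by
  have h0 : logEmbedding K (Additive.ofMul (ζ : (𝓞 K)ˣ)) = 0 := logEmbedding_eq_zero_iff.2 ζ.2
  rw [ofMul_mul, map_add, h0, zero_add, logEmbedding_prod_fundSystem, cutoff]
  refine Finset.prod_congr rfl fun i _ => ?_
  rw [map_add, Finsupp.add_apply, Basis.repr_sum_self, add_comm]

theorem hasSum_torsion_one : HasSum (fun _ : torsion K => (1 : ℝ)) (torsionOrder K) := by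
  have := Fintype.ofFinite (torsion K)
  have h := hasSum_fintype fun _ : torsion K => (1 : ℝ)
  rw [Finset.sum_const, nsmul_one, Finset.card_univ, ← Nat.card_eq_fintype_card] at h
  exact h

theorem hasSum_prod_const {α β : Type*} {f : β → ℝ} {a b : ℝ} (hf : ∀ x, 0 ≤ f x)
    (h1 : HasSum (fun _ : α => (1 : ℝ)) a) (h2 : HasSum f b) :
    HasSum (fun p : α × β => f p.2) (a * b) := by
  simpa only [one_mul] using
    h1.mul h2 (h1.summable.mul_of_nonneg h2.summable (fun _ => zero_le_one) hf)

theorem hasSum_prod_tent_torsion (y : logSpace K) :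
    HasSum (fun p : torsion K × (Fin (Units.rank K) → ℤ) =>
      ∏ i, tent ((unitBasis K).repr y i + p.2 i)) (torsionOrder K) := by
  have := hasSum_prod_const
    (fun k => Finset.prod_nonneg fun _ _ => tent_nonneg _) (hasSum_torsion_one K)
    (hasSum_prod_tent fun i => (unitBasis K).repr y i)
  rwa [mul_one] at this

theorem bijective_torsion_mul_prod : Function.Bijective
    fun p : torsion K × (Fin (Units.rank K) → ℤ) => (p.1 : (𝓞 K)ˣ) * ∏ i, fundSystem K i ^ p.2 i := by
  rw [Function.bijective_iff_existsUnique]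
  intro u
  obtain ⟨p, h1, h2⟩ := exist_unique_eq_mul_prod K u
  exact ⟨p, h1.symm, fun q hq => h2 q hq.symm⟩

/-- By Dirichlet's unit theorem a unit is a root of unity times a product of integer powers of
fundamental units. Roots of unity do not move the logarithmic space and contribute the factor
`torsionOrder K`; the other factor runs through the unit lattice, whose translates of `cutoff` sum
to one. -/
theorem hasSum_cutoff_units (y : logSpace K) :
    HasSum (fun u : (𝓞 K)ˣ => cutoff (logEmbedding K (Additive.ofMul u) + y))
      (torsionOrder K) := by
  rw [← (Equiv.ofBijective _ (bijective_torsion_mul_prod K)).hasSum_iff]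
  convert hasSum_prod_tent_torsion K y using 1
  funext p
  exact cutoff_torsion_mul K p.1 p.2 y

end

end NumberField.UnitCutoff

/-! ### Archimedean estimates for the weights -/

namespace NumberField.UnitCutoff

open NumberField NumberField.InfinitePlace NumberField.mixedEmbedding NumberField.Units
  NumberField.Units.dirichletUnitTheorem Module

section

open scoped Classical

variable {K : Type*} [Field K] [NumberField K]

theorem normAtPlace_le_norm (w : InfinitePlace K) (x : mixedSpace K) : normAtPlace w x ≤ ‖x‖ := by
  rw [norm_eq_sup'_normAtPlace]
  exact Finset.le_sup' (fun w => normAtPlace w x) (Finset.mem_univ w)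

theorem abs_normAtPlace_sub_le (w : InfinitePlace K) (x y : mixedSpace K) :
    |normAtPlace w x - normAtPlace w y| ≤ ‖x - y‖ := by
  have key : ∀ x y : mixedSpace K, normAtPlace w x - normAtPlace w y ≤ ‖x - y‖ := fun x y => by
    have := normAtPlace_add_le w (x - y) y
    rw [sub_add_cancel] at this
    linarith [normAtPlace_le_norm w (x - y)]
  rw [abs_le]
  have := key y x
  rw [norm_sub_rev] at this
  exact ⟨by linarith, key x y⟩

theorem log_norm_eq {x : mixedSpace K} (hx : mixedEmbedding.norm x ≠ 0) :
    Real.log (mixedEmbedding.norm x) = ∑ w, mult w * Real.log (normAtPlace w x) := by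
  rw [mixedEmbedding.norm_apply, Real.log_prod fun w _ =>
    pow_ne_zero _ (mixedEmbedding.norm_ne_zero_iff.1 hx w)]
  simp [Real.log_pow]

variable (K) in
theorem sum_mult_cast : ∑ w : InfinitePlace K, (mult w : ℝ) = finrank ℚ K := by
  rw [← Nat.cast_sum, sum_mult_eq]

variable (K) in
theorem finrank_cast_pos : (0 : ℝ) < finrank ℚ K := Nat.cast_pos.2 finrank_pos

/-- `logMap` forgets the place `w₀`. The normalized logarithms, weighted by `mult`, sum to zero, so
`w₀` is controlled by the remaining places; this costs the factor counting the places. -/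
theorem abs_log_sub_le_of_norm_logMap_le {x : mixedSpace K} (hx : mixedEmbedding.norm x ≠ 0) {R : ℝ}
    (h : ‖logMap x‖ ≤ R) (w : InfinitePlace K) :
    |Real.log (normAtPlace w x) - Real.log (mixedEmbedding.norm x) * (finrank ℚ K : ℝ)⁻¹| ≤
      Fintype.card (InfinitePlace K) * R := by
  have hR : 0 ≤ R := (norm_nonneg _).trans h
  have hcomp : ∀ w : {w : InfinitePlace K // w ≠ w₀}, |logMap x w| ≤ R := fun w =>
    (norm_le_pi_norm (logMap x) w).trans h
  set a := Real.log (mixedEmbedding.norm x) * (finrank ℚ K : ℝ)⁻¹ with ha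
  have hdiv : ∀ w : InfinitePlace K, |Real.log (normAtPlace w x) - a| ≤
      |mult w * (Real.log (normAtPlace w x) - a)| := fun w => by
    rw [abs_mul]
    refine le_mul_of_one_le_left (abs_nonneg _) ?_
    rw [abs_of_nonneg (by positivity)]
    exact_mod_cast one_le_mult
  have hcard : (1 : ℝ) ≤ Fintype.card (InfinitePlace K) := by
    exact_mod_cast Fintype.card_pos
  refine (hdiv w).trans ?_
  by_cases hw : w = w₀
  · subst hw
    have hsum : ∑ w : InfinitePlace K, (mult w : ℝ) * (Real.log (normAtPlace w x) - a) = 0 := by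
      simp only [mul_sub, Finset.sum_sub_distrib, ← log_norm_eq hx, ← Finset.sum_mul,
        sum_mult_cast]
      rw [ha, mul_comm (Real.log _), mul_inv_cancel_left₀ (finrank_cast_pos K).ne', sub_self]
    rw [Fintype.sum_eq_add_sum_subtype_ne _ w₀, add_eq_zero_iff_eq_neg] at hsum
    rw [hsum, abs_neg]
    refine (Finset.abs_sum_le_sum_abs _ _).trans ((Finset.sum_le_sum fun w _ => hcomp w).trans ?_)
    rw [Finset.sum_const, nsmul_eq_mul, Finset.card_univ]
    gcongr
    exact Fintype.card_subtype_le _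
  · exact (hcomp ⟨w, hw⟩).trans (le_mul_of_one_le_left hR hcard)

theorem norm_pos_of_norm_ne_zero {x : mixedSpace K} (hx : mixedEmbedding.norm x ≠ 0) : 0 < ‖x‖ :=
  ((normAtPlace_nonneg w₀ x).lt_of_ne' (mixedEmbedding.norm_ne_zero_iff.1 hx w₀)).trans_le
    (normAtPlace_le_norm _ x)

variable (K) in
/-- On the support of the cutoff function, all archimedean absolute values are comparable. -/
theorem exists_mul_norm_le_normAtPlace : ∃ κ : ℝ, 0 < κ ∧ ∀ x : mixedSpace K,
    mixedEmbedding.norm x ≠ 0 → cutoff (logMap x) ≠ 0 → ∀ w, κ * ‖x‖ ≤ normAtPlace w x := by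
  obtain ⟨R, hR⟩ := exists_norm_le_of_cutoff_ne_zero K
  -- The logarithms at `w` and at the place of largest absolute value each differ from the same mean
  -- by at most the number of places times `R`.
  refine ⟨Real.exp (-(2 * (Fintype.card (InfinitePlace K) * R))), Real.exp_pos _,
    fun x hx hc w => ?_⟩
  have hpos : ∀ w, 0 < normAtPlace w x := fun w =>
    (normAtPlace_nonneg w x).lt_of_ne' (mixedEmbedding.norm_ne_zero_iff.1 hx w)
  obtain ⟨v, -, hv⟩ := Finset.exists_mem_eq_sup' Finset.univ_nonempty fun w => normAtPlace w x
  rw [norm_eq_sup'_normAtPlace, hv, ← Real.exp_log (hpos v), ← Real.exp_add,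
    ← Real.le_log_iff_exp_le (hpos w)]
  have h1 := abs_le.1 (abs_log_sub_le_of_norm_logMap_le hx (hR _ hc) w)
  have h2 := abs_le.1 (abs_log_sub_le_of_norm_logMap_le hx (hR _ hc) v)
  linarith [h1.1, h2.2]

theorem pow_le_norm_of_forall_le {x : mixedSpace K} {t : ℝ} (ht : 0 ≤ t)
    (h : ∀ w, t ≤ normAtPlace w x) : t ^ finrank ℚ K ≤ mixedEmbedding.norm x := by
  rw [mixedEmbedding.norm_apply, ← sum_mult_eq, ← Finset.prod_pow_eq_pow_sum]
  exact Finset.prod_le_prod (fun _ _ => by positivity) fun w _ => by gcongr; exact h w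

/-- The weight `N(x)^{-s}`, cut off to a neighbourhood of a fundamental domain of the units. -/
noncomputable def weight (s : ℝ) (x : mixedSpace K) : ℝ :=
  mixedEmbedding.norm x ^ (-s) * cutoff (logMap x)

theorem weight_nonneg (s : ℝ) (x : mixedSpace K) : 0 ≤ weight s x :=
  mul_nonneg (Real.rpow_nonneg (mixedEmbedding.norm_nonneg _) _) (cutoff_nonneg K _)

variable (K) in
-- On the support of the cutoff the norm form is at least a constant times the `n`-th power of the
-- length. Outside the cutoff's support the weight is zero, so sums of weights are dominated by
-- lattice sums of `‖x‖ ^ (-ns)`.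
theorem exists_weight_le : ∃ κ : ℝ, 0 < κ ∧ ∀ s : ℝ, 0 ≤ s → ∀ x : mixedSpace K,
    mixedEmbedding.norm x ≠ 0 → weight s x ≤ (κ * ‖x‖) ^ (-(finrank ℚ K * s)) := by
  obtain ⟨κ, hκ, h⟩ := exists_mul_norm_le_normAtPlace K
  refine ⟨κ, hκ, fun s hs x hx => ?_⟩
  have hx0 := mul_pos hκ (norm_pos_of_norm_ne_zero hx)
  by_cases hc : cutoff (logMap x) = 0
  · rw [weight, hc, mul_zero]
    exact Real.rpow_nonneg hx0.le _
  · have h1 := pow_le_norm_of_forall_le hx0.le (h x hx hc)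
    refine (mul_le_of_le_one_right (Real.rpow_nonneg (mixedEmbedding.norm_nonneg _) _)
      (cutoff_le_one K _)).trans ?_
    rw [← mul_neg, Real.rpow_mul hx0.le, Real.rpow_natCast]
    exact Real.rpow_le_rpow_of_nonpos (by positivity) h1 (by linarith)

theorem abs_log_sub_log_le {a b t r : ℝ} (ht : 0 < t) (ha : t ≤ a) (hab : |a - b| ≤ r)
    (hr : 2 * r ≤ t) : |Real.log b - Real.log a| ≤ 2 * r / t := by
  have h1 := abs_le.1 hab
  have ha0 : 0 < a := by linarith
  have hb0 : t / 2 ≤ b := by linarith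
  have hb1 : 0 < b := by linarith
  have hr0 : 0 ≤ r := (abs_nonneg _).trans hab
  rw [abs_le]
  constructor
  · have h2 := Real.log_le_sub_one_of_pos (div_pos ha0 hb1)
    rw [Real.log_div ha0.ne' hb1.ne'] at h2
    have h3 : a / b - 1 ≤ 2 * r / t := by
      rw [div_sub_one hb1.ne', div_le_div_iff₀ hb1 ht]
      nlinarith
    linarith
  · have h2 := Real.log_le_sub_one_of_pos (div_pos hb1 ha0)
    rw [Real.log_div hb1.ne' ha0.ne'] at h2
    have h3 : b / a - 1 ≤ 2 * r / t := by
      rw [div_sub_one ha0.ne', div_le_div_iff₀ ha0 ht]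
      nlinarith
    linarith

theorem abs_log_norm_sub_le {x y : mixedSpace K} (hx : mixedEmbedding.norm x ≠ 0)
    (hy : mixedEmbedding.norm y ≠ 0) {δ : ℝ}
    (h : ∀ w, |Real.log (normAtPlace w y) - Real.log (normAtPlace w x)| ≤ δ) :
    |Real.log (mixedEmbedding.norm y) - Real.log (mixedEmbedding.norm x)| ≤ finrank ℚ K * δ := by
  rw [log_norm_eq hx, log_norm_eq hy, ← Finset.sum_sub_distrib, ← sum_mult_cast, Finset.sum_mul]
  refine (Finset.abs_sum_le_sum_abs _ _).trans (Finset.sum_le_sum fun w _ => ?_)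
  rw [← mul_sub, abs_mul, abs_of_nonneg (by positivity)]
  gcongr
  exact h w

/-- The 4 arises because `mult` is at most 2 and the logarithm at `w` and the normalizing term each
move by at most `δ`. -/
theorem norm_logMap_sub_le {x y : mixedSpace K} (hx : mixedEmbedding.norm x ≠ 0)
    (hy : mixedEmbedding.norm y ≠ 0) {δ : ℝ}
    (h : ∀ w, |Real.log (normAtPlace w y) - Real.log (normAtPlace w x)| ≤ δ) :
    ‖logMap y - logMap x‖ ≤ 4 * δ := by
  have hδ : 0 ≤ δ := (abs_nonneg _).trans (h w₀)
  refine (pi_norm_le_iff_of_nonneg (by positivity)).2 fun w => ?_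
  have h1 := h w
  have h2 : |Real.log (mixedEmbedding.norm y) * (finrank ℚ K : ℝ)⁻¹ -
      Real.log (mixedEmbedding.norm x) * (finrank ℚ K : ℝ)⁻¹| ≤ δ := by
    rw [← sub_mul, abs_mul, abs_of_nonneg (inv_nonneg.2 (finrank_cast_pos K).le),
      ← div_eq_mul_inv, div_le_iff₀ (finrank_cast_pos K), mul_comm δ]
    exact abs_log_norm_sub_le hx hy h
  have h3 : (mult w.1 : ℝ) ≤ 2 := by
    rw [mult]
    split_ifs <;> norm_num
  rw [Pi.sub_apply, logMap_apply, logMap_apply, ← mul_sub, Real.norm_eq_abs, abs_mul,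
    abs_of_nonneg (by positivity : (0 : ℝ) ≤ mult w.1)]
  rw [abs_le] at h1 h2
  calc (mult w.1 : ℝ) * _ ≤ 2 * (2 * δ) := by
        gcongr
        rw [abs_le]
        constructor <;> linarith
    _ = 4 * δ := by ring

end

end NumberField.UnitCutoff

/-! ### Sums of periodic functions of mean zero over the integers -/

namespace NumberField.UnitCutoff

open NumberField NumberField.InfinitePlace NumberField.mixedEmbedding NumberField.Units
  NumberField.Units.dirichletUnitTheorem Module

/-- The representation of an element of a commutative ring as a representative modulo `I` plus an element
of `I`. -/
theorem bijective_out_add {A : Type*} [CommRing A] (I : Ideal A) : Function.Bijective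
    fun p : I × (A ⧸ I) => Quotient.out p.2 + (p.1 : A) := by
  have hout : ∀ q : A ⧸ I, Ideal.Quotient.mk I (Quotient.out q) = q := fun q =>
    Quotient.out_eq' q
  constructor
  · rintro ⟨a, q⟩ ⟨b, q'⟩ h
    have h1 := congrArg (Ideal.Quotient.mk I) h
    simp only [map_add, hout, Ideal.Quotient.eq_zero_iff_mem.2 a.2,
      Ideal.Quotient.eq_zero_iff_mem.2 b.2, add_zero] at h1
    subst h1
    simp only [add_right_inj] at h
    rw [Subtype.ext h]
  · intro c
    refine ⟨⟨⟨c - Quotient.out (Ideal.Quotient.mk I c), ?_⟩, Ideal.Quotient.mk I c⟩, by simp⟩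
    rw [← Ideal.Quotient.eq_zero_iff_mem, map_sub, hout, sub_self]

section

open scoped Classical

variable {K : Type*} [Field K] [NumberField K]

variable (K) in
-- All places of `x` are comparable to `‖x‖` here, so a displacement by at most `R` moves each
-- logarithm by `O(R / ‖x‖)`. The weight, of size `O(‖x‖ ^ (-n))`, therefore varies by one power
-- less. Restricting `s` to `[1, 2]` makes the constants uniform.
theorem exists_abs_weight_sub_le_of_cutoff_ne_zero (R : ℝ) (hR : 0 ≤ R) :
    ∃ M C : ℝ, 0 < M ∧ 0 ≤ C ∧ ∀ s : ℝ, 1 ≤ s → s ≤ 2 → ∀ x y : mixedSpace K,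
      mixedEmbedding.norm x ≠ 0 → mixedEmbedding.norm y ≠ 0 → ‖x - y‖ ≤ R → M ≤ ‖x‖ →
      cutoff (logMap x) ≠ 0 → |weight s x - weight s y| ≤ C * (‖x‖ ^ (finrank ℚ K + 1))⁻¹ := by
  obtain ⟨κ, hκ, hκx⟩ := exists_mul_norm_le_normAtPlace K
  obtain ⟨A, hA, hcut⟩ := exists_abs_cutoff_sub_le K
  set n : ℝ := (finrank ℚ K : ℝ) with hn
  have hn0 : 0 < n := finrank_cast_pos K
  have hn1 : 1 ≤ n := by
    rw [hn]
    exact_mod_cast (finrank_pos : 0 < finrank ℚ K)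
  -- This `M` gives `t = κ‖x‖ ≥ 1` and `2nδ ≤ 1` below, so that `|exp z - 1| ≤ 2|z|` applies to `z =
  -- -(s * d)`.
  refine ⟨(4 * n * R + 1) / κ, (4 * A + 4 * n) * (2 * R / κ) * (κ ^ finrank ℚ K)⁻¹,
    by positivity, by positivity, fun s hs1 hs2 x y hx hy hxy hM hc => ?_⟩
  have hx0 : 0 < ‖x‖ := norm_pos_of_norm_ne_zero hx
  rw [div_le_iff₀' hκ] at hM
  set t := κ * ‖x‖ with ht
  have ht0 : 0 < t := mul_pos hκ hx0
  have hRt : 4 * n * R ≤ t := by linarith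
  have hRt' : 2 * R ≤ t := by nlinarith
  have h1 : 1 ≤ t := by nlinarith
  set δ := 2 * R / t with hδ
  have hδ0 : 0 ≤ δ := by positivity
  have hδn : 2 * n * δ ≤ 1 := by
    rw [hδ, mul_div_assoc', div_le_one ht0]
    linarith
  have hlog : ∀ w, |Real.log (normAtPlace w y) - Real.log (normAtPlace w x)| ≤ δ := fun w =>
    abs_log_sub_log_le ht0 (hκx x hx hc w) ((abs_normAtPlace_sub_le w x y).trans hxy) hRt'
  have hN := abs_log_norm_sub_le hx hy hlog
  have hL := norm_logMap_sub_le hx hy hlog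
  have hNx : 0 < mixedEmbedding.norm x := (mixedEmbedding.norm_nonneg x).lt_of_ne' hx
  have hNy : 0 < mixedEmbedding.norm y := (mixedEmbedding.norm_nonneg y).lt_of_ne' hy
  set d := Real.log (mixedEmbedding.norm y) - Real.log (mixedEmbedding.norm x) with hd
  have hsd : |-(s * d)| ≤ 2 * (n * δ) := by
    rw [abs_neg, abs_mul, abs_of_nonneg (by linarith)]
    gcongr
  have hexp : |Real.exp (-(s * d)) - 1| ≤ 4 * n * δ := by
    refine (Real.abs_exp_sub_one_le (hsd.trans (by linarith))).trans ?_
    linarith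
  have hyx : mixedEmbedding.norm y ^ (-s) =
      mixedEmbedding.norm x ^ (-s) * Real.exp (-(s * d)) := by
    rw [Real.rpow_def_of_pos hNx, Real.rpow_def_of_pos hNy, ← Real.exp_add, hd]
    ring_nf
  have hNle : mixedEmbedding.norm x ^ (-s) ≤ (t ^ finrank ℚ K)⁻¹ := by
    have h2 := pow_le_norm_of_forall_le ht0.le (hκx x hx hc)
    have h3 : 1 ≤ mixedEmbedding.norm x := (one_le_pow₀ h1).trans h2
    refine (Real.rpow_le_rpow_of_exponent_le h3 (by linarith : -s ≤ -1)).trans ?_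
    rw [Real.rpow_neg_one]
    gcongr
  have hmain : |weight s x - weight s y| ≤
      mixedEmbedding.norm x ^ (-s) * (4 * A * δ + 4 * n * δ) := by
    have h4 : weight s x - weight s y = mixedEmbedding.norm x ^ (-s) *
        ((cutoff (logMap x) - cutoff (logMap y)) -
          (Real.exp (-(s * d)) - 1) * cutoff (logMap y)) := by
      rw [weight, weight, hyx]
      ring
    rw [h4, abs_mul, abs_of_nonneg (Real.rpow_nonneg hNx.le _)]
    refine mul_le_mul_of_nonneg_left ((abs_sub _ _).trans (add_le_add ?_ ?_))
      (Real.rpow_nonneg hNx.le _)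
    · refine (hcut _ _).trans ?_
      rw [norm_sub_rev]
      nlinarith
    · rw [abs_mul, abs_of_nonneg (cutoff_nonneg K (logMap y))]
      exact (mul_le_of_le_one_right (abs_nonneg _) (cutoff_le_one K _)).trans hexp
  calc |weight s x - weight s y| ≤ (t ^ finrank ℚ K)⁻¹ * (4 * A * δ + 4 * n * δ) :=
        hmain.trans (by gcongr)
    _ = (4 * A + 4 * n) * (2 * R / κ) * (κ ^ finrank ℚ K)⁻¹ * (‖x‖ ^ (finrank ℚ K + 1))⁻¹ := by
        rw [hδ, ht, mul_pow, pow_succ]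
        field_simp

variable (K) in
theorem exists_abs_weight_sub_le (R : ℝ) (hR : 0 ≤ R) :
    ∃ M C : ℝ, 0 ≤ C ∧ ∀ s : ℝ, 1 ≤ s → s ≤ 2 → ∀ x y : mixedSpace K,
      mixedEmbedding.norm x ≠ 0 → mixedEmbedding.norm y ≠ 0 → ‖x - y‖ ≤ R → M ≤ ‖x‖ →
      |weight s x - weight s y| ≤ C * (‖x‖ ^ (finrank ℚ K + 1))⁻¹ := by
  obtain ⟨M, C, hM, hC, h⟩ := exists_abs_weight_sub_le_of_cutoff_ne_zero K R hR
  refine ⟨2 * M + 2 * R, C * 2 ^ (finrank ℚ K + 1), by positivity,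
    fun s hs1 hs2 x y hx hy hxy hMx => ?_⟩
  have hx0 : 0 < ‖x‖ := norm_pos_of_norm_ne_zero hx
  by_cases hcx : cutoff (logMap x) = 0
  · by_cases hcy : cutoff (logMap y) = 0
    · rw [weight, weight, hcx, hcy, mul_zero, mul_zero, sub_zero, abs_zero]
      positivity
    -- Only `y` lies on the support: exchange the two points. The choice `2 * M + 2 * R` ensures `M
    -- ≤ ‖y‖`, and halving the length costs the factor `2 ^ (n + 1)`.
    · have hy2 : ‖x‖ / 2 ≤ ‖y‖ := by
        have := norm_sub_norm_le x y
        linarith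
      rw [abs_sub_comm]
      refine (h s hs1 hs2 y x hy hx (by rwa [norm_sub_rev]) (by linarith) hcy).trans ?_
      rw [mul_assoc]
      refine mul_le_mul_of_nonneg_left ?_ hC
      calc (‖y‖ ^ (finrank ℚ K + 1))⁻¹ ≤ ((‖x‖ / 2) ^ (finrank ℚ K + 1))⁻¹ := by gcongr
        _ = _ := by rw [div_pow, inv_div, div_eq_mul_inv]
  · refine (h s hs1 hs2 x y hx hy hxy (by linarith) hcx).trans ?_
    gcongr
    exact le_mul_of_one_le_right hC (one_le_pow₀ one_le_two)

/-- The weight of an algebraic integer. -/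
noncomputable def intWeight (s : ℝ) (c : 𝓞 K) : ℝ := weight s (mixedEmbedding K (c : K))

theorem norm_mixedEmbedding_int (c : 𝓞 K) :
    mixedEmbedding.norm (mixedEmbedding K (c : K)) = Ideal.absNorm (Ideal.span {c}) := by
  rw [norm_eq_norm, Ideal.absNorm_span_singleton, ← Algebra.coe_norm_int]
  push_cast
  rw [Nat.cast_natAbs]
  push_cast
  rfl

theorem norm_mixedEmbedding_int_ne_zero {c : 𝓞 K} (hc : c ≠ 0) :
    mixedEmbedding.norm (mixedEmbedding K (c : K)) ≠ 0 := by
  rw [norm_mixedEmbedding_int, Nat.cast_ne_zero, Ne, Ideal.absNorm_eq_zero_iff,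
    Ideal.span_singleton_eq_bot]
  exact hc

theorem one_le_norm_mixedEmbedding_int {c : 𝓞 K} (hc : c ≠ 0) :
    1 ≤ mixedEmbedding.norm (mixedEmbedding K (c : K)) := by
  have := norm_mixedEmbedding_int_ne_zero hc
  rw [norm_mixedEmbedding_int, Nat.cast_ne_zero] at this
  rw [norm_mixedEmbedding_int]
  exact_mod_cast Nat.one_le_iff_ne_zero.2 this

theorem intWeight_nonneg (s : ℝ) (c : 𝓞 K) : 0 ≤ intWeight s c := weight_nonneg _ _

theorem intWeight_zero {s : ℝ} (hs : s ≠ 0) : intWeight s (0 : 𝓞 K) = 0 := by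
  simp [intWeight, weight, Real.zero_rpow (neg_ne_zero.2 hs)]

theorem intWeight_le_one {s : ℝ} (hs : 0 < s) (c : 𝓞 K) : intWeight s c ≤ 1 := by
  by_cases hc : c = 0
  · rw [hc, intWeight_zero hs.ne']
    exact zero_le_one
  · exact mul_le_one₀ (Real.rpow_le_one_of_one_le_of_nonpos
      (one_le_norm_mixedEmbedding_int hc) (by linarith)) (cutoff_nonneg K _) (cutoff_le_one K _)

variable (K) in
/-- The ring of integers as a lattice in the mixed space. -/
noncomputable def intEquiv : 𝓞 K ≃ mixedEmbedding.integerLattice K :=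
  Equiv.ofBijective (fun c => ⟨mixedEmbedding K (c : K), ⟨c, rfl⟩⟩)
    ⟨fun a b h => RingOfIntegers.ext (mixedEmbedding_injective K (Subtype.ext_iff.1 h)), by
      rintro ⟨_, c, rfl⟩
      exact ⟨c, rfl⟩⟩

variable (K) in
theorem finrank_integerLattice :
    finrank ℤ (mixedEmbedding.integerLattice K) = finrank ℚ K := by
  rw [ZLattice.rank ℝ, mixedEmbedding.finrank]

variable (K) in
theorem summable_norm_rpow_int {r : ℝ} (hr : r < -finrank ℚ K) :
    Summable fun c : 𝓞 K => ‖mixedEmbedding K (c : K)‖ ^ r := by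
  have := ZLattice.summable_norm_rpow (mixedEmbedding.integerLattice K) r
    (by rwa [finrank_integerLattice])
  exact (intEquiv K).summable_iff.2 this

theorem summable_intWeight {s : ℝ} (hs : 1 < s) : Summable fun c : 𝓞 K => intWeight s c := by
  obtain ⟨κ, hκ, h⟩ := exists_weight_le K
  have hn := finrank_cast_pos K
  refine Summable.of_nonneg_of_le (fun c => weight_nonneg _ _) (fun c => ?_)
    ((summable_norm_rpow_int K (r := -(finrank ℚ K * s)) (by nlinarith)).mul_left
      (κ ^ (-(finrank ℚ K * s))))
  by_cases hc : c = 0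
  · rw [hc, intWeight_zero (by linarith)]
    positivity
  · rw [← Real.mul_rpow hκ.le (norm_nonneg _)]
    exact h s (by linarith) _ (norm_mixedEmbedding_int_ne_zero hc)

variable (K) in
theorem finite_norm_mixedEmbedding_lt (M : ℝ) :
    {c : 𝓞 K | ‖mixedEmbedding K (c : K)‖ < M}.Finite := by
  rcases le_or_gt M 0 with hM | hM
  · refine Set.Finite.subset Set.finite_empty fun c hc => ?_
    exact absurd (norm_nonneg (mixedEmbedding K (c : K))) (not_le.2 (lt_of_lt_of_le hc hM))
  have hr : -(finrank ℚ K + 1 : ℝ) < -finrank ℚ K := by linarith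
  have h := (summable_norm_rpow_int K hr).tendsto_cofinite_zero.eventually_lt_const
    (Real.rpow_pos_of_pos hM (-(finrank ℚ K + 1 : ℝ)))
  refine (Set.Finite.union (Filter.eventually_cofinite.1 h) (Set.finite_singleton 0)).subset
    fun c hc => ?_
  by_cases h0 : c = 0
  · exact Or.inr h0
  · refine Or.inl (not_lt.2 ?_)
    exact Real.rpow_le_rpow_of_nonpos
      (norm_pos_of_norm_ne_zero (norm_mixedEmbedding_int_ne_zero h0)) (le_of_lt hc)
      (by linarith [finrank_cast_pos K])

variable (K) in
-- One majorant serves all `s` in `(1, 2]`: finitely many short `c`, where the weights lie between 0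
-- and 1, and beyond them `‖c‖ ^ (-n-1)`, which is summable over a lattice of rank `n`.
theorem exists_summable_bound (R : ℝ) (hR : 0 ≤ R) : ∃ g : 𝓞 K → ℝ, Summable g ∧
    ∀ s : ℝ, 1 < s → s ≤ 2 → ∀ c r : 𝓞 K, ‖mixedEmbedding K (r : K)‖ ≤ R →
      |intWeight s (r + c) - intWeight s c| ≤ g c := by
  obtain ⟨M, C, hC, h⟩ := exists_abs_weight_sub_le K R hR
  -- The radius `R + 1` keeps `c` and `r + c` both nonzero outside `S`.
  let S := (finite_norm_mixedEmbedding_lt K (max M (R + 1))).toFinset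
  refine ⟨fun c => (if c ∈ S then 1 else 0) +
    C * ‖mixedEmbedding K (c : K)‖ ^ (-(finrank ℚ K + 1 : ℝ)), ?_, ?_⟩
  · refine Summable.add ?_ ((summable_norm_rpow_int K (by linarith)).mul_left C)
    exact summable_of_ne_finset_zero (s := S) fun c hc => if_neg hc
  · intro s hs1 hs2 c r hr
    have h0 : 0 ≤ C * ‖mixedEmbedding K (c : K)‖ ^ (-(finrank ℚ K + 1 : ℝ)) := by positivity
    by_cases hc : c ∈ S
    · simp only [hc, if_true]
      have h1 := intWeight_le_one (by linarith : 0 < s) (r + c)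
      have h2 := intWeight_le_one (by linarith : 0 < s) c
      have h3 := intWeight_nonneg s (r + c)
      have h4 := intWeight_nonneg s c
      rw [abs_le]
      constructor <;> linarith
    · simp only [hc, if_false, zero_add]
      have hc' : max M (R + 1) ≤ ‖mixedEmbedding K (c : K)‖ := by
        simpa [S] using hc
      have hc1 : R < ‖mixedEmbedding K (c : K)‖ := by
        linarith [le_max_right M (R + 1)]
      have hne : c ≠ 0 := by
        rintro rfl
        simp only [map_zero, norm_zero] at hc1
        linarith
      have hadd : mixedEmbedding K ((r + c : 𝓞 K) : K) =
          mixedEmbedding K (r : K) + mixedEmbedding K (c : K) := by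
        rw [← map_add]
        rfl
      have hne' : r + c ≠ 0 := by
        intro h5
        rw [h5] at hadd
        simp only [map_zero] at hadd
        rw [eq_neg_of_add_eq_zero_left hadd.symm, norm_neg] at hr
        linarith
      rw [abs_sub_comm]
      have := h s hs1.le hs2 (mixedEmbedding K (c : K)) (mixedEmbedding K ((r + c : 𝓞 K) : K))
        (norm_mixedEmbedding_int_ne_zero hne) (norm_mixedEmbedding_int_ne_zero hne')
        (by rw [hadd, sub_add_cancel_right, norm_neg]; exact hr) ((le_max_left _ _).trans hc')
      rw [Real.rpow_neg (norm_nonneg _)]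
      exact_mod_cast this

/-- Sums of a periodic function of mean zero against the weights are bounded. -/
theorem exists_abs_tsum_mul_intWeight_le (I : Ideal (𝓞 K)) (hI : I ≠ ⊥) (θ : 𝓞 K ⧸ I → ℝ)
    (h1 : ∀ q, |θ q| ≤ 1) (h0 : ∑ᶠ q, θ q = 0) : ∃ C : ℝ, ∀ s : ℝ, 1 < s → s ≤ 2 →
      |∑' c : 𝓞 K, θ (Ideal.Quotient.mk I c) * intWeight s c| ≤ C := by
  have : Finite (𝓞 K ⧸ I) := Ideal.finiteQuotientOfFreeOfNeBot I hI
  have := Fintype.ofFinite (𝓞 K ⧸ I)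
  rw [finsum_eq_sum_of_fintype] at h0
  let r : 𝓞 K ⧸ I → 𝓞 K := Quotient.out
  have hr : ∀ q, Ideal.Quotient.mk I (r q) = q := fun q => Quotient.out_eq' q
  obtain ⟨g, hg, hgs⟩ := exists_summable_bound K (∑ q, ‖mixedEmbedding K (r q : K)‖)
    (Finset.sum_nonneg fun _ _ => norm_nonneg _)
  refine ⟨∑' a : I, ∑ _q : 𝓞 K ⧸ I, g a, fun s hs1 hs2 => ?_⟩
  have hsum : Summable fun c : 𝓞 K => θ (Ideal.Quotient.mk I c) * intWeight s c := by
    refine Summable.of_norm_bounded (summable_intWeight hs1) fun c => ?_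
    rw [norm_mul, Real.norm_eq_abs, Real.norm_eq_abs, abs_of_nonneg (intWeight_nonneg s c)]
    exact mul_le_of_le_one_left (intWeight_nonneg s c) (h1 _)
  let e := Equiv.ofBijective _ (bijective_out_add I)
  have hmk : ∀ p, Ideal.Quotient.mk I (e p) = p.2 := fun p => by
    simp only [e, Equiv.ofBijective_apply, map_add]
    rw [Ideal.Quotient.eq_zero_iff_mem.2 p.1.2, add_zero]
    exact hr _
  have hsum' : Summable fun p => θ (Ideal.Quotient.mk I (e p)) * intWeight s (e p) :=
    e.summable_iff.2 hsum
  have hgI : Summable fun a : I => ∑ _q : 𝓞 K ⧸ I, g a :=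
    summable_sum fun _ _ => hg.comp_injective Subtype.val_injective
  rw [← e.tsum_eq, hsum'.tsum_prod, ← Real.norm_eq_abs]
  refine tsum_of_norm_bounded hgI.hasSum fun a => ?_
  -- Because `θ` has mean zero, the weight at the base point `a` can be subtracted for free; only
  -- differences bounded by `g a` remain.
  have h2 : ∑' q, θ (Ideal.Quotient.mk I (e (a, q))) * intWeight s (e (a, q)) =
      ∑ q, θ q * (intWeight s (r q + (a : 𝓞 K)) - intWeight s (a : 𝓞 K)) := by
    rw [tsum_fintype]
    simp only [mul_sub, Finset.sum_sub_distrib, ← Finset.sum_mul, h0, zero_mul, sub_zero, hmk]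
    rfl
  rw [h2]
  refine (norm_sum_le _ _).trans (Finset.sum_le_sum fun q _ => ?_)
  rw [norm_mul, Real.norm_eq_abs, Real.norm_eq_abs]
  refine (mul_le_of_le_one_left (abs_nonneg _) (h1 q)).trans (hgs s hs1 hs2 _ _ ?_)
  exact Finset.single_le_sum (f := fun q => ‖mixedEmbedding K (r q : K)‖)
    (fun _ _ => norm_nonneg _) (Finset.mem_univ q)

end

end NumberField.UnitCutoff

/-! ### From sums over integers to sums over principal ideals -/

namespace NumberField.UnitCutoff

open NumberField NumberField.InfinitePlace NumberField.mixedEmbedding NumberField.Units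
  NumberField.Units.dirichletUnitTheorem Module

section

open scoped Classical

section

variable {K : Type*} [Field K] (χ : Ideal (𝓞 K) →*₀ ℝ) (𝔪 : Ideal (𝓞 K)) (J : Ideal (𝓞 K))

/-- The values of `χ` on the principal ideals inside `J`, as a function of the generator. -/
noncomputable def genChar (c : 𝓞 K) : ℝ := if c ∈ J then χ (Ideal.span {c}) else 0

theorem genChar_periodic (hper : ∀ c d : 𝓞 K, c - d ∈ 𝔪 → χ (Ideal.span {c}) = χ (Ideal.span {d}))
    {c d : 𝓞 K} (h : c - d ∈ 𝔪 * J) : genChar χ J c = genChar χ J d := by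
  have hJ : c ∈ J ↔ d ∈ J := by
    have h1 : c - d ∈ J := Ideal.mul_le_right h
    constructor
    · intro hc
      simpa using J.sub_mem hc h1
    · intro hd
      simpa using J.add_mem h1 hd
  rw [genChar, genChar, hper c d (Ideal.mul_le_left h)]
  simp only [hJ]

end

variable {K : Type*} [Field K] [NumberField K]

theorem intWeight_unit_mul (s : ℝ) (u : (𝓞 K)ˣ) {c : 𝓞 K} (hc : c ≠ 0) :
    intWeight s ((u : 𝓞 K) * c) = (Ideal.absNorm (Ideal.span {c}) : ℝ) ^ (-s) *
      cutoff (logEmbedding K (Additive.ofMul u) + logMap (mixedEmbedding K (c : K))) := by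
  have h : mixedEmbedding K (((u : 𝓞 K) * c : 𝓞 K) : K) = u • mixedEmbedding K (c : K) := by
    rw [unitSMul_smul, ← map_mul]
    rfl
  rw [intWeight, weight, h, norm_unit_smul, norm_mixedEmbedding_int,
    logMap_unit_smul u (norm_mixedEmbedding_int_ne_zero hc)]

/-- The sum of the weights of the generators of a principal ideal. -/
theorem tsum_intWeight_fiber (s : ℝ) {c : 𝓞 K} (hc : c ≠ 0) :
    ∑' a : (fun a : 𝓞 K => Ideal.span {a}) ⁻¹' {Ideal.span {c}}, intWeight s (a : 𝓞 K) =
      (Ideal.absNorm (Ideal.span {c}) : ℝ) ^ (-s) * torsionOrder K := by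
  let g : (𝓞 K)ˣ → (fun a : 𝓞 K => Ideal.span {a}) ⁻¹' {Ideal.span {c}} := fun u =>
    ⟨u * c, by
      rw [Set.mem_preimage, Set.mem_singleton_iff, Ideal.span_singleton_mul_left_unit u.isUnit]⟩
  have hg : Function.Bijective g := by
    constructor
    · intro u v h
      have h1 : (u : 𝓞 K) * c = v * c := congrArg Subtype.val h
      exact Units.ext (mul_right_cancel₀ hc h1)
    · rintro ⟨a, ha⟩
      rw [Set.mem_preimage, Set.mem_singleton_iff, Ideal.span_singleton_eq_span_singleton] at ha
      obtain ⟨u, hu⟩ := ha.symm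
      exact ⟨u, Subtype.ext ((mul_comm _ _).trans hu)⟩
  rw [← (Equiv.ofBijective g hg).tsum_eq]
  have h2 := (hasSum_cutoff_units K (logMap (mixedEmbedding K (c : K)))).mul_left
    ((Ideal.absNorm (Ideal.span {c}) : ℝ) ^ (-s))
  rw [← h2.tsum_eq]
  exact tsum_congr fun u => intWeight_unit_mul s u hc

section

variable (χ : Ideal (𝓞 K) →*₀ ℝ) (𝔪 : Ideal (𝓞 K)) (J : Ideal (𝓞 K))

theorem sum_genChar (h𝔪 : 𝔪 ≠ ⊥) (hJ0 : J ≠ ⊥) (hJ : IsCoprime J 𝔪)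
    (hcop : ∀ I, χ I ≠ 0 → IsCoprime I 𝔪)
    (hper : ∀ c d : 𝓞 K, c - d ∈ 𝔪 → χ (Ideal.span {c}) = χ (Ideal.span {d}))
    (hodd : ∃ e : 𝓞 K, χ (Ideal.span {e}) = -1) :
    ∑ᶠ q : 𝓞 K ⧸ (𝔪 * J), genChar χ J (Quotient.out q) = 0 := by
  obtain ⟨e₀, he₀⟩ := hodd
  obtain ⟨x, hx, y, hy, hxy⟩ := Ideal.isCoprime_iff_exists.1 hJ
  -- By the Chinese remainder theorem `e` is `e₀` modulo `𝔪` and `1` modulo `J`. Multiplication by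
  -- `e` permutes the residues modulo `𝔪 * J`, respects membership in `J` and changes the sign of
  -- `genChar`, so the sum equals its own negative.
  let e : 𝓞 K := e₀ * x + y
  have he1 : e - e₀ ∈ 𝔪 := by
    have : e - e₀ = (1 - e₀) * y := by
      simp only [e]
      linear_combination e₀ * hxy
    rw [this]
    exact 𝔪.mul_mem_left _ hy
  have he2 : e - 1 ∈ J := by
    have : e - 1 = (e₀ - 1) * x := by
      simp only [e]
      linear_combination hxy
    rw [this]
    exact J.mul_mem_left _ hx
  have heχ : χ (Ideal.span {e}) = -1 := by rw [hper e e₀ he1, he₀]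
  have hmem : ∀ c, e * c ∈ J ↔ c ∈ J := fun c => by
    have h1 : e * c - c ∈ J := by
      have : e * c - c = c * (e - 1) := by ring
      rw [this]
      exact J.mul_mem_left _ he2
    constructor
    · intro hc
      simpa using J.sub_mem hc h1
    · exact fun hc => J.mul_mem_left _ hc
  have hmul : ∀ c, genChar χ J (e * c) = -genChar χ J c := fun c => by
    simp only [genChar, hmem, ← Ideal.span_singleton_mul_span_singleton, map_mul, heχ]
    split_ifs <;> simp
  have hunit : IsUnit (Ideal.Quotient.mk (𝔪 * J) e) := by
    have h1 : IsCoprime (Ideal.span {e}) 𝔪 := hcop _ (by rw [heχ]; norm_num)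
    have h2 : IsCoprime (Ideal.span {e}) J := by
      rw [Ideal.isCoprime_iff_exists]
      refine ⟨e, Ideal.mem_span_singleton_self e, 1 - e, ?_, by ring⟩
      rw [← neg_sub]
      exact J.neg_mem he2
    obtain ⟨a, ha, b, hb, hab⟩ := Ideal.isCoprime_iff_exists.1 (h1.mul_right h2)
    obtain ⟨d, rfl⟩ := Ideal.mem_span_singleton'.1 ha
    refine IsUnit.of_mul_eq_one (Ideal.Quotient.mk _ d) ?_
    rw [← map_mul, ← map_one (Ideal.Quotient.mk (𝔪 * J)), Ideal.Quotient.eq]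
    have : e * d - 1 = -b := by linear_combination hab
    rw [this]
    exact (𝔪 * J).neg_mem hb
  have hout : ∀ q : 𝓞 K ⧸ (𝔪 * J), Ideal.Quotient.mk _ (Quotient.out q) = q := fun q =>
    Quotient.out_eq' q
  have : Finite (𝓞 K ⧸ (𝔪 * J)) := Ideal.finiteQuotientOfFreeOfNeBot _ (mul_ne_zero h𝔪 hJ0)
  have := Fintype.ofFinite (𝓞 K ⧸ (𝔪 * J))
  rw [finsum_eq_sum_of_fintype]
  have key : ∑ q : 𝓞 K ⧸ (𝔪 * J), genChar χ J (Quotient.out q) =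
      -∑ q : 𝓞 K ⧸ (𝔪 * J), genChar χ J (Quotient.out q) := by
    rw [← Finset.sum_neg_distrib]
    rw [← Equiv.sum_comp hunit.unit.mulLeft]
    refine Finset.sum_congr rfl fun q _ => ?_
    rw [← hmul]
    refine genChar_periodic χ 𝔪 J hper ?_
    rw [← Ideal.Quotient.eq, hout, map_mul, hout]
    rfl
  linarith

/-- The Dirichlet series over the principal ideals inside `J`. -/
noncomputable def principalTerm (s : ℝ) (I : Ideal (𝓞 K)) : ℝ :=
  if I ≤ J ∧ I.IsPrincipal then χ I * (Ideal.absNorm I : ℝ) ^ (-s) else 0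

/-- The generators of a nonzero principal ideal form one orbit of the units, over which the cutoff
sums to `torsionOrder K`. A nonprincipal ideal has empty fibre, and `χ` vanishes on the zero ideal.
-/
theorem tsum_genChar_fiber (s : ℝ) (I : Ideal (𝓞 K)) :
    ∑' a : (fun a : 𝓞 K => Ideal.span {a}) ⁻¹' {I}, genChar χ J a * intWeight s (a : 𝓞 K) =
      principalTerm χ J s I * torsionOrder K := by
  have hval : ∀ a : (fun a : 𝓞 K => Ideal.span {a}) ⁻¹' {I},
      genChar χ J a * intWeight s (a : 𝓞 K) = (if I ≤ J then χ I else 0) * intWeight s (a : 𝓞 K) := by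
    rintro ⟨a, ha⟩
    rw [Set.mem_preimage, Set.mem_singleton_iff] at ha
    simp only [genChar, ← ha, Ideal.span_singleton_le_iff_mem]
  rw [tsum_congr hval, tsum_mul_left]
  by_cases hI : I.IsPrincipal
  · obtain ⟨c, rfl⟩ := hI
    change _ * ∑' a : (fun a : 𝓞 K => Ideal.span {a}) ⁻¹' {Ideal.span {c}}, _ =
      principalTerm χ J s (Ideal.span {c}) * _
    have hp : (Ideal.span {c}).IsPrincipal := ⟨c, rfl⟩
    change (if Ideal.span {c} ≤ J then χ (Ideal.span {c}) else 0) * _ = _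
    by_cases hc : c = 0
    · have : χ (Ideal.span {c}) = 0 := by
        rw [hc, Ideal.span_singleton_zero]
        exact map_zero χ
      simp [principalTerm, this]
    · rw [tsum_intWeight_fiber s hc]
      simp only [principalTerm, hp, and_true]
      split_ifs <;> ring
  · have : IsEmpty ((fun a : 𝓞 K => Ideal.span {a}) ⁻¹' {I}) := by
      constructor
      rintro ⟨a, ha⟩
      exact hI ⟨a, ha.symm⟩
    rw [tsum_empty, mul_zero, principalTerm, if_neg (fun h => hI h.2), zero_mul]

theorem exists_abs_tsum_principalTerm_le (h𝔪 : 𝔪 ≠ ⊥) (hJ0 : J ≠ ⊥) (hJ : IsCoprime J 𝔪)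
    (h1 : ∀ I, |χ I| ≤ 1) (hcop : ∀ I, χ I ≠ 0 → IsCoprime I 𝔪)
    (hper : ∀ c d : 𝓞 K, c - d ∈ 𝔪 → χ (Ideal.span {c}) = χ (Ideal.span {d}))
    (hodd : ∃ e : 𝓞 K, χ (Ideal.span {e}) = -1) :
    ∃ C : ℝ, ∀ s : ℝ, 1 < s → s ≤ 2 → |∑' I, principalTerm χ J s I| ≤ C := by
  have h2 : ∀ c, |genChar χ J c| ≤ 1 := fun c => by
    rw [genChar]
    split_ifs
    · exact h1 _
    · simp
  obtain ⟨C, hC⟩ := exists_abs_tsum_mul_intWeight_le (𝔪 * J) (mul_ne_zero h𝔪 hJ0)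
    (fun q => genChar χ J (Quotient.out q)) (fun q => h2 _)
    (sum_genChar χ 𝔪 J h𝔪 hJ0 hJ hcop hper hodd)
  have h3 : ∀ c : 𝓞 K, genChar χ J (Quotient.out (Ideal.Quotient.mk (𝔪 * J) c)) =
      genChar χ J c := fun c => by
    refine genChar_periodic χ 𝔪 J hper ?_
    rw [← Ideal.Quotient.eq]
    exact Quotient.out_eq' _
  refine ⟨C, fun s hs1 hs2 => ?_⟩
  have h4 := hC s hs1 hs2
  simp only [h3] at h4
  have hsum : Summable fun c : 𝓞 K => genChar χ J c * intWeight s c := by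
    refine Summable.of_norm_bounded (summable_intWeight hs1) fun c => ?_
    rw [norm_mul, Real.norm_eq_abs, Real.norm_eq_abs, abs_of_nonneg (intWeight_nonneg s c)]
    exact mul_le_of_le_one_left (intWeight_nonneg s c) (h2 _)
  have h5 := hsum.hasSum.tsum_fiberwise fun a : 𝓞 K => Ideal.span {a}
  simp only [tsum_genChar_fiber χ J s] at h5
  rw [← h5.tsum_eq, tsum_mul_right, abs_mul] at h4
  have h6 : (1 : ℝ) ≤ |(torsionOrder K : ℝ)| := by
    rw [abs_of_nonneg (by positivity)]
    exact_mod_cast torsionOrder_pos K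
  exact (le_mul_of_one_le_right (abs_nonneg _) h6).trans h4

end

end

end NumberField.UnitCutoff


/-! ### Ideal classes and bounded Dirichlet series -/

namespace NumberField.UnitCutoff

open NumberField NumberField.InfinitePlace NumberField.mixedEmbedding NumberField.Units
  NumberField.Units.dirichletUnitTheorem Module nonZeroDivisors

section

open scoped Classical

variable {K : Type*} [Field K] [NumberField K]

theorem summable_principalTerm (χ : Ideal (𝓞 K) →*₀ ℝ) (h1 : ∀ I, |χ I| ≤ 1)
    (J : Ideal (𝓞 K)) {s : ℝ} (hs : 1 < s) : Summable (principalTerm χ J s) := by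
  have hsum : Summable fun c : 𝓞 K => genChar χ J c * intWeight s c := by
    refine Summable.of_norm_bounded (summable_intWeight hs) fun c => ?_
    rw [norm_mul, Real.norm_eq_abs, Real.norm_eq_abs, abs_of_nonneg (intWeight_nonneg s c)]
    refine mul_le_of_le_one_left (intWeight_nonneg s c) ?_
    rw [genChar]
    split_ifs
    · exact h1 _
    · simp
  have h5 := (hsum.hasSum.tsum_fiberwise fun a : 𝓞 K => Ideal.span {a}).summable
  simp only [tsum_genChar_fiber χ J s] at h5
  exact (summable_mul_right_iff (Nat.cast_ne_zero.2 (torsionOrder_ne_zero K))).1 h5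

/-- The ideal class of a nonzero ideal (and the trivial class for the zero ideal). -/
noncomputable def idealClass (I : Ideal (𝓞 K)) : ClassGroup (𝓞 K) :=
  if h : I = ⊥ then 1 else ClassGroup.mk0 ⟨I, mem_nonZeroDivisors_of_ne_zero h⟩

theorem idealClass_mul {I J : Ideal (𝓞 K)} (hI : I ≠ ⊥) (hJ : J ≠ ⊥) :
    idealClass (I * J) = idealClass I * idealClass J := by
  rw [idealClass, idealClass, idealClass, dif_neg hI, dif_neg hJ, dif_neg (show I * J ≠ ⊥ from mul_ne_zero hI hJ),
    ← map_mul]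
  rfl

theorem idealClass_top : idealClass (⊤ : Ideal (𝓞 K)) = 1 := by
  rw [idealClass, dif_neg top_ne_bot]
  exact ClassGroup.mk0_eq_one_iff (mem_nonZeroDivisors_of_ne_zero top_ne_bot) |>.2
    ⟨1, by simp⟩

theorem idealClass_pow {I : Ideal (𝓞 K)} (hI : I ≠ ⊥) (n : ℕ) :
    idealClass (I ^ n) = idealClass I ^ n := by
  induction n with
  | zero => rw [pow_zero, pow_zero, Ideal.one_eq_top, idealClass_top]
  | succ n ih => rw [pow_succ, pow_succ, idealClass_mul (pow_ne_zero n hI) hI, ih]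

theorem idealClass_eq_one_iff {I : Ideal (𝓞 K)} (hI : I ≠ ⊥) :
    idealClass I = 1 ↔ I.IsPrincipal := by
  rw [idealClass, dif_neg hI]
  exact ClassGroup.mk0_eq_one_iff _

/-- The Dirichlet series over the ideals in a class. -/
noncomputable def classTerm (χ : Ideal (𝓞 K) →*₀ ℝ) (s : ℝ) (C : ClassGroup (𝓞 K))
    (I : Ideal (𝓞 K)) : ℝ :=
  if idealClass I = C then χ I * (Ideal.absNorm I : ℝ) ^ (-s) else 0

/-- Multiplication by `J` carries the nonzero ideals in the class inverse to `J` to the nonzero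
principal ideals inside `J`, since containment in `J` is divisibility by `J`. -/
theorem classTerm_eq (χ : Ideal (𝓞 K) →*₀ ℝ) (s : ℝ) {J : Ideal (𝓞 K)} (hJ : χ J ≠ 0)
    (I : Ideal (𝓞 K)) : classTerm χ s (idealClass J)⁻¹ I =
      (χ J)⁻¹ * (Ideal.absNorm J : ℝ) ^ s * principalTerm χ J s (I * J) := by
  have hJ0 : J ≠ ⊥ := by
    rintro rfl
    exact hJ (map_zero χ)
  by_cases hI : I = ⊥
  · have : χ ⊥ = 0 := map_zero χ
    simp [hI, classTerm, principalTerm, this]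
  · have hN : (0 : ℝ) < Ideal.absNorm J := by
      exact_mod_cast Nat.pos_of_ne_zero (by rwa [Ne, Ideal.absNorm_eq_zero_iff])
    have h1 : idealClass I = (idealClass J)⁻¹ ↔ (I * J).IsPrincipal := by
      rw [← idealClass_eq_one_iff (mul_ne_zero hI hJ0), idealClass_mul hI hJ0,
        eq_inv_iff_mul_eq_one]
    have h2 : I * J ≤ J := Ideal.mul_le_right
    simp only [classTerm, principalTerm, h1, h2, true_and]
    split_ifs
    · rw [map_mul, map_mul, Nat.cast_mul, Real.mul_rpow (by positivity) (by positivity),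
        Real.rpow_neg hN.le]
      field_simp
    · simp

theorem principalTerm_support_subset (χ : Ideal (𝓞 K) →*₀ ℝ) (s : ℝ) (J : Ideal (𝓞 K)) :
    Function.support (principalTerm χ J s) ⊆ Set.range fun I => I * J := by
  intro I hI
  have : I ≤ J := by
    by_contra h
    exact hI (if_neg fun h' => h h'.1)
  obtain ⟨I', rfl⟩ := Ideal.dvd_iff_le.2 this
  exact ⟨I', mul_comm _ _⟩

theorem mul_right_injective_ideal {J : Ideal (𝓞 K)} (hJ : J ≠ ⊥) :
    Function.Injective fun I : Ideal (𝓞 K) => I * J := mul_left_injective₀ hJ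

theorem tsum_classTerm (χ : Ideal (𝓞 K) →*₀ ℝ) (s : ℝ) {J : Ideal (𝓞 K)} (hJ : χ J ≠ 0) :
    ∑' I, classTerm χ s (idealClass J)⁻¹ I =
      (χ J)⁻¹ * (Ideal.absNorm J : ℝ) ^ s * ∑' I, principalTerm χ J s I := by
  have hJ0 : J ≠ ⊥ := by
    rintro rfl
    exact hJ (map_zero χ)
  rw [tsum_congr (classTerm_eq χ s hJ), tsum_mul_left,
    (mul_right_injective_ideal hJ0).tsum_eq (principalTerm_support_subset χ s J)]

theorem summable_classTerm (χ : Ideal (𝓞 K) →*₀ ℝ) (h1 : ∀ I, |χ I| ≤ 1) {s : ℝ} (hs : 1 < s)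
    {J : Ideal (𝓞 K)} (hJ : χ J ≠ 0) : Summable (classTerm χ s (idealClass J)⁻¹) := by
  have hJ0 : J ≠ ⊥ := by
    rintro rfl
    exact hJ (map_zero χ)
  rw [funext (classTerm_eq χ s hJ)]
  exact ((summable_principalTerm χ h1 J hs).comp_injective
    (mul_right_injective_ideal hJ0)).mul_left _

theorem sum_classTerm (χ : Ideal (𝓞 K) →*₀ ℝ) (s : ℝ) (I : Ideal (𝓞 K)) :
    ∑ C, classTerm χ s C I = χ I * (Ideal.absNorm I : ℝ) ^ (-s) := by
  simp [classTerm]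

variable (K) in
/-- The trivial character on ideals. -/
noncomputable def trivChar : Ideal (𝓞 K) →*₀ ℝ where
  toFun I := if I = ⊥ then 0 else 1
  map_zero' := if_pos rfl
  map_one' := if_neg one_ne_zero
  map_mul' I J := by
    by_cases hI : I = ⊥
    · simp [hI]
    · by_cases hJ : J = ⊥
      · simp [hJ]
      · rw [if_neg hI, if_neg hJ, if_neg (show I * J ≠ ⊥ from mul_ne_zero hI hJ), one_mul]

theorem trivChar_apply {I : Ideal (𝓞 K)} (hI : I ≠ ⊥) : trivChar K I = 1 := if_neg hI

theorem abs_trivChar_le (I : Ideal (𝓞 K)) : |trivChar K I| ≤ 1 := by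
  change |if I = ⊥ then (0 : ℝ) else 1| ≤ 1
  split_ifs <;> simp

theorem exists_idealClass_eq (C : ClassGroup (𝓞 K)) : ∃ I : Ideal (𝓞 K), I ≠ ⊥ ∧ idealClass I = C := by
  obtain ⟨I, rfl⟩ := ClassGroup.mk0_surjective C
  have h : (I : Ideal (𝓞 K)) ≠ ⊥ := nonZeroDivisors.ne_zero I.2
  exact ⟨I, h, by rw [idealClass, dif_neg h]⟩

variable (K) in
-- The class decomposition for the trivial character reduces convergence to that of the weights on
-- the lattice of integers.
theorem summable_absNorm_rpow {s : ℝ} (hs : 1 < s) :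
    Summable fun I : Ideal (𝓞 K) => (Ideal.absNorm I : ℝ) ^ (-s) := by
  have h : Summable fun I => ∑ C, classTerm (trivChar K) s C I := by
    refine summable_sum fun C _ => ?_
    obtain ⟨J, hJ, hC⟩ := exists_idealClass_eq C⁻¹
    have := summable_classTerm (trivChar K) abs_trivChar_le hs
      (by rw [trivChar_apply hJ]; exact one_ne_zero)
    rwa [hC, inv_inv] at this
  refine h.congr fun I => ?_
  rw [sum_classTerm]
  by_cases hI : I = ⊥
  · simp [hI, Real.zero_rpow (by linarith : -s ≠ 0)]
  · rw [trivChar_apply hI, one_mul]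

theorem summable_mul_absNorm_rpow (χ : Ideal (𝓞 K) → ℝ) (h1 : ∀ I, |χ I| ≤ 1) {s : ℝ} (hs : 1 < s) :
    Summable fun I : Ideal (𝓞 K) => χ I * (Ideal.absNorm I : ℝ) ^ (-s) := by
  refine Summable.of_norm_bounded (summable_absNorm_rpow K hs) fun I => ?_
  rw [norm_mul, Real.norm_eq_abs, Real.norm_eq_abs,
    abs_of_nonneg (Real.rpow_nonneg (Nat.cast_nonneg _) _)]
  exact mul_le_of_le_one_left (Real.rpow_nonneg (Nat.cast_nonneg _) _) (h1 _)

/-- The Dirichlet series of a nontrivial character of conductor `𝔪` is bounded near `s = 1`. -/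
theorem exists_tsum_char_le (χ : Ideal (𝓞 K) →*₀ ℝ) (𝔪 : Ideal (𝓞 K)) (h𝔪 : 𝔪 ≠ ⊥)
    (h1 : ∀ I, |χ I| ≤ 1) (hcop : ∀ I, χ I ≠ 0 → IsCoprime I 𝔪)
    (hper : ∀ c d : 𝓞 K, c - d ∈ 𝔪 → χ (Ideal.span {c}) = χ (Ideal.span {d}))
    (hodd : ∃ e : 𝓞 K, χ (Ideal.span {e}) = -1) :
    ∃ C : ℝ, ∀ s : ℝ, 1 < s → s ≤ 2 →
      ∑' I, χ I * (Ideal.absNorm I : ℝ) ^ (-s) ≤ C := by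
  have key : ∀ C : ClassGroup (𝓞 K), ∃ B : ℝ, ∀ s : ℝ, 1 < s → s ≤ 2 →
      Summable (classTerm χ s C) ∧ ∑' I, classTerm χ s C I ≤ B := by
    intro C
    by_cases hC : ∃ I, idealClass I = C ∧ χ I ≠ 0
    · obtain ⟨I, rfl, hI⟩ := hC
      have hI0 : I ≠ ⊥ := by
        rintro rfl
        exact hI (map_zero χ)
      -- A power of `I` is used because `J` must be prime to `𝔪`, which an arbitrary ideal in the
      -- inverse class need not be.
      let J := I ^ (Fintype.card (ClassGroup (𝓞 K)) - 1)
      have hJ : χ J ≠ 0 := by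
        rw [map_pow]
        exact pow_ne_zero _ hI
      have hJ0 : J ≠ ⊥ := pow_ne_zero _ hI0
      have hIJ : (idealClass J)⁻¹ = idealClass I := by
        rw [inv_eq_iff_mul_eq_one, idealClass_pow hI0, ← pow_succ,
          Nat.sub_add_cancel Fintype.card_pos, pow_card_eq_one]
      obtain ⟨B, hB⟩ := exists_abs_tsum_principalTerm_le χ 𝔪 J h𝔪 hJ0 (hcop J hJ) h1 hcop hper hodd
      refine ⟨|(χ J)⁻¹| * (Ideal.absNorm J : ℝ) ^ (2 : ℝ) * B, fun s hs1 hs2 => ⟨?_, ?_⟩⟩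
      · rw [← hIJ]
        exact summable_classTerm χ h1 hs1 hJ
      · rw [← hIJ, tsum_classTerm χ s hJ]
        refine (le_abs_self _).trans ?_
        rw [abs_mul, abs_mul, abs_of_nonneg (Real.rpow_nonneg (Nat.cast_nonneg _) s)]
        have hN : (1 : ℝ) ≤ Ideal.absNorm J := by
          exact_mod_cast Nat.pos_of_ne_zero (by rwa [Ne, Ideal.absNorm_eq_zero_iff])
        gcongr
        exact hB s hs1 hs2
    · push Not at hC
      refine ⟨0, fun s _ _ => ?_⟩
      have : classTerm χ s C = 0 := by
        funext I
        simp only [classTerm, Pi.zero_apply, ite_eq_right_iff]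
        intro h
        rw [hC I h, zero_mul]
      rw [this]
      exact ⟨summable_zero, by simp⟩
  choose B hB using key
  refine ⟨∑ C, B C, fun s hs1 hs2 => ?_⟩
  rw [← tsum_congr (sum_classTerm χ s), Summable.tsum_finsetSum fun C _ => (hB C s hs1 hs2).1]
  exact Finset.sum_le_sum fun C _ => (hB C s hs1 hs2).2

end

end NumberField.UnitCutoff


/-! ### Euler products by sieving -/

namespace NumberField.UnitCutoff

open NumberField Filter Topology IsDedekindDomain

section EulerProduct

open scoped Classical

variable {K : Type*} [Field K] [NumberField K]

/-- The part of an ideal sum that is prime to a finite set of primes. -/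
noncomputable def coprimeTerm (f : Ideal (𝓞 K) →*₀ ℝ) (S : Finset (HeightOneSpectrum (𝓞 K)))
    (I : Ideal (𝓞 K)) : ℝ := if ∀ p ∈ S, ¬ p.asIdeal ∣ I then f I else 0

theorem summable_coprimeTerm {f : Ideal (𝓞 K) →*₀ ℝ} (hf : Summable f)
    (S : Finset (HeightOneSpectrum (𝓞 K))) : Summable (coprimeTerm f S) := by
  refine Summable.of_norm_bounded hf.norm fun I => ?_
  rw [coprimeTerm]
  split_ifs <;> simp

/-- The terms removed are those at multiples of `p`, and complete multiplicativity factors `f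
p.asIdeal` out of their sum. -/
theorem tsum_coprimeTerm_insert {f : Ideal (𝓞 K) →*₀ ℝ} (hf : Summable f)
    (S : Finset (HeightOneSpectrum (𝓞 K))) {p : HeightOneSpectrum (𝓞 K)} (hp : p ∉ S) :
    ∑' I, coprimeTerm f (insert p S) I = (∑' I, coprimeTerm f S I) * (1 - f p.asIdeal) := by
  let g : Ideal (𝓞 K) → ℝ := fun I => if p.asIdeal ∣ I then coprimeTerm f S I else 0
  have h1 : ∀ I, coprimeTerm f (insert p S) I = coprimeTerm f S I - g I := by
    intro I
    by_cases hI : p.asIdeal ∣ I <;> simp [coprimeTerm, g, hI]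
  have hg : ∑' I, g I = f p.asIdeal * ∑' I, coprimeTerm f S I := by
    have hinj : Function.Injective fun I : Ideal (𝓞 K) => p.asIdeal * I :=
      mul_right_injective₀ p.ne_bot
    have hsupp : Function.support g ⊆ Set.range fun I : Ideal (𝓞 K) => p.asIdeal * I := by
      intro I hI
      have : p.asIdeal ∣ I := by
        by_contra h
        exact hI (if_neg h)
      obtain ⟨I', rfl⟩ := this
      exact ⟨I', rfl⟩
    rw [← hinj.tsum_eq hsupp, ← tsum_mul_left]
    refine tsum_congr fun I => ?_
    have h2 : ∀ q ∈ S, (q.asIdeal ∣ p.asIdeal * I ↔ q.asIdeal ∣ I) := by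
      intro q hq
      rw [q.prime.dvd_mul, or_iff_right]
      intro h
      have h3 : q.asIdeal = p.asIdeal :=
        (associated_iff_eq.1 ((q.prime.dvd_prime_iff_associated p.prime).1 h))
      exact hp (HeightOneSpectrum.ext h3 ▸ hq)
    have h4 : (∀ q ∈ S, ¬ q.asIdeal ∣ p.asIdeal * I) ↔ ∀ q ∈ S, ¬ q.asIdeal ∣ I :=
      forall₂_congr fun q hq => not_congr (h2 q hq)
    simp only [g, dvd_mul_right, if_true, coprimeTerm, h4, map_mul]
    split_ifs <;> simp
  have hgs : Summable g := by
    refine Summable.of_norm_bounded (summable_coprimeTerm hf S).norm fun I => ?_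
    simp only [g]
    split_ifs <;> simp
  rw [tsum_congr h1, (summable_coprimeTerm hf S).tsum_sub hgs, hg]
  ring

theorem tsum_coprimeTerm {f : Ideal (𝓞 K) →*₀ ℝ} (hf : Summable f)
    (S : Finset (HeightOneSpectrum (𝓞 K))) :
    ∑' I, coprimeTerm f S I = (∑' I, f I) * ∏ p ∈ S, (1 - f p.asIdeal) := by
  induction S using Finset.induction_on with
  | empty => simp [coprimeTerm]
  | insert p S hp ih =>
    rw [tsum_coprimeTerm_insert hf S hp, ih, Finset.prod_insert hp]
    ring

/-- As `S` grows only the unit ideal survives the sieve, and dominated convergence applies. In this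
form the Euler product also gives positivity of the sum when all its factors are positive, since the
limit is 1. -/
theorem tendsto_mul_prod_one_sub {f : Ideal (𝓞 K) →*₀ ℝ} (hf : Summable f) :
    Tendsto (fun S : Finset (HeightOneSpectrum (𝓞 K)) =>
      (∑' I, f I) * ∏ p ∈ S, (1 - f p.asIdeal)) atTop (𝓝 1) := by
  simp only [← tsum_coprimeTerm hf]
  have h1 : ∑' I : Ideal (𝓞 K), (if I = ⊤ then f I else 0) = 1 := by
    rw [tsum_eq_single (⊤ : Ideal (𝓞 K)) fun I hI => if_neg hI, if_pos rfl, ← Ideal.one_eq_top,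
      map_one]
  rw [← h1]
  refine tendsto_tsum_of_dominated_convergence hf.norm (fun I => ?_)
    (Eventually.of_forall fun S I => ?_)
  · refine tendsto_const_nhds.congr' ?_
    by_cases hI : I = ⊤
    · refine Eventually.of_forall fun S => ?_
      simp only [if_pos hI, coprimeTerm]
      rw [if_pos]
      intro p _ h
      rw [hI, Ideal.dvd_iff_le, top_le_iff] at h
      exact p.isPrime.ne_top h
    · rw [if_neg hI]
      by_cases h0 : I = ⊥
      · refine Eventually.of_forall fun S => ?_
        have : f ⊥ = 0 := map_zero f
        simp [coprimeTerm, h0, this]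
      · obtain ⟨M, hM, hIM⟩ := Ideal.exists_le_maximal I hI
        let p : HeightOneSpectrum (𝓞 K) := ⟨M, hM.isPrime, fun h => h0 (le_bot_iff.1 (h ▸ hIM))⟩
        filter_upwards [eventually_ge_atTop {p}] with S hS
        rw [coprimeTerm, if_neg]
        push Not
        exact ⟨p, hS (Finset.mem_singleton_self p), Ideal.dvd_iff_le.2 hIM⟩
  · rw [coprimeTerm]
    split_ifs <;> simp

theorem abs_log_one_sub_add_le {t : ℝ} (ht : |t| ≤ 1 / 2) : |-Real.log (1 - t) - t| ≤ 2 * t ^ 2 := by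
  have h := abs_le.1 ht
  have h1 : 0 < 1 - t := by linarith
  have h2 := Real.log_le_sub_one_of_pos h1
  have h3 := Real.one_sub_inv_le_log_of_pos h1
  have h4 : (1 - t)⁻¹ ≤ 1 + t + 2 * t ^ 2 := by
    rw [inv_le_iff_one_le_mul₀ h1]
    nlinarith [mul_nonneg (sq_nonneg t) (by linarith : 0 ≤ 1 - 2 * t)]
  rw [abs_le]
  constructor <;> nlinarith [sq_nonneg t]

theorem injective_asIdeal :
    Function.Injective (HeightOneSpectrum.asIdeal : HeightOneSpectrum (𝓞 K) → Ideal (𝓞 K)) :=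
  fun _ _ h => HeightOneSpectrum.ext h

variable (K) in
/-- A bound for the contribution of prime powers to the logarithm of an Euler product. -/
noncomputable def primePowerBound : ℝ :=
  ∑' p : HeightOneSpectrum (𝓞 K), 2 * (Ideal.absNorm p.asIdeal : ℝ) ^ (-(2 : ℝ))

theorem two_le_absNorm (p : HeightOneSpectrum (𝓞 K)) : (2 : ℝ) ≤ Ideal.absNorm p.asIdeal := by
  have h0 : Ideal.absNorm p.asIdeal ≠ 0 := by
    rw [Ne, Ideal.absNorm_eq_zero_iff]
    exact p.ne_bot
  have h1 : Ideal.absNorm p.asIdeal ≠ 1 := by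
    rw [Ne, Ideal.absNorm_eq_one_iff]
    exact p.isPrime.ne_top
  have : 2 ≤ Ideal.absNorm p.asIdeal := by omega
  exact_mod_cast this

variable (K) in
theorem summable_prime_absNorm_rpow {s : ℝ} (hs : 1 < s) :
    Summable fun p : HeightOneSpectrum (𝓞 K) => (Ideal.absNorm p.asIdeal : ℝ) ^ (-s) :=
  (summable_absNorm_rpow K hs).comp_injective injective_asIdeal

theorem summable_prime_mul (χ : HeightOneSpectrum (𝓞 K) → ℝ) (h1 : ∀ p, |χ p| ≤ 1)
    {s : ℝ} (hs : 1 < s) :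
    Summable fun p => χ p * (Ideal.absNorm p.asIdeal : ℝ) ^ (-s) := by
  refine Summable.of_norm_bounded (summable_prime_absNorm_rpow K hs) fun p => ?_
  rw [norm_mul, Real.norm_eq_abs, Real.norm_eq_abs,
    abs_of_nonneg (Real.rpow_nonneg (Nat.cast_nonneg _) _)]
  exact mul_le_of_le_one_left (Real.rpow_nonneg (Nat.cast_nonneg _) _) (h1 _)

/-- The logarithm of the Dirichlet series of a completely multiplicative function is, up to a
bounded error, the sum over the primes. -/
theorem abs_log_tsum_sub_le (χ : Ideal (𝓞 K) →*₀ ℝ) (h1 : ∀ I, |χ I| ≤ 1) {s : ℝ} (hs : 1 < s) :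
    0 < ∑' I, χ I * (Ideal.absNorm I : ℝ) ^ (-s) ∧
    |Real.log (∑' I, χ I * (Ideal.absNorm I : ℝ) ^ (-s)) -
      ∑' p : HeightOneSpectrum (𝓞 K), χ p.asIdeal * (Ideal.absNorm p.asIdeal : ℝ) ^ (-s)| ≤
        primePowerBound K := by
  let f : Ideal (𝓞 K) →*₀ ℝ :=
    { toFun := fun I => χ I * (Ideal.absNorm I : ℝ) ^ (-s)
      map_zero' := by rw [map_zero, zero_mul]
      map_one' := by rw [map_one, map_one, Nat.cast_one, Real.one_rpow, one_mul]
      map_mul' := fun I J => by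
        rw [map_mul, map_mul, Nat.cast_mul, Real.mul_rpow (by positivity) (by positivity)]
        ring }
  have hf : Summable f := summable_mul_absNorm_rpow χ h1 hs
  change 0 < ∑' I, f I ∧ |Real.log (∑' I, f I) -
    ∑' p : HeightOneSpectrum (𝓞 K), f p.asIdeal| ≤ primePowerBound K
  have hp : ∀ p : HeightOneSpectrum (𝓞 K),
      |f p.asIdeal| ≤ (Ideal.absNorm p.asIdeal : ℝ) ^ (-(1 : ℝ)) := fun p => by
    have h2 := two_le_absNorm p
    change |χ p.asIdeal * (Ideal.absNorm p.asIdeal : ℝ) ^ (-s)| ≤ _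
    rw [abs_mul, abs_of_nonneg (Real.rpow_nonneg (Nat.cast_nonneg _) (-s))]
    refine (mul_le_of_le_one_left (Real.rpow_nonneg (Nat.cast_nonneg _) _) (h1 _)).trans ?_
    exact Real.rpow_le_rpow_of_exponent_le (by linarith) (by linarith)
  have hhalf : ∀ p : HeightOneSpectrum (𝓞 K), |f p.asIdeal| ≤ 1 / 2 := fun p => by
    refine (hp p).trans ?_
    rw [Real.rpow_neg_one, one_div]
    exact inv_anti₀ two_pos (two_le_absNorm p)
  have hpos : ∀ p : HeightOneSpectrum (𝓞 K), 0 < 1 - f p.asIdeal := fun p => by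
    have := abs_le.1 (hhalf p)
    linarith
  have hlim := tendsto_mul_prod_one_sub hf
  have hL : 0 < ∑' I, f I := by
    by_contra hL
    have h3 : (1 : ℝ) ≤ 0 := le_of_tendsto hlim (Eventually.of_forall fun S =>
      mul_nonpos_of_nonpos_of_nonneg (not_lt.1 hL) (Finset.prod_nonneg fun p _ => (hpos p).le))
    linarith
  refine ⟨hL, ?_⟩
  have hlog := (Real.continuousAt_log one_ne_zero).tendsto.comp hlim
  rw [Real.log_one] at hlog
  have hsum : Summable fun p : HeightOneSpectrum (𝓞 K) => f p.asIdeal :=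
    hf.comp_injective injective_asIdeal
  have hb : Summable fun p : HeightOneSpectrum (𝓞 K) =>
      2 * (Ideal.absNorm p.asIdeal : ℝ) ^ (-(2 : ℝ)) :=
    (summable_prime_absNorm_rpow K one_lt_two).mul_left 2
  have hlim2 : Tendsto (fun S : Finset (HeightOneSpectrum (𝓞 K)) =>
      |∑ p ∈ S, (-Real.log (1 - f p.asIdeal) - f p.asIdeal)|) atTop
      (𝓝 |Real.log (∑' I, f I) - ∑' p : HeightOneSpectrum (𝓞 K), f p.asIdeal|) := by
    refine Tendsto.abs ?_
    have h4 := (hlog.const_sub (Real.log (∑' I, f I))).sub hsum.hasSum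
    rw [sub_zero] at h4
    refine h4.congr fun S => ?_
    simp only [Function.comp_apply]
    rw [Real.log_mul hL.ne' (Finset.prod_ne_zero_iff.2 fun p _ => (hpos p).ne'),
      Real.log_prod fun p _ => (hpos p).ne', Finset.sum_sub_distrib, Finset.sum_neg_distrib]
    ring
  refine le_of_tendsto hlim2 (Eventually.of_forall fun S => ?_)
  refine (Finset.abs_sum_le_sum_abs _ _).trans ((Finset.sum_le_sum fun p _ => ?_).trans
    (hb.sum_le_tsum S fun p _ => by positivity))
  refine (abs_log_one_sub_add_le (hhalf p)).trans ?_
  gcongr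
  rw [← sq_abs]
  refine (pow_le_pow_left₀ (abs_nonneg _) (hp p) 2).trans (le_of_eq ?_)
  rw [← Real.rpow_natCast, ← Real.rpow_mul (by positivity)]
  norm_num

end EulerProduct

end NumberField.UnitCutoff

/-! ### Comparison of densities as `s` tends to 1 -/

namespace NumberField.UnitCutoff

open NumberField Filter Topology IsDedekindDomain

section Density

variable (K : Type*) [Field K] [NumberField K]

/-- The Dedekind zeta function on the real half line `s > 1`. -/
noncomputable def realZeta (s : ℝ) : ℝ := ∑' I : Ideal (𝓞 K), (Ideal.absNorm I : ℝ) ^ (-s)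

/-- Grouping ideals by norm; this makes the simple pole of the Dedekind zeta function available for
the sum over ideals. -/
theorem dedekindZeta_eq_realZeta {s : ℝ} (hs : 1 < s) :
    dedekindZeta K (s : ℂ) = (realZeta K s : ℂ) := by
  have h := ((summable_absNorm_rpow K hs).hasSum.tsum_fiberwise
    (Ideal.absNorm : Ideal (𝓞 K) → ℕ)).tsum_eq
  rw [realZeta, ← h, Complex.ofReal_tsum, dedekindZeta, LSeries]
  refine tsum_congr fun n => ?_
  have h1 : ∑' I : (Ideal.absNorm : Ideal (𝓞 K) → ℕ) ⁻¹' {n},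
      (Ideal.absNorm (I : Ideal (𝓞 K)) : ℝ) ^ (-s) =
        Nat.card {I : Ideal (𝓞 K) // Ideal.absNorm I = n} * (n : ℝ) ^ (-s) := by
    have h2 : ∀ I : (Ideal.absNorm : Ideal (𝓞 K) → ℕ) ⁻¹' {n},
        (Ideal.absNorm (I : Ideal (𝓞 K)) : ℝ) ^ (-s) = (n : ℝ) ^ (-s) := fun I => by
      rw [show Ideal.absNorm (I : Ideal (𝓞 K)) = n from I.2]
    rw [tsum_congr h2, tsum_const, nsmul_eq_mul]
    rfl
  rw [h1]
  rcases Nat.eq_zero_or_pos n with rfl | hn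
  · simp [Real.zero_rpow (by linarith : -s ≠ 0)]
  · rw [LSeries.term_of_ne_zero hn.ne', Real.rpow_neg (by positivity)]
    push_cast
    rw [Complex.ofReal_cpow (by positivity), div_eq_mul_inv]
    simp

theorem tendsto_sub_one_mul_realZeta :
    Tendsto (fun s : ℝ => (s - 1) * realZeta K s) (𝓝[>] 1) (𝓝 (dedekindZeta_residue K)) := by
  have h := (Complex.continuous_re.tendsto _).comp (tendsto_sub_one_mul_dedekindZeta_nhdsGT K)
  rw [Complex.ofReal_re] at h
  refine h.congr' ?_
  filter_upwards [self_mem_nhdsWithin] with s hs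
  rw [Function.comp_apply, dedekindZeta_eq_realZeta K hs, ← Complex.ofReal_one,
    ← Complex.ofReal_sub, ← Complex.ofReal_mul, Complex.ofReal_re]

theorem tendsto_log_sub_one_mul_realZeta :
    Tendsto (fun s : ℝ => Real.log ((s - 1) * realZeta K s)) (𝓝[>] 1)
      (𝓝 (Real.log (dedekindZeta_residue K))) :=
  ((Real.continuousAt_log (dedekindZeta_residue_ne_zero K)).tendsto.comp
    (tendsto_sub_one_mul_realZeta K))

theorem tsum_trivChar {s : ℝ} (hs : 1 < s) :
    ∑' I, trivChar K I * (Ideal.absNorm I : ℝ) ^ (-s) = realZeta K s := by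
  refine tsum_congr fun I => ?_
  by_cases hI : I = ⊥
  · simp [hI, Real.zero_rpow (by linarith : -s ≠ 0)]
  · rw [trivChar_apply hI, one_mul]

theorem realZeta_pos {s : ℝ} (hs : 1 < s) : 0 < realZeta K s := by
  rw [← tsum_trivChar K hs]
  exact (abs_log_tsum_sub_le (trivChar K) abs_trivChar_le hs).1

theorem abs_log_realZeta_sub_le {s : ℝ} (hs : 1 < s) :
    |Real.log (realZeta K s) -
      ∑' p : HeightOneSpectrum (𝓞 K), (Ideal.absNorm p.asIdeal : ℝ) ^ (-s)| ≤
        primePowerBound K := by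
  have h := (abs_log_tsum_sub_le (trivChar K) abs_trivChar_le hs).2
  rw [tsum_trivChar K hs] at h
  simpa only [trivChar_apply (HeightOneSpectrum.ne_bot _), one_mul] using h

variable {K} in
open Classical in
/-- A set of primes, all of which split in a quadratic extension, cannot contain almost all the
primes at which one of two independent real characters is nontrivial. -/
theorem false_of_split_of_char (L : Type*) [Field L] [NumberField L]
    (T : Set (HeightOneSpectrum (𝓞 K)))
    (hT : ∃ C : ℝ, ∀ s : ℝ, 1 < s →
      2 * ∑' p : HeightOneSpectrum (𝓞 K), (if p ∈ T then 1 else 0) *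
        (Ideal.absNorm p.asIdeal : ℝ) ^ (-s) ≤ Real.log (realZeta L s) + C)
    (χ : Fin 3 → Ideal (𝓞 K) →*₀ ℝ) (h1 : ∀ i I, |χ i I| ≤ 1)
    (hχ : ∀ i, ∃ C : ℝ, ∀ s : ℝ, 1 < s → s ≤ 2 →
      ∑' I, χ i I * (Ideal.absNorm I : ℝ) ^ (-s) ≤ C)
    (Z : Finset (HeightOneSpectrum (𝓞 K)))
    (hZ : ∀ p ∉ Z, p ∉ T → ∀ i, χ i p.asIdeal = 1)
    (hZT : ∀ p ∉ Z, 0 ≤ 1 + ∑ i, χ i p.asIdeal) : False := by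
  obtain ⟨C, hC⟩ := hT
  choose D hD using hχ
  let B : ℝ := 3 * primePowerBound K + ∑ i, (Real.log (D i) + primePowerBound K) + 8 * Z.card +
    2 * C
  -- Write `Σ` and `Σ_T` for the sums of `N(p) ^ (-s)` over all primes and over `T`. The characters
  -- contribute at most `O(1)`, so `4Σ ≤ 4Σ_T + Σ + O(1)`, while `2Σ_T ≤ log ζ_L + C`. Since both
  -- `log ζ_K` and `log ζ_L` are `-log (s - 1) + O(1)`, the resulting inequality fails near 1.
  have key : ∀ s : ℝ, 1 < s → s ≤ 2 →
      3 * Real.log (realZeta K s) ≤ 2 * Real.log (realZeta L s) + B := by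
    intro s hs1 hs2
    let a : HeightOneSpectrum (𝓞 K) → ℝ := fun p => (Ideal.absNorm p.asIdeal : ℝ) ^ (-s)
    have ha0 : ∀ p, 0 ≤ a p := fun p => Real.rpow_nonneg (Nat.cast_nonneg _) _
    have ha1 : ∀ p, a p ≤ 1 := fun p =>
      Real.rpow_le_one_of_one_le_of_nonpos (by linarith [two_le_absNorm p]) (by linarith)
    have hsa : Summable a := summable_prime_absNorm_rpow K hs1
    have hsT : Summable fun p => (if p ∈ T then 1 else 0) * a p :=
      summable_prime_mul _ (fun p => by split_ifs <;> simp) hs1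
    have hsχ : ∀ i, Summable fun p => χ i p.asIdeal * a p := fun i =>
      summable_prime_mul (fun p => χ i p.asIdeal) (fun p => h1 i _) hs1
    have hsZ : HasSum (fun p => if p ∈ Z then a p else 0) (∑ p ∈ Z, a p) := by
      have : ∑ p ∈ Z, a p = ∑ p ∈ Z, if p ∈ Z then a p else 0 :=
        Finset.sum_congr rfl fun p hp => (if_pos hp).symm
      rw [this]
      exact hasSum_sum_of_ne_finset_zero fun p hp => if_neg hp
    -- Off `Z`, the bracket is nonnegative if `p ∈ T`, and equals `4 * a p` otherwise because all
    -- three characters are 1. On `Z` the bracket is at least `-2 * a p`, which the term with 8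
    -- absorbs.
    have hpt : ∀ p, 4 * a p ≤ 4 * ((if p ∈ T then 1 else 0) * a p) + (a p +
        ∑ i, χ i p.asIdeal * a p) + 8 * (if p ∈ Z then a p else 0) := by
      intro p
      have h3 : ∀ i, -1 ≤ χ i p.asIdeal := fun i => (abs_le.1 (h1 i p.asIdeal)).1
      have h4 : ∑ i, χ i p.asIdeal * a p = (∑ i, χ i p.asIdeal) * a p := by rw [Finset.sum_mul]
      have h5 : -3 ≤ ∑ i, χ i p.asIdeal := by
        rw [Fin.sum_univ_three]
        linarith [h3 0, h3 1, h3 2]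
      rw [h4]
      by_cases hp : p ∈ Z
      · rw [if_pos hp]
        have : 0 ≤ (if p ∈ T then (1 : ℝ) else 0) := by split_ifs <;> norm_num
        nlinarith [ha0 p, mul_nonneg this (ha0 p)]
      · rw [if_neg hp]
        by_cases hpT : p ∈ T
        · rw [if_pos hpT]
          nlinarith [ha0 p, hZT p hp]
        · rw [if_neg hpT]
          have h6 : ∑ i, χ i p.asIdeal = 3 := by
            simp [hZ p hp hpT]
          rw [h6]
          linarith
    have hsum := hasSum_le hpt (hsa.hasSum.mul_left 4)
      (((hsT.hasSum.mul_left 4).add (hsa.hasSum.add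
        (hasSum_sum fun i (_ : i ∈ Finset.univ) => (hsχ i).hasSum))).add (hsZ.mul_left 8))
    have hZ1 : ∑ p ∈ Z, a p ≤ Z.card := by
      have := Finset.sum_le_sum fun p (_ : p ∈ Z) => ha1 p
      simpa using this
    have hL : ∑ i, ∑' p : HeightOneSpectrum (𝓞 K), χ i p.asIdeal * a p ≤
        ∑ i, (Real.log (D i) + primePowerBound K) := by
      refine Finset.sum_le_sum fun i _ => ?_
      obtain ⟨h7, h8⟩ := abs_log_tsum_sub_le (χ i) (h1 i) hs1
      have h9 := Real.log_le_log h7 (hD i s hs1 hs2)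
      have := (abs_le.1 h8).1
      simp only [a]
      linarith
    have h10 := (abs_le.1 (abs_log_realZeta_sub_le K hs1)).2
    have h11 := hC s hs1
    simp only [B]
    simp only [a] at hsum hL hZ1
    linarith
  have h1mem : ∀ᶠ s : ℝ in 𝓝[>] 1, 1 < s ∧ s ≤ 2 := by
    filter_upwards [Ioc_mem_nhdsGT (one_lt_two : (1 : ℝ) < 2)] with s hs using hs
  have hlim : Tendsto (fun s : ℝ => 2 * Real.log ((s - 1) * realZeta L s) -
      3 * Real.log ((s - 1) * realZeta K s) + B) (𝓝[>] 1) (𝓝 (2 * Real.log (dedekindZeta_residue L) -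
        3 * Real.log (dedekindZeta_residue K) + B)) :=
    (((tendsto_log_sub_one_mul_realZeta L).const_mul 2).sub
      ((tendsto_log_sub_one_mul_realZeta K).const_mul 3)).add_const B
  have hbot : Tendsto (fun s : ℝ => Real.log (s - 1)) (𝓝[>] 1) atBot := by
    refine Real.tendsto_log_nhdsGT_zero.comp ?_
    refine tendsto_nhdsWithin_iff.2 ⟨?_, ?_⟩
    · have : Tendsto (fun s : ℝ => s - 1) (𝓝 1) (𝓝 (1 - 1)) := tendsto_id.sub_const 1
      rw [sub_self] at this
      exact this.mono_left nhdsWithin_le_nhds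
    · filter_upwards [h1mem] with s hs
      exact sub_pos.2 hs.1
  have hge : ∀ᶠ s : ℝ in 𝓝[>] 1, -Real.log (s - 1) ≤ 2 * Real.log ((s - 1) * realZeta L s) -
      3 * Real.log ((s - 1) * realZeta K s) + B := by
    filter_upwards [h1mem] with s hs
    have h2 : (s - 1) ≠ 0 := (sub_pos.2 hs.1).ne'
    rw [Real.log_mul h2 (realZeta_pos L hs.1).ne', Real.log_mul h2 (realZeta_pos K hs.1).ne']
    linarith [key s hs.1 hs.2]
  exact not_tendsto_nhds_of_tendsto_atTop
    (tendsto_atTop_mono' _ hge (tendsto_neg_atBot_atTop.comp hbot)) _ hlim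

end Density

end NumberField.UnitCutoff

/-! ### Splitting of primes in a quadratic extension -/

namespace NumberField.UnitCutoff

open NumberField Filter Topology IsDedekindDomain

section Quadratic

universe u

variable {K : Type u} [Field K] [NumberField K]

/-- In a quadratic extension generated by a square root of `b`, a prime not dividing `2 b` at which
`b` is a square has two primes of the same norm above it. -/
theorem exists_two_primes_over {L : Type*} [Field L] [NumberField L] [Algebra K L]
    (hfin : Module.finrank K L = 2) {b : 𝓞 K} {θ : 𝓞 L} (hθ : θ ^ 2 = algebraMap (𝓞 K) (𝓞 L) b)
    (σ : 𝓞 L ≃ₐ[𝓞 K] 𝓞 L) (hσ : σ θ = -θ) (p : HeightOneSpectrum (𝓞 K))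
    (h2 : (2 : 𝓞 K) ∉ p.asIdeal) (hb : b ∉ p.asIdeal) (hr : ∃ r : 𝓞 K, r ^ 2 - b ∈ p.asIdeal) :
    ∃ P : Bool → HeightOneSpectrum (𝓞 L), Function.Injective P ∧
      (∀ i, (P i).asIdeal.comap (algebraMap (𝓞 K) (𝓞 L)) = p.asIdeal) ∧
      ∀ i, Ideal.absNorm (P i).asIdeal = Ideal.absNorm p.asIdeal := by
  obtain ⟨r, hr⟩ := hr
  obtain ⟨P, hPm, hPp⟩ := Ideal.exists_maximal_ideal_liesOver_of_isIntegral (S := 𝓞 L) p.asIdeal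
  have hmem : ∀ c : 𝓞 K, algebraMap (𝓞 K) (𝓞 L) c ∈ P ↔ c ∈ p.asIdeal := fun c => by
    rw [hPp.over]; rfl
  have hr0 : r ∉ p.asIdeal := fun h => hb <| by
    have := sub_mem (Ideal.pow_mem_of_mem _ h 2 (by norm_num)) hr
    simpa using this
  have h2r : ∀ t : 𝓞 L, t - algebraMap (𝓞 K) (𝓞 L) r ∈ P →
      t + algebraMap (𝓞 K) (𝓞 L) r ∈ P → False := by
    intro t h3 h4
    have h5 := sub_mem h4 h3
    have h6 : t + algebraMap (𝓞 K) (𝓞 L) r - (t - algebraMap (𝓞 K) (𝓞 L) r) =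
        algebraMap (𝓞 K) (𝓞 L) (2 * r) := by
      rw [map_mul, map_ofNat]; ring
    rw [h6, hmem] at h5
    exact (p.isPrime.mem_or_mem h5).elim h2 hr0
  have hprod : (θ - algebraMap (𝓞 K) (𝓞 L) r) * (θ + algebraMap (𝓞 K) (𝓞 L) r) ∈ P := by
    have h3 : (θ - algebraMap (𝓞 K) (𝓞 L) r) * (θ + algebraMap (𝓞 K) (𝓞 L) r) =
        -algebraMap (𝓞 K) (𝓞 L) (r ^ 2 - b) := by
      rw [map_sub, map_pow, ← hθ]; ring
    rw [h3]
    exact neg_mem ((hmem _).2 hr)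
  -- The conjugate prime. As `θ ≡ ± r` modulo `P`, equality `P = Q` would put both `θ - r` and `θ +
  -- r` in `P`, hence also `2 * r`.
  let Q : Ideal (𝓞 L) := P.comap (σ : 𝓞 L →+* 𝓞 L)
  have hQm : Q.IsMaximal := Ideal.comap_isMaximal_of_equiv (p := P) (σ : 𝓞 L ≃+* 𝓞 L)
  have hQp : Q.LiesOver p.asIdeal := ⟨by
    ext c
    change _ ↔ σ (algebraMap (𝓞 K) (𝓞 L) c) ∈ P
    rw [σ.commutes, hmem]⟩
  have hPQ : P ≠ Q := by
    intro h
    rcases hPm.isPrime.mem_or_mem hprod with h3 | h3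
    · have h4 : σ (θ - algebraMap (𝓞 K) (𝓞 L) r) ∈ P := by rw [h] at h3; exact h3
      rw [map_sub, hσ, σ.commutes] at h4
      refine h2r θ h3 ?_
      have := neg_mem h4
      rwa [neg_sub, sub_neg_eq_add, add_comm] at this
    · have h4 : σ (θ + algebraMap (𝓞 K) (𝓞 L) r) ∈ P := by rw [h] at h3; exact h3
      rw [map_add, hσ, σ.commutes] at h4
      refine h2r θ ?_ h3
      have := neg_mem h4
      rwa [neg_add, neg_neg, ← sub_eq_add_neg] at this
  have hP0 : P ≠ ⊥ := Ideal.ne_bot_of_liesOver_of_ne_bot p.ne_bot P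
  have hQ0 : Q ≠ ⊥ := Ideal.ne_bot_of_liesOver_of_ne_bot p.ne_bot Q
  have hpm : p.asIdeal.IsMaximal := p.isMaximal
  have hsum := Ideal.sum_ramification_inertia (𝓞 L) K L (p := p.asIdeal) p.ne_bot
  rw [hfin] at hsum
  have hPmem : P ∈ IsDedekindDomain.primesOverFinset p.asIdeal (𝓞 L) :=
    (IsDedekindDomain.mem_primesOverFinset_iff p.ne_bot _).2 ⟨hPm.isPrime, hPp⟩
  have hQmem : Q ∈ IsDedekindDomain.primesOverFinset p.asIdeal (𝓞 L) :=
    (IsDedekindDomain.mem_primesOverFinset_iff p.ne_bot _).2 ⟨hQm.isPrime, hQp⟩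
  -- Two distinct primes in degree two leave no room for an inertia degree above 1, so both have the
  -- norm of `p`.
  have hle : ∑ R ∈ {P, Q}, Ideal.ramificationIdx' p.asIdeal R * Ideal.inertiaDeg' p.asIdeal R ≤ 2 := by
    rw [← hsum]
    refine Finset.sum_le_sum_of_subset fun R hR => ?_
    rcases Finset.mem_insert.1 hR with rfl | hR
    · exact hPmem
    · rw [Finset.mem_singleton.1 hR]; exact hQmem
  rw [Finset.sum_pair hPQ] at hle
  have e1 := Nat.pos_of_ne_zero (Ideal.IsDedekindDomain.ramificationIdx'_ne_zero_of_liesOver P p.ne_bot)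
  have e2 := Nat.pos_of_ne_zero (Ideal.IsDedekindDomain.ramificationIdx'_ne_zero_of_liesOver Q p.ne_bot)
  have f1 := Nat.pos_of_ne_zero (Ideal.inertiaDeg'_ne_zero p.asIdeal P)
  have f2 := Nat.pos_of_ne_zero (Ideal.inertiaDeg'_ne_zero p.asIdeal Q)
  have g1 := Nat.le_mul_of_pos_left (Ideal.inertiaDeg' p.asIdeal P) e1
  have g2 := Nat.le_mul_of_pos_left (Ideal.inertiaDeg' p.asIdeal Q) e2
  have n1 := Ideal.absNorm_eq_pow_inertiaDeg'_of_liesOver P p.asIdeal p.isPrime p.ne_bot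
  have n2 := Ideal.absNorm_eq_pow_inertiaDeg'_of_liesOver Q p.asIdeal p.isPrime p.ne_bot
  rw [show Ideal.inertiaDeg' p.asIdeal P = 1 by omega, pow_one] at n1
  rw [show Ideal.inertiaDeg' p.asIdeal Q = 1 by omega, pow_one] at n2
  refine ⟨fun i => if i then ⟨P, hPm.isPrime, hP0⟩ else ⟨Q, hQm.isPrime, hQ0⟩, ?_, ?_, ?_⟩
  · intro i j hij
    cases i <;> cases j <;> simp_all [eq_comm]
  · intro i
    cases i
    · exact hQp.over.symm
    · exact hPp.over.symm
  · intro i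
    cases i
    · exact n2
    · exact n1

theorem exists_quadratic_extension (b : 𝓞 K) (hb : ¬ IsSquare (b : K)) :
    ∃ (L : Type u) (_ : Field L) (_ : NumberField L) (_ : Algebra K L),
      Module.finrank K L = 2 ∧ ∃ (θ : 𝓞 L) (σ : 𝓞 L ≃ₐ[𝓞 K] 𝓞 L),
        θ ^ 2 = algebraMap (𝓞 K) (𝓞 L) b ∧ σ θ = -θ := by
  open Polynomial in
  have hmon : (X ^ 2 - C (b : K)).Monic := monic_X_pow_sub_C _ two_ne_zero
  have hdeg : (X ^ 2 - C (b : K)).natDegree = 2 := natDegree_X_pow_sub_C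
  have hirr : Irreducible (X ^ 2 - C (b : K)) := by
    refine (hmon.irreducible_iff_roots_eq_zero_of_degree_le_three hdeg.ge (by omega)).2 ?_
    refine Multiset.eq_zero_of_forall_notMem fun t ht => hb ⟨t, ?_⟩
    have := (mem_roots hmon.ne_zero).1 ht
    rw [IsRoot, eval_sub, eval_pow, eval_X, eval_C, sub_eq_zero] at this
    rw [← this, sq]
  have : Fact (Irreducible (X ^ 2 - C (b : K))) := ⟨hirr⟩
  let L := AdjoinRoot (X ^ 2 - C (b : K))
  have : Module.Finite K L := hmon.finite_adjoinRoot
  have : NumberField L := NumberField.of_module_finite K L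
  let ρ : L := AdjoinRoot.root _
  have hρ : ρ ^ 2 = algebraMap K L (b : K) := by
    have := AdjoinRoot.eval₂_root (X ^ 2 - C (b : K))
    rw [eval₂_sub, eval₂_pow, eval₂_X, eval₂_C, sub_eq_zero] at this
    exact this
  have hint : IsIntegral ℤ ρ := by
    refine IsIntegral.of_pow (n := 2) two_pos ?_
    rw [hρ]
    exact (RingOfIntegers.isIntegral_coe b).map (algebraMap K L).toIntAlgHom
  let s : L →ₐ[K] L := AdjoinRoot.liftAlgHom _ (Algebra.ofId K L) (-ρ) (by
    rw [eval₂_sub, eval₂_pow, eval₂_X, eval₂_C, sub_eq_zero, neg_sq, hρ]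
    rfl)
  have hs : s ρ = -ρ := AdjoinRoot.liftAlgHom_root _ _ _ _
  have hss : s.comp s = AlgHom.id K L := AdjoinRoot.algHom_ext (by
    change s (s ρ) = ρ
    rw [hs, map_neg, hs, neg_neg])
  let e : L ≃ₐ[K] L := AlgEquiv.ofAlgHom s s hss hss
  refine ⟨L, inferInstance, inferInstance, inferInstance, ?_, ⟨ρ, hint⟩,
    RingOfIntegers.mapAlgEquiv e, ?_, ?_⟩
  · rw [(AdjoinRoot.powerBasis hmon.ne_zero).finrank, AdjoinRoot.powerBasis_dim, hdeg]
  · exact RingOfIntegers.ext hρ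
  · exact RingOfIntegers.ext hs

open Classical in
/-- A set of primes at which a nonsquare `b` is a square has upper density at most one half, in the
form of a bound by the zeta function of the quadratic extension generated by `√b`. -/
theorem exists_tsum_le_log_realZeta (b : 𝓞 K) (hb : ¬ IsSquare (b : K))
    (T : Set (HeightOneSpectrum (𝓞 K)))
    (hT : ∀ p ∈ T, (2 : 𝓞 K) ∉ p.asIdeal → b ∉ p.asIdeal → ∃ r : 𝓞 K, r ^ 2 - b ∈ p.asIdeal) :
    ∃ (L : Type u) (_ : Field L) (_ : NumberField L), ∃ C : ℝ, ∀ s : ℝ, 1 < s →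
      2 * ∑' p : HeightOneSpectrum (𝓞 K), (if p ∈ T then 1 else 0) *
        (Ideal.absNorm p.asIdeal : ℝ) ^ (-s) ≤ Real.log (realZeta L s) + C := by
  obtain ⟨L, _, _, _, hfin, θ, σ, hθ, hσ⟩ := exists_quadratic_extension b hb
  have hb0 : b ≠ 0 := by
    rintro rfl
    exact hb ⟨0, by simp⟩
  have hfin2 : {p : HeightOneSpectrum (𝓞 K) | 2 * b ∈ p.asIdeal}.Finite := by
    have := Ideal.finite_factors (I := Ideal.span {2 * b}) (by simpa using hb0)
    simpa only [Ideal.dvd_span_singleton] using this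
  let S := hfin2.toFinset
  have hS : ∀ p, p ∉ S → (2 : 𝓞 K) ∉ p.asIdeal ∧ b ∉ p.asIdeal := by
    intro p hp
    have h1 : 2 * b ∉ p.asIdeal := by simpa [S] using hp
    exact ⟨fun h => h1 (Ideal.mul_mem_right _ _ h), fun h => h1 (Ideal.mul_mem_left _ _ h)⟩
  let U : Set (HeightOneSpectrum (𝓞 K)) := {p | p ∈ T ∧ p ∉ S}
  choose P hPinj hPover hPnorm using fun p : U =>
    exists_two_primes_over hfin hθ σ hσ p.1 (hS _ p.2.2).1 (hS _ p.2.2).2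
      (hT _ p.2.1 (hS _ p.2.2).1 (hS _ p.2.2).2)
  have hinj : Function.Injective fun q : U × Bool => P q.1 q.2 := by
    rintro ⟨p, i⟩ ⟨q, j⟩ h
    have h1 : p = q := Subtype.ext (HeightOneSpectrum.ext (by
      rw [← hPover p i, ← hPover q j]
      exact congrArg (fun R : HeightOneSpectrum (𝓞 L) =>
        R.asIdeal.comap (algebraMap (𝓞 K) (𝓞 L))) h))
    subst h1
    exact Prod.ext rfl (hPinj p h)
  refine ⟨L, inferInstance, inferInstance, primePowerBound L + 2 * S.card, fun s hs => ?_⟩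
  let a : HeightOneSpectrum (𝓞 K) → ℝ := fun p => (Ideal.absNorm p.asIdeal : ℝ) ^ (-s)
  have ha0 : ∀ p, 0 ≤ a p := fun p => Real.rpow_nonneg (Nat.cast_nonneg _) _
  have ha1 : ∀ p, a p ≤ 1 := fun p =>
    Real.rpow_le_one_of_one_le_of_nonpos (by linarith [two_le_absNorm p]) (by linarith)
  have hsa : Summable a := summable_prime_absNorm_rpow K hs
  have hsL := summable_prime_absNorm_rpow L hs
  have hsT : Summable fun p => (if p ∈ T then 1 else 0) * a p :=
    summable_prime_mul _ (fun p => by split_ifs <;> simp) hs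
  have hsZ : HasSum (fun p => if p ∈ S then a p else 0) (∑ p ∈ S, a p) := by
    have : ∑ p ∈ S, a p = ∑ p ∈ S, if p ∈ S then a p else 0 :=
      Finset.sum_congr rfl fun p hp => (if_pos hp).symm
    rw [this]
    exact hasSum_sum_of_ne_finset_zero fun p hp => if_neg hp
  have h1 : ∑' p, (if p ∈ T then 1 else 0) * a p ≤ ∑' p : U, a p + ∑ p ∈ S, a p := by
    rw [tsum_subtype U a]
    refine hasSum_le (fun p => ?_) hsT.hasSum ((hsa.indicator U).hasSum.add hsZ)
    by_cases hp : p ∈ S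
    · rw [if_pos hp]
      have := Set.indicator_nonneg (fun q _ => ha0 q) p (s := U)
      split_ifs <;> linarith [ha0 p]
    · rw [if_neg hp, add_zero]
      by_cases hpT : p ∈ T
      · rw [if_pos hpT, one_mul, Set.indicator_of_mem (show p ∈ U from ⟨hpT, hp⟩)]
      · rw [if_neg hpT, zero_mul]
        exact Set.indicator_nonneg (fun q _ => ha0 q) p
  -- Each prime of `U` yields two primes of `L` with its norm, and all of these are distinct: the
  -- left side is part of the sum over the primes of `L`.
  have h2 : 2 * ∑' p : U, a p ≤
      ∑' p : HeightOneSpectrum (𝓞 L), (Ideal.absNorm p.asIdeal : ℝ) ^ (-s) := by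
    have hcomp := hsL.comp_injective hinj
    have h3 : (fun q : U × Bool => (Ideal.absNorm (P q.1 q.2).asIdeal : ℝ) ^ (-s)) =
        fun q => a q.1 := by
      funext q
      rw [hPnorm]
    have h4 : ∑' q : U × Bool, a q.1 = 2 * ∑' p : U, a p := by
      have h5 : Summable fun q : U × Bool => a q.1 := by rw [← h3]; exact hcomp
      rw [h5.tsum_prod, ← tsum_mul_left]
      exact tsum_congr fun p => by simp [two_mul]
    rw [← h4, ← h3]
    exact Summable.tsum_le_tsum_of_inj _ hinj
      (fun _ _ => Real.rpow_nonneg (Nat.cast_nonneg _) _) (fun _ => le_rfl) hcomp hsL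
  have h3 := (abs_le.1 (abs_log_realZeta_sub_le L hs)).1
  have h4 : ∑ p ∈ S, a p ≤ S.card := by
    have := Finset.sum_le_sum fun p (_ : p ∈ S) => ha1 p
    simpa using this
  change 2 * ∑' p, (if p ∈ T then 1 else 0) * a p ≤ _
  linarith

end Quadratic

end NumberField.UnitCutoff

/-! ### Generators of Grothendieck-Witt groups, and finite fields -/

namespace GW

section Generators

variable {k L : Type*} [Field k] [AddCommGroup L] [Module k L]

theorem exists_isOrthSum (B₁ B₂ : SymForm k L) : ∃ B : SymForm k L, B.IsOrthSum B₁ B₂ ∧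
    B.n = B₁.n + B₂.n := by
  let e : ((Fin B₁.n → k) × (Fin B₂.n → k)) ≃ₗ[k] (Fin (B₁.n + B₂.n) → k) :=
    LinearEquiv.ofFinrankEq _ _ (by simp)
  let p₁ := (LinearMap.fst k _ _).comp e.symm.toLinearMap
  let p₂ := (LinearMap.snd k _ _).comp e.symm.toLinearMap
  let C := B₁.B.compl₁₂ p₁ p₁ + B₂.B.compl₁₂ p₂ p₂
  have hC : ∀ x y, C (e x) (e y) = B₁.B x.1 y.1 + B₂.B x.2 y.2 := fun x y => by
    simp [C, p₁, p₂]
  refine ⟨⟨_, C, fun x y => ?_, fun x hx => ?_⟩, ⟨e, hC⟩, rfl⟩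
  · obtain ⟨x, rfl⟩ := e.surjective x
    obtain ⟨y, rfl⟩ := e.surjective y
    rw [hC, hC, B₁.symm, B₂.symm]
  · obtain ⟨x, rfl⟩ := e.surjective x
    have h1 : x.1 = 0 := B₁.nondeg _ fun y => by simpa [hC] using hx (e (y, 0))
    have h2 : x.2 = 0 := B₂.nondeg _ fun y => by simpa [hC] using hx (e (0, y))
    rw [show x = 0 from Prod.ext h1 h2, map_zero]

/-- An anisotropic vector splits off. -/
theorem exists_split {ℓ : L} (hℓ : ℓ ≠ 0) (h1 : ∀ m : L, ∃ a : k, m = a • ℓ) (B : SymForm k L)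
    (v : Fin B.n → k) (hv : B.B v v ≠ 0) : ∃ (a : kˣ) (B' : SymForm k L), B'.n + 1 = B.n ∧
      mk B = angle hℓ a + mk B' ∧
      ∀ w, B.B v w = 0 → ∃ w', B'.B w' w' = B.B w w := by
  let φ : k ≃ₗ[k] L := LinearEquiv.ofBijective (LinearMap.toSpanSingleton k L ℓ)
    ⟨smul_left_injective k hℓ, fun m => by
      obtain ⟨a, rfl⟩ := h1 m
      exact ⟨a, rfl⟩⟩
  have hφ : ∀ m, φ.symm m • ℓ = m := fun m => φ.apply_symm_apply m
  let f : (Fin B.n → k) →ₗ[k] k := φ.symm.toLinearMap.comp (B.B v)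
  have hf : ∀ w, B.B v w = f w • ℓ := fun w => (hφ _).symm
  have hfv : f v ≠ 0 := fun h => hv (by rw [hf, h, zero_smul])
  let a : kˣ := Units.mk0 (f v) hfv
  have hdim : Module.finrank k (LinearMap.ker f) + 1 = B.n := by
    rw [Module.Dual.finrank_ker_add_one_of_ne_zero (f := f) (fun h => hfv (by rw [h]; rfl)),
      Module.finrank_fin_fun]
  let g : (Fin (Module.finrank k (LinearMap.ker f)) → k) ≃ₗ[k] LinearMap.ker f :=
    LinearEquiv.ofFinrankEq _ _ (by simp)
  let i : (Fin (Module.finrank k (LinearMap.ker f)) → k) →ₗ[k] (Fin B.n → k) :=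
    (LinearMap.ker f).subtype.comp g.toLinearMap
  have hi : ∀ w, f (i w) = 0 := fun w => (g w).2
  have hvi : ∀ w, B.B v (i w) = 0 := fun w => by rw [hf, hi, zero_smul]
  let F : ((Fin 1 → k) × (Fin (Module.finrank k (LinearMap.ker f)) → k)) →ₗ[k] (Fin B.n → k) :=
    LinearMap.coprod ((LinearMap.toSpanSingleton k _ v).comp (LinearMap.proj 0)) i
  have hF : ∀ x, F x = x.1 0 • v + i x.2 := fun x => rfl
  have hinj : Function.Injective F := by
    rw [← LinearMap.ker_eq_bot, LinearMap.ker_eq_bot']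
    intro x hx
    rw [hF] at hx
    have h2 := congrArg f hx
    rw [map_add, hi, add_zero, map_smul, map_zero, smul_eq_mul, mul_eq_zero,
      or_iff_left hfv] at h2
    rw [h2, zero_smul, zero_add] at hx
    have h3 : g x.2 = 0 := Subtype.ext hx
    refine Prod.ext (funext fun j => ?_) (by simpa using h3)
    rw [Subsingleton.elim j 0]
    exact h2
  let e := LinearEquiv.ofInjectiveOfFinrankEq F hinj (by simp [← hdim, add_comm])
  have he : ∀ x, e x = x.1 0 • v + i x.2 := hF
  let B' : SymForm k L :=
    { n := Module.finrank k (LinearMap.ker f)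
      B := B.B.compl₁₂ i i
      symm := fun x y => B.symm _ _
      nondeg := fun x hx => by
        have h2 : i x = 0 := B.nondeg _ fun y => by
          obtain ⟨y, rfl⟩ := e.surjective y
          rw [he, map_add, map_smul, B.symm _ v, hvi, smul_zero, zero_add]
          exact hx y.2
        have h3 : g x = 0 := Subtype.ext h2
        simpa using h3 }
  have hsum : ∀ x y, B.B (e x) (e y) =
      ((a : k) * x.1 0 * y.1 0) • ℓ + B.B (i x.2) (i y.2) := by
    intro x y
    rw [he, he]
    simp only [map_add, map_smul, LinearMap.add_apply, LinearMap.smul_apply, hvi, B.symm _ v,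
      smul_zero, add_zero, zero_add]
    rw [hf v, smul_smul, smul_smul]
    congr 2
    simp only [a, Units.val_mk0]
    ring
  -- A vector orthogonal to `v` lies in `ker f`, so its value is still attained in the complement.
  -- This is what lets an alternating form be diagonalized after adding a rank one form.
  refine ⟨a, B', hdim, mk_orthSum ⟨e, hsum⟩, fun w hw => ?_⟩
  · have hw0 : f w = 0 := by rw [hf] at hw; simpa [hℓ] using hw
    refine ⟨g.symm ⟨w, hw0⟩, ?_⟩
    have : i (g.symm ⟨w, hw0⟩) = w := by simp [i]
    change B.B (i _) (i _) = _
    rw [this]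

/-- Over a line `L`, the group `GW(k, L)` is generated by the rank one forms. -/
theorem mk_mem_closure_angle {ℓ : L} (hℓ : ℓ ≠ 0) (h1 : ∀ m : L, ∃ a : k, m = a • ℓ)
    (B : SymForm k L) : mk B ∈ AddSubgroup.closure (Set.range (angle (k := k) hℓ)) := by
  have hang : ∀ a : kˣ, angle hℓ a ∈ AddSubgroup.closure (Set.range (angle (k := k) hℓ)) :=
    fun a => AddSubgroup.subset_closure ⟨a, rfl⟩
  obtain ⟨n, hn⟩ : ∃ n, B.n = n := ⟨_, rfl⟩
  induction n generalizing B with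
  | zero =>
    have h0 : B.IsOrthSum B B := by
      have : IsEmpty (Fin B.n) := by rw [hn]; infer_instance
      exact ⟨LinearEquiv.ofFinrankEq _ _ (by simp [hn]), fun x y => by
        simp [Subsingleton.elim _ (0 : Fin B.n → k)]⟩
    rw [left_eq_add.1 (mk_orthSum h0)]
    exact zero_mem _
  | succ n ih =>
    have hsplit : ∀ (C : SymForm k L), C.n = n + 1 → ∀ v, C.B v v ≠ 0 →
        mk C ∈ AddSubgroup.closure (Set.range (angle (k := k) hℓ)) := by
      intro C hC v hv
      obtain ⟨a, C', h2, h3, -⟩ := exists_split hℓ h1 C v hv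
      rw [h3]
      exact add_mem (hang a) (ih C' (by omega))
    by_cases hB : ∃ v, B.B v v ≠ 0
    · obtain ⟨v, hv⟩ := hB
      exact hsplit B hn v hv
    -- Now `B` is alternating and has no vector to split off. After adding `⟨1⟩` with basis vector
    -- `f`, the vector `v + f` has value `ℓ` and splits off; `w + f`, with `B(v, w) = -ℓ`, is
    -- orthogonal to it and again has value `ℓ`, so the complement falls under `hsplit` too.
    -- Subtracting `⟨1⟩` recovers `B`.
    · push Not at hB
      obtain ⟨C, ⟨e, he⟩, hCn⟩ := exists_isOrthSum B (SymForm.unary hℓ (1 : kˣ))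
      have hC := mk_orthSum ⟨e, he⟩
      have h1n : (SymForm.unary hℓ (1 : kˣ)).n = 1 := rfl
      let v : Fin B.n → k := Pi.single ⟨0, by omega⟩ 1
      have hv : v ≠ 0 := by
        intro h
        have := congrFun h ⟨0, by omega⟩
        simp [v] at this
      obtain ⟨w₀, hw₀⟩ : ∃ w, B.B v w ≠ 0 := by
        by_contra! h
        exact hv (B.nondeg _ h)
      obtain ⟨c, hc⟩ := h1 (B.B v w₀)
      have hc0 : c ≠ 0 := by
        rintro rfl
        exact hw₀ (by rw [hc, zero_smul])
      let w := -(c⁻¹ • w₀)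
      have hvw : B.B v w = -ℓ := by
        simp [w, hc, smul_smul, hc0]
      have ho : ∀ x y : Fin B.n → k, C.B (e (x, fun _ => 1)) (e (y, fun _ => 1)) =
          B.B x y + ℓ := fun x y => by
        rw [he]
        change B.B x y + (((1 : kˣ) : k) * 1 * 1) • ℓ = _
        simp
      obtain ⟨a, D, hD, hCD, hw⟩ := exists_split hℓ h1 C (e (v, fun _ => 1)) (by
        rw [ho]; simpa [hB] using hℓ)
      obtain ⟨w', hw'⟩ := hw (e (w, fun _ => 1)) (by rw [ho]; simp [hvw])
      have hDm := hsplit D (by omega) w' (by rw [hw', ho]; simpa [hB] using hℓ)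
      have : mk B = angle hℓ a + mk D - angle hℓ 1 := by
        rw [← hCD, hC, angle, add_sub_cancel_right]
      rw [this]
      exact sub_mem (add_mem (hang a) hDm) (hang 1)

theorem closure_angle {ℓ : L} (hℓ : ℓ ≠ 0) (h1 : ∀ m : L, ∃ a : k, m = a • ℓ) :
    AddSubgroup.closure (Set.range (angle (k := k) hℓ)) = ⊤ := by
  refine top_le_iff.1 fun z hz => ?_
  clear hz
  obtain ⟨y, rfl⟩ := QuotientAddGroup.mk_surjective z
  induction y using FreeAbelianGroup.induction_on with
  | zero => exact zero_mem _
  | of B => exact mk_mem_closure_angle hℓ h1 B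
  | neg B ih => exact neg_mem ih
  | add x y hx hy => exact add_mem hx hy

/-- Over a finite field `u = a² + b²`, and `(a, b)`, `(-b, a)` is an orthogonal basis of `⟨1⟩ ⊥ ⟨1⟩`
on which both values are `u`. Hence differences of rank one classes are 2-torsion. -/
theorem angle_add_self [Finite k] {ℓ : L} (hℓ : ℓ ≠ 0) (u : kˣ) :
    angle hℓ u + angle hℓ u = angle hℓ 1 + angle hℓ 1 := by
  have := Fintype.ofFinite k
  obtain ⟨a, b, hab⟩ : ∃ a b : k, a ^ 2 + b ^ 2 = u := by
    by_cases h2 : ringChar k = 2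
    · obtain ⟨a, ha⟩ := FiniteField.isSquare_of_char_two h2 (u : k)
      exact ⟨a, 0, by rw [ha]; ring⟩
    · obtain ⟨a, b, h⟩ := FiniteField.exists_root_sum_quadratic (R := k)
        (f := Polynomial.X ^ 2) (g := Polynomial.X ^ 2 - Polynomial.C (u : k))
        (Polynomial.degree_X_pow 2) (Polynomial.degree_X_pow_sub_C two_pos _)
        (FiniteField.odd_card_of_char_ne_two h2)
      refine ⟨a, b, ?_⟩
      simp only [Polynomial.eval_sub, Polynomial.eval_pow, Polynomial.eval_X,
        Polynomial.eval_C] at h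
      linear_combination h
  refine (angle_add_angle hℓ 1 1 u u a b (-b) a ?_ ?_ ?_).symm
  · rw [← hab]; simp
  · rw [← hab]; simp; ring
  · simp; ring

end Generators

end GW

/-! ### Reduction of integral elements at a closed point -/

namespace ClosedPoint

open IsDedekindDomain IsLocalRing

section Reduction

variable {R : Type*} [CommRing R] [IsDedekindDomain R] {K : Type*} [Field K]
  [Algebra R K] [IsFractionRing R K] (x : HeightOneSpectrum R)

variable (K) in
/-- Reduction `R → κ(x)` at the closed point `x`. -/
noncomputable def reduction : R →+* κ K x :=
  (residue (locRing K x)).comp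
    ((algebraMap R K).codRestrict (locRing K x).toSubring fun r => x.valuation_le_one r)

theorem reduction_eq_zero_iff (r : R) : reduction K x r = 0 ↔ r ∈ x.asIdeal := by
  rw [← x.valuation_lt_one_iff_mem (K := K)]
  change residue _ _ = 0 ↔ _
  rw [residue_eq_zero_iff, Valuation.mem_maximalIdeal_iff]
  rfl

theorem reduction_surjective : Function.Surjective (reduction K x) := by
  intro y
  obtain ⟨⟨y, hy⟩, rfl⟩ := residue_surjective y
  obtain ⟨r, hr⟩ := x.exists_valuation_sub_lt_of_integer (x := y) hy 1
  refine ⟨r, ?_⟩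
  change residue _ _ = _
  rw [← sub_eq_zero, ← map_sub, residue_eq_zero_iff, Valuation.mem_maximalIdeal_iff]
  exact hr

variable {u : Kˣ} {r : R}

theorem intValuation_eq_exp_neg_ord (hu : (u : K) = algebraMap R K r) :
    x.intValuation r = WithZero.exp (-(ord x u).toAdd) := by
  rw [← valuation_eq, hu, ← x.valuation_of_algebraMap (K := K)]

theorem ord_nonneg (hu : (u : K) = algebraMap R K r) : 0 ≤ (ord x u).toAdd := by
  have h := x.intValuation_le_one r
  rw [intValuation_eq_exp_neg_ord x hu, ← WithZero.exp_zero, WithZero.exp_le_exp] at h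
  omega

theorem ord_pos_iff_mem (hu : (u : K) = algebraMap R K r) :
    0 < (ord x u).toAdd ↔ r ∈ x.asIdeal := by
  rw [ord_pos_iff, hu]
  exact x.valuation_lt_one_iff_mem r

theorem ord_eq_zero_iff_notMem (hu : (u : K) = algebraMap R K r) :
    (ord x u).toAdd = 0 ↔ r ∉ x.asIdeal := by
  rw [← ord_pos_iff_mem x hu]
  have := ord_nonneg x hu
  omega

theorem coe_leadCoeff_eq_reduction {π : Kˣ} (hπ : ord x π = Multiplicative.ofAdd 1)
    (hu : (u : K) = algebraMap R K r) (hrx : r ∉ x.asIdeal) :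
    (leadCoeff hπ u : κ K x) = reduction K x r := by
  rw [coe_leadCoeff hπ ((ord_eq_zero_iff x _).1 ((ord_eq_zero_iff_notMem x hu).2 hrx))]
  change residue _ _ = residue _ _
  congr 1
  exact Subtype.ext hu

open Classical in
theorem ord_eq_count (hu : (u : K) = algebraMap R K r) : (ord x u).toAdd =
    ((Associates.mk x.asIdeal).count (Associates.mk (Ideal.span {r})).factors : ℤ) := by
  have hr : r ≠ 0 := by
    rintro rfl
    exact u.ne_zero (by rw [hu, map_zero])
  have h := intValuation_eq_exp_neg_ord x hu
  rw [x.intValuation_if_neg hr, WithZero.exp_inj, neg_inj] at h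
  exact h.symm

theorem ord_eq_one_of_notMem_sq (hu : (u : K) = algebraMap R K r) (h1 : r ∈ x.asIdeal)
    (h2 : r ∉ x.asIdeal ^ 2) : (ord x u).toAdd = 1 := by
  have h3 := (ord_pos_iff_mem x hu).2 h1
  have h4 : (ord x u).toAdd < 2 := by
    by_contra! h
    refine h2 ((x.intValuation_le_pow_iff_mem r 2).1 ?_)
    rw [intValuation_eq_exp_neg_ord x hu, WithZero.exp_le_exp]
    simpa using h
  omega

end Reduction

open NumberField in
instance {K : Type*} [Field K] [NumberField K] (x : HeightOneSpectrum (𝓞 K)) :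
    Finite (κ K x) := by
  have : Finite (𝓞 K ⧸ x.asIdeal) := Ideal.finiteQuotientOfFreeOfNeBot _ x.ne_bot
  refine Finite.of_surjective (Ideal.Quotient.lift x.asIdeal (reduction K x)
    fun r hr => (reduction_eq_zero_iff x r).2 hr) ?_
  exact Ideal.Quotient.lift_surjective_of_surjective _ _ (reduction_surjective x)

end ClosedPoint

/-! ### Ideal characters from a tame product formula -/

namespace NumberField.Reciprocity

open NumberField NumberField.UnitCutoff IsDedekindDomain ClosedPoint Function

section PrimeChar

open scoped Classical

variable {K : Type*} [Field K] [NumberField K]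

/-- The exponent of a prime in the factorization of an ideal. -/
noncomputable def expo (x : HeightOneSpectrum (𝓞 K)) (I : Ideal (𝓞 K)) : ℕ :=
  (Associates.mk x.asIdeal).count (Associates.mk I).factors

theorem expo_mul (x : HeightOneSpectrum (𝓞 K)) {I J : Ideal (𝓞 K)} (hI : I ≠ ⊥) (hJ : J ≠ ⊥) :
    expo x (I * J) = expo x I + expo x J := by
  rw [expo, ← Associates.mk_mul_mk, Associates.count_mul (Associates.mk_ne_zero.2 hI)
    (Associates.mk_ne_zero.2 hJ) x.associates_irreducible]
  rfl

theorem expo_ne_zero_iff (x : HeightOneSpectrum (𝓞 K)) {I : Ideal (𝓞 K)} (hI : I ≠ ⊥) :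
    expo x I ≠ 0 ↔ x.asIdeal ∣ I := Associates.count_ne_zero_iff_dvd hI x.irreducible

theorem expo_top (x : HeightOneSpectrum (𝓞 K)) : expo x ⊤ = 0 := by
  by_contra h
  have := Ideal.le_of_dvd ((expo_ne_zero_iff x top_ne_bot).1 h)
  exact x.isPrime.ne_top (top_le_iff.1 this)

theorem expo_asIdeal (x y : HeightOneSpectrum (𝓞 K)) :
    expo x y.asIdeal = if x = y then 1 else 0 := by
  split_ifs with h
  · subst h
    exact Associates.count_self x.associates_irreducible
  · by_contra h1
    have h2 := Ideal.le_of_dvd ((expo_ne_zero_iff x y.ne_bot).1 h1)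
    exact h (HeightOneSpectrum.ext (y.isMaximal.eq_of_le x.isPrime.ne_top h2).symm)

theorem ord_eq_expo (x : HeightOneSpectrum (𝓞 K)) {u : Kˣ} {r : 𝓞 K} (hu : (u : K) = r) :
    (ord x u).toAdd = expo x (Ideal.span {r}) := ord_eq_count x hu

theorem hasFiniteMulSupport_pow_expo (g : HeightOneSpectrum (𝓞 K) → ℝ) {I : Ideal (𝓞 K)}
    (hI : I ≠ ⊥) : HasFiniteMulSupport fun x => g x ^ expo x I := by
  refine (Ideal.finite_factors hI).subset fun x hx => ?_
  rw [Set.mem_ofPred_eq, ← expo_ne_zero_iff x hI]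
  intro h
  exact hx (by simp [h])

/-- The completely multiplicative function on ideals with given values at the primes. -/
noncomputable def primeChar (g : HeightOneSpectrum (𝓞 K) → ℝ) : Ideal (𝓞 K) →*₀ ℝ where
  toFun I := if I = ⊥ then 0 else ∏ᶠ x, g x ^ expo x I
  map_zero' := if_pos rfl
  map_one' := by
    rw [Ideal.one_eq_top, if_neg top_ne_bot]
    simp [expo_top]
  map_mul' I J := by
    by_cases hI : I = ⊥
    · simp [hI]
    by_cases hJ : J = ⊥
    · simp [hJ]
    have hIJ : I * J ≠ ⊥ := mul_ne_zero hI hJ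
    rw [if_neg hI, if_neg hJ, if_neg hIJ, ← finprod_mul_distrib
      (hasFiniteMulSupport_pow_expo g hI) (hasFiniteMulSupport_pow_expo g hJ)]
    simp only [expo_mul _ hI hJ, pow_add]

theorem primeChar_apply (g : HeightOneSpectrum (𝓞 K) → ℝ) {I : Ideal (𝓞 K)} (hI : I ≠ ⊥) :
    primeChar g I = ∏ᶠ x, g x ^ expo x I := if_neg hI

theorem primeChar_asIdeal (g : HeightOneSpectrum (𝓞 K) → ℝ) (x : HeightOneSpectrum (𝓞 K)) :
    primeChar g x.asIdeal = g x := by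
  rw [primeChar_apply g x.ne_bot, finprod_eq_single _ x fun y hy => by simp [expo_asIdeal, hy]]
  simp [expo_asIdeal]

theorem abs_primeChar_le {g : HeightOneSpectrum (𝓞 K) → ℝ} (hg : ∀ x, |g x| ≤ 1)
    (I : Ideal (𝓞 K)) : |primeChar g I| ≤ 1 := by
  by_cases hI : I = ⊥
  · have : primeChar g ⊥ = 0 := map_zero _
    simp [hI, this]
  · rw [primeChar_apply g hI, finprod_eq_prod _ (hasFiniteMulSupport_pow_expo g hI),
      Finset.abs_prod]
    exact Finset.prod_le_one (fun _ _ => abs_nonneg _) fun x _ => by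
      rw [abs_pow]
      exact pow_le_one₀ (abs_nonneg _) (hg x)

theorem primeChar_eq_zero {g : HeightOneSpectrum (𝓞 K) → ℝ} {x : HeightOneSpectrum (𝓞 K)}
    (hx : g x = 0) {I : Ideal (𝓞 K)} (hI : x.asIdeal ∣ I) : primeChar g I = 0 := by
  obtain ⟨J, rfl⟩ := hI
  rw [map_mul, primeChar_asIdeal, hx, zero_mul]

theorem primeChar_mul (g g' : HeightOneSpectrum (𝓞 K) → ℝ) {I : Ideal (𝓞 K)} (hI : I ≠ ⊥) :
    primeChar (fun x => g x * g' x) I = primeChar g I * primeChar g' I := by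
  rw [primeChar_apply _ hI, primeChar_apply _ hI, primeChar_apply _ hI, ← finprod_mul_distrib
    (hasFiniteMulSupport_pow_expo g hI) (hasFiniteMulSupport_pow_expo g' hI)]
  simp only [mul_pow]

theorem exists_sub_mem_pow_and_sub_one_mem (Z : Finset (HeightOneSpectrum (𝓞 K)))
    (y : HeightOneSpectrum (𝓞 K)) (s : 𝓞 K) (n : ℕ) : ∃ r : 𝓞 K, r - s ∈ y.asIdeal ^ n ∧
      ∀ x ∈ Z, x ≠ y → r - 1 ∈ x.asIdeal := by
  obtain ⟨r, hr⟩ := IsDedekindDomain.exists_forall_sub_mem_ideal (s := insert y Z)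
    (fun x => x.asIdeal) (fun x => if x = y then n else 1) (fun x _ => x.prime)
    (fun x _ z _ h h1 => h (HeightOneSpectrum.ext h1)) (fun x => if x.1 = y then s else 1)
  refine ⟨r, ?_, fun x hx hxy => ?_⟩
  · simpa using hr y (Finset.mem_insert_self _ _)
  · simpa [hxy] using hr x (Finset.mem_insert_of_mem hx)

end PrimeChar

section Symbol

open scoped Classical

variable {K : Type*} [Field K] [NumberField K]

/-- The leading coefficient at `x` with respect to the chosen uniformizer. -/
noncomputable abbrev lead (x : HeightOneSpectrum (𝓞 K)) : Kˣ →* (κ K x)ˣ := leadCoeff (ord_unif x)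

/-- The tame symbol at `x`, up to squares. -/
noncomputable def tame (x : HeightOneSpectrum (𝓞 K)) (a c : Kˣ) : (κ K x)ˣ :=
  (-1) ^ ((ord x a).toAdd * (ord x c).toAdd) * lead x a ^ (ord x c).toAdd *
    lead x c ^ (ord x a).toAdd

theorem hasFiniteMulSupport_tame (ψ : ∀ x : HeightOneSpectrum (𝓞 K), (κ K x)ˣ →* ℤˣ) (a c : Kˣ) :
    HasFiniteMulSupport fun x => ψ x (tame x a c) := by
  refine ((ChowWitt.finite_ord_ne (𝓞 K) a).union (ChowWitt.finite_ord_ne (𝓞 K) c)).subset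
    fun x hx => ?_
  by_contra h
  simp only [Set.mem_union, Set.mem_ofPred_eq, not_or, not_not] at h
  exact hx (by simp [tame, h.1, h.2])

theorem units_zpow_of_even (u : ℤˣ) {n : ℤ} (hn : Even n) : u ^ n = 1 := by
  obtain ⟨m, rfl⟩ := hn
  rw [← two_mul, zpow_mul]
  simp [zpow_ofNat]

theorem units_zpow_of_odd (u : ℤˣ) {n : ℤ} (hn : Odd n) : u ^ n = u := by
  obtain ⟨m, rfl⟩ := hn
  rw [zpow_add_one, units_zpow_of_even u (even_two_mul m), one_mul]

theorem map_tame_of_even {x : HeightOneSpectrum (𝓞 K)} (φ : (κ K x)ˣ →* ℤˣ) {a : Kˣ}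
    (ha : Even (ord x a).toAdd) (c : Kˣ) :
    φ (tame x a c) = φ (lead x a) ^ (ord x c).toAdd := by
  simp only [tame, map_mul, map_zpow]
  rw [units_zpow_of_even _ ha, units_zpow_of_even _ (ha.mul_right _), one_mul, mul_one]

theorem map_tame_of_odd {x : HeightOneSpectrum (𝓞 K)} (φ : (κ K x)ˣ →* ℤˣ) {a c : Kˣ}
    (ha : Odd (ord x a).toAdd) (hc : (ord x c).toAdd = 0) : φ (tame x a c) = φ (lead x c) := by
  simp only [tame, map_mul, map_zpow, hc]
  rw [units_zpow_of_odd _ ha]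
  simp

/-- The inclusion of `{1, -1}` in the real numbers. -/
noncomputable def signHom : ℤˣ →* ℝ := (Int.castRingHom ℝ).toMonoidHom.comp (Units.coeHom ℤ)

theorem signHom_eq (u : ℤˣ) : signHom u = 1 ∨ signHom u = -1 := by
  rcases Int.units_eq_one_or u with rfl | rfl
  · left; simp
  · right; simp [signHom]

theorem signHom_eq_one_iff {u : ℤˣ} : signHom u = 1 ↔ u = 1 := by
  rcases Int.units_eq_one_or u with rfl | rfl
  · simp
  · norm_num [signHom]

theorem signHom_mul_self (u : ℤˣ) : signHom u * signHom u = 1 := by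
  rcases signHom_eq u with h | h <;> simp [h]

variable (ψ : ∀ x : HeightOneSpectrum (𝓞 K), (κ K x)ˣ →* ℤˣ)

/-- The primes at which `ψ` is nontrivial and `a` has odd order. -/
def oddSet (a : Kˣ) : Set (HeightOneSpectrum (𝓞 K)) := {x | ψ x ≠ 1 ∧ Odd (ord x a).toAdd}

theorem finite_oddSet (a : Kˣ) : (oddSet ψ a).Finite :=
  (ChowWitt.finite_ord_ne (𝓞 K) a).subset fun x hx h => by
    have := hx.2
    rw [h] at this
    exact absurd this (by decide)

/-- The value at `x` of the quadratic character attached to `a`. -/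
noncomputable def symVal (a : Kˣ) (x : HeightOneSpectrum (𝓞 K)) : ℝ :=
  if x ∈ oddSet ψ a then 0 else if ψ x = 1 then 1 else signHom (ψ x (lead x a))

/-- The quadratic character attached to `a`. -/
noncomputable def symChar (a : Kˣ) : Ideal (𝓞 K) →*₀ ℝ := primeChar (symVal ψ a)

theorem symVal_of_notMem {a : Kˣ} {x : HeightOneSpectrum (𝓞 K)} (h : x ∉ oddSet ψ a) :
    symVal ψ a x = signHom (ψ x (lead x a)) := by
  rw [symVal, if_neg h]
  split_ifs with h1
  · simp [h1]
  · rfl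

theorem abs_symVal_le (a : Kˣ) (x : HeightOneSpectrum (𝓞 K)) : |symVal ψ a x| ≤ 1 := by
  by_cases h : x ∈ oddSet ψ a
  · simp [symVal, h]
  · rw [symVal_of_notMem ψ h]
    rcases signHom_eq (ψ x (lead x a)) with h1 | h1 <;> simp [h1]

theorem abs_symChar_le (a : Kˣ) (I : Ideal (𝓞 K)) : |symChar ψ a I| ≤ 1 :=
  abs_primeChar_le (abs_symVal_le ψ a) I

theorem symChar_eq_zero {a : Kˣ} {x : HeightOneSpectrum (𝓞 K)} (hx : x ∈ oddSet ψ a)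
    {I : Ideal (𝓞 K)} (hI : x.asIdeal ∣ I) : symChar ψ a I = 0 :=
  primeChar_eq_zero (if_pos hx) hI

/-- The value of the quadratic character on a principal ideal depends only on the residues of a
generator. -/
theorem symChar_span (hrec : ∀ a c : Kˣ, ∏ᶠ x, ψ x (tame x a c) = 1) (a : Kˣ) {c : Kˣ} {r : 𝓞 K} (hc : (c : K) = r)
    (hr : ∀ x ∈ oddSet ψ a, r ∉ x.asIdeal) : symChar ψ a (Ideal.span {r}) =
      ∏ᶠ x, if x ∈ oddSet ψ a then signHom (ψ x (lead x c)) else 1 := by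
  have hr0 : Ideal.span {r} ≠ ⊥ := by
    rw [Ne, Ideal.span_singleton_eq_bot]
    rintro rfl
    exact c.ne_zero (by rw [hc]; simp)
  -- The local factor of the character is the tame sign, corrected at the primes of `oddSet` by the
  -- residue sign of `c`. The product formula then removes all the tame signs.
  have hpt : ∀ x, symVal ψ a x ^ expo x (Ideal.span {r}) = signHom (ψ x (tame x a c)) *
      if x ∈ oddSet ψ a then signHom (ψ x (lead x c)) else 1 := by
    intro x
    have hord := ord_eq_expo x hc
    by_cases hx : x ∈ oddSet ψ a
    · have h0 : (ord x c).toAdd = 0 := (ord_eq_zero_iff_notMem x hc).2 (hr x hx)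
      have h1 : expo x (Ideal.span {r}) = 0 := by omega
      rw [if_pos hx, map_tame_of_odd _ hx.2 h0, h1, pow_zero, signHom_mul_self]
    · rw [if_neg hx, mul_one, symVal_of_notMem ψ hx]
      by_cases h1 : ψ x = 1
      · simp [h1]
      · have h2 : Even (ord x a).toAdd := by
          by_contra h
          exact hx ⟨h1, Int.not_even_iff_odd.1 h⟩
        rw [map_tame_of_even _ h2, hord, zpow_natCast, map_pow]
  have hfin : HasFiniteMulSupport fun x => signHom (ψ x (tame x a c)) :=
    (hasFiniteMulSupport_tame ψ a c).subset fun x hx h => hx (by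
      change signHom (ψ x (tame x a c)) = 1
      rw [show ψ x (tame x a c) = 1 from h, map_one])
  have hfin' : HasFiniteMulSupport fun x =>
      if x ∈ oddSet ψ a then signHom (ψ x (lead x c)) else 1 :=
    (finite_oddSet ψ a).subset fun x hx => by
      by_contra h
      exact hx (if_neg h)
  rw [symChar, primeChar_apply _ hr0]
  simp only [hpt]
  rw [finprod_mul_distrib hfin hfin', ← signHom.map_finprod (hasFiniteMulSupport_tame ψ a c), hrec,
    map_one, one_mul]

end Symbol

end NumberField.Reciprocity

/-! ### Square classes with even divisor against characters of the class group -/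

namespace NumberField.Reciprocity

open NumberField NumberField.UnitCutoff IsDedekindDomain ClosedPoint Function

section ClassGroup

variable {K : Type*} [Field K] [NumberField K]

/-- The squares of a cyclic group have index at most two. -/
theorem isSquare_or_isSquare_mul {G : Type*} [CommGroup G] [IsCyclic G] (a b : G) :
    IsSquare a ∨ IsSquare b ∨ IsSquare (a * b) := by
  obtain ⟨g, hg⟩ := IsCyclic.exists_generator (α := G)
  obtain ⟨m, rfl⟩ := hg a
  obtain ⟨n, rfl⟩ := hg b
  have h : ∀ k : ℤ, Even k → IsSquare (g ^ k) := by
    rintro _ ⟨k, rfl⟩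
    exact ⟨g ^ k, zpow_add g k k⟩
  change IsSquare (g ^ m) ∨ IsSquare (g ^ n) ∨ IsSquare (g ^ m * g ^ n)
  rw [← zpow_add]
  by_cases hm : Even m
  · exact Or.inl (h m hm)
  by_cases hn : Even n
  · exact Or.inr (Or.inl (h n hn))
  · exact Or.inr (Or.inr (h _ (Int.even_add.2 (iff_of_false hm hn))))

variable (K) in
/-- Some root of unity is not a square. -/
theorem exists_unit_not_isSquare : ∃ ζ : (𝓞 K)ˣ, ¬ IsSquare ((ζ : 𝓞 K) : K) := by
  obtain ⟨g, hg⟩ := IsCyclic.exists_generator (α := Units.torsion K)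
  refine ⟨g, ?_⟩
  rintro ⟨y, hy⟩
  have hint : IsIntegral ℤ y := by
    refine IsIntegral.of_pow (n := 2) two_pos ?_
    rw [sq, ← hy]
    exact RingOfIntegers.isIntegral_coe _
  let r : 𝓞 K := ⟨y, hint⟩
  have hr : (g : (𝓞 K)ˣ) = r * r := RingOfIntegers.ext hy
  have hru : IsUnit r := isUnit_of_mul_isUnit_left (hr ▸ (g : (𝓞 K)ˣ).isUnit)
  obtain ⟨Y, hY⟩ := hru
  have hYg : Y ^ 2 = g := _root_.Units.ext (by rw [hr, ← hY, sq]; rfl)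
  have hYt : Y ∈ Units.torsion K := by
    refine (CommGroup.mem_torsion _).2 ((isOfFinOrder_pow (n := 2)).1 ?_ |>.resolve_right two_ne_zero)
    rw [hYg]
    exact (CommGroup.mem_torsion _).1 g.2
  obtain ⟨k, hk⟩ := hg ⟨Y, hYt⟩
  -- A square root `g ^ k` of the generator `g` would force `g`, and with it `-1`, to have odd
  -- order.
  have h1 : g ^ (k * 2 - 1) = 1 := by
    rw [zpow_sub_one, zpow_mul, mul_inv_eq_one]
    change (g ^ k) ^ (2 : ℤ) = g
    rw [show g ^ k = ⟨Y, hYt⟩ from hk]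
    exact Subtype.ext hYg
  have h2 : (-1 : (𝓞 K)ˣ) ∈ Units.torsion K :=
    (CommGroup.mem_torsion _).2 (isOfFinOrder_iff_pow_eq_one.2 ⟨2, two_pos, by simp⟩)
  obtain ⟨m, hm⟩ := hg ⟨-1, h2⟩
  have h3 : (-1 : (𝓞 K)ˣ) ^ (k * 2 - 1) = 1 := by
    have h4 : (⟨-1, h2⟩ : Units.torsion K) ^ (k * 2 - 1) = 1 := by
      rw [← hm]
      change (g ^ m) ^ (k * 2 - 1) = 1
      rw [← zpow_mul, mul_comm, zpow_mul, h1, one_zpow]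
    exact congrArg Subtype.val h4
  have h5 : Odd (k * 2 - 1) := ⟨k - 1, by ring⟩
  rw [h5.neg_one_zpow] at h3
  have h6 := congrArg (fun u : (𝓞 K)ˣ => (((u : 𝓞 K) : K))) h3
  norm_num at h6

/-- The target is `ℂˣ`, so that the duality of finite abelian groups can count these characters. -/
theorem exists_classGroup_hom (χ : Ideal (𝓞 K) →*₀ ℝ)
    (h : ∀ r : 𝓞 K, r ≠ 0 → χ (Ideal.span {r}) = 1) : ∃ θ : ClassGroup (𝓞 K) →* ℂˣ,
      ∀ I : Ideal (𝓞 K), I ≠ ⊥ → (θ (idealClass I) : ℂ) = χ I := by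
  have hprin : ∀ I : Ideal (𝓞 K), I ≠ ⊥ → idealClass I = 1 → χ I = 1 := by
    intro I hI h1
    obtain ⟨r, rfl⟩ := ((idealClass_eq_one_iff hI).1 h1).principal
    exact h r fun h0 => hI (by simp [h0])
  have hwd : ∀ I J : Ideal (𝓞 K), I ≠ ⊥ → J ≠ ⊥ → idealClass I = idealClass J → χ I = χ J := by
    intro I J hI hJ hIJ
    obtain ⟨J', hJ', hC⟩ := exists_idealClass_eq (idealClass I)⁻¹
    have h1 := hprin (I * J') (mul_ne_zero hI hJ') (by
      rw [idealClass_mul hI hJ', hC, mul_inv_cancel])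
    have h2 := hprin (J * J') (mul_ne_zero hJ hJ') (by
      rw [idealClass_mul hJ hJ', hC, hIJ, mul_inv_cancel])
    rw [map_mul] at h1 h2
    exact mul_right_cancel₀ (right_ne_zero_of_mul_eq_one h1) (h1.trans h2.symm)
  choose J hJ hJC using exists_idealClass_eq (K := K)
  let θ₀ : ClassGroup (𝓞 K) →* ℂ :=
    { toFun := fun C => (χ (J C) : ℂ)
      map_one' := by rw [hprin _ (hJ 1) (hJC 1), Complex.ofReal_one]
      map_mul' := fun C D => by
        rw [← Complex.ofReal_mul, ← map_mul, hwd (J (C * D)) (J C * J D) (hJ _)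
          (mul_ne_zero (hJ C) (hJ D)) (by rw [idealClass_mul (hJ C) (hJ D), hJC, hJC, hJC])] }
  refine ⟨θ₀.toHomUnits, fun I hI => ?_⟩
  change (χ (J (idealClass I)) : ℂ) = χ I
  rw [hwd _ _ (hJ _) hI (hJC _)]

variable (ψ : ∀ x : HeightOneSpectrum (𝓞 K), (κ K x)ˣ →* ℤˣ)

theorem notMem_oddSet {a : Kˣ} (ha : ∀ x : HeightOneSpectrum (𝓞 K), Even (ord x a).toAdd)
    (x : HeightOneSpectrum (𝓞 K)) : x ∉ oddSet ψ a := fun h => Int.not_even_iff_odd.2 h.2 (ha x)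

theorem symChar_mul {a b : Kˣ} (ha : ∀ x : HeightOneSpectrum (𝓞 K), Even (ord x a).toAdd)
    (hb : ∀ x : HeightOneSpectrum (𝓞 K), Even (ord x b).toAdd) {I : Ideal (𝓞 K)} (hI : I ≠ ⊥) :
    symChar ψ (a * b) I = symChar ψ a I * symChar ψ b I := by
  rw [symChar, symChar, symChar, ← primeChar_mul _ _ hI]
  congr 2
  funext x
  have hab : ∀ x : HeightOneSpectrum (𝓞 K), Even (ord x (a * b)).toAdd := fun x => by
    rw [map_mul, toAdd_mul]
    exact (ha x).add (hb x)
  rw [symVal_of_notMem ψ (notMem_oddSet ψ ha x), symVal_of_notMem ψ (notMem_oddSet ψ hb x),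
    symVal_of_notMem ψ (notMem_oddSet ψ hab x), map_mul, map_mul, map_mul]

theorem symChar_mul_self {a : Kˣ} (ha : ∀ x : HeightOneSpectrum (𝓞 K), Even (ord x a).toAdd)
    {I : Ideal (𝓞 K)} (hI : I ≠ ⊥) : symChar ψ a I * symChar ψ a I = 1 := by
  rw [symChar, ← primeChar_mul _ _ hI, primeChar_apply _ hI]
  refine finprod_eq_one_of_forall_eq_one fun x => ?_
  rw [symVal_of_notMem ψ (notMem_oddSet ψ ha x), signHom_mul_self, one_pow]

theorem symChar_span_of_even (hrec : ∀ a c : Kˣ, ∏ᶠ x, ψ x (tame x a c) = 1) {a : Kˣ}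
    (ha : ∀ x : HeightOneSpectrum (𝓞 K), Even (ord x a).toAdd) (r : 𝓞 K) (hr : r ≠ 0) :
    symChar ψ a (Ideal.span {r}) = 1 := by
  have hr' : (r : K) ≠ 0 := by simpa using hr
  rw [symChar_span ψ hrec a (c := Units.mk0 (r : K) hr') rfl
    fun x hx => absurd hx (notMem_oddSet ψ ha x)]
  exact finprod_eq_one_of_forall_eq_one fun x => if_neg (notMem_oddSet ψ ha x)

/-- There are more square classes of elements with even divisor than quadratic characters of the
class group. -/
theorem exists_not_isSquare_symChar_eq_one
    (hrec : ∀ a c : Kˣ, ∏ᶠ x, ψ x (tame x a c) = 1) :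
    ∃ (b : 𝓞 K) (a : Kˣ), (a : K) = b ∧ ¬ IsSquare (b : K) ∧
      (∀ x : HeightOneSpectrum (𝓞 K), Even (ord x a).toAdd) ∧
      ∀ I : Ideal (𝓞 K), I ≠ ⊥ → symChar ψ a I = 1 := by
  obtain ⟨ζ, hζ⟩ := exists_unit_not_isSquare K
  let A := {C : ClassGroup (𝓞 K) // C ^ 2 = 1}
  have hA : ∀ C : A, ∃ (I : Ideal (𝓞 K)) (r : 𝓞 K), I ≠ ⊥ ∧ idealClass I = C.1 ∧ r ≠ 0 ∧
      I ^ 2 = Ideal.span {r} := by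
    intro C
    obtain ⟨I, hI, hC⟩ := exists_idealClass_eq C.1
    have h2 : I ^ 2 ≠ ⊥ := pow_ne_zero 2 hI
    obtain ⟨r, hr⟩ := ((idealClass_eq_one_iff h2).1 (by rw [idealClass_pow hI, hC, C.2])).principal
    exact ⟨I, r, hI, hC, fun h0 => h2 (by rw [hr, h0]; simp), hr⟩
  choose I r hI hIC hr hIr using hA
  -- A class of order dividing 2 contains some `I` with `I ^ 2 = (r)`. Together with the optional
  -- factor `ζ` this gives twice as many elements of even divisor as there are such classes.
  let β : Bool × A → 𝓞 K := fun q => (if q.1 then (ζ : 𝓞 K) else 1) * r q.2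
  have hβ0 : ∀ q, β q ≠ 0 := by
    rintro ⟨i, C⟩
    cases i <;> simp [β, hr]
  have hβI : ∀ q, Ideal.span {β q} = I q.2 ^ 2 := by
    rintro ⟨i, C⟩
    cases i
    · simp [β, hIr]
    · simp only [β, if_true, hIr]
      exact Ideal.span_singleton_mul_left_unit ζ.isUnit _
  let u : Bool × A → Kˣ := fun q => Units.mk0 (β q : K) (by simpa using hβ0 q)
  have hu : ∀ q, (u q : K) = β q := fun q => rfl
  have hueven : ∀ q (x : HeightOneSpectrum (𝓞 K)), Even (ord x (u q)).toAdd := by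
    intro q x
    rw [ord_eq_expo x (hu q), hβI, sq, expo_mul x (hI _) (hI _)]
    exact ⟨expo x (I q.2), by push_cast; ring⟩
  choose θ hθ using fun q => exists_classGroup_hom (symChar ψ (u q))
    (symChar_span_of_even ψ hrec (hueven q))
  have hθ2 : ∀ q, θ q ^ 2 = 1 := by
    intro q
    ext C
    obtain ⟨J, hJ, rfl⟩ := exists_idealClass_eq C
    rw [MonoidHom.pow_apply, Units.val_pow_eq_pow_val, hθ q J hJ, sq, ← Complex.ofReal_mul,
      symChar_mul_self ψ (hueven q) hJ]
    simp
  have : NeZero (Monoid.exponent (ClassGroup (𝓞 K)) : ℂ) :=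
    ⟨Nat.cast_ne_zero.2 Monoid.exponent_ne_zero_of_finite⟩
  obtain ⟨e⟩ := CommGroup.monoidHom_mulEquiv_of_hasEnoughRootsOfUnity (ClassGroup (𝓞 K)) ℂ
  -- The quadratic characters of the class group are as numerous as `A`. By the pigeonhole principle
  -- two of the elements share a character, and their product has the trivial one.
  let F : Bool × A → A := fun q => ⟨e (θ q), by rw [← map_pow, hθ2, map_one]⟩
  have hFni : ¬ Injective F := by
    intro hF
    have h1 := Nat.card_le_card_of_injective F hF
    have : Nonempty A := ⟨⟨1, one_pow 2⟩⟩
    have h2 : 0 < Nat.card A := Nat.card_pos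
    rw [Nat.card_prod, Nat.card_eq_fintype_card (α := Bool), Fintype.card_bool] at h1
    omega
  obtain ⟨p, q, hFpq, hpq⟩ := Function.not_injective_iff.1 hFni
  have hθpq : θ p = θ q := e.injective (congrArg Subtype.val hFpq)
  refine ⟨β p * β q, u p * u q, by simp [hu], ?_, fun x => ?_, fun J hJ => ?_⟩
  -- If the product were a square, the ideals `I p.2` and `I q.2` would have the same class, so `p`
  -- and `q` would differ only in the factor `ζ`, and `ζ` would be a square.
  · rintro ⟨y, hy⟩
    have hint : IsIntegral ℤ y := by
      refine IsIntegral.of_pow (n := 2) two_pos ?_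
      rw [sq, ← hy]
      exact RingOfIntegers.isIntegral_coe _
    let t : 𝓞 K := ⟨y, hint⟩
    have ht : β p * β q = t * t := RingOfIntegers.ext hy
    have h1 : (I p.2 * I q.2) ^ 2 = Ideal.span {t} ^ 2 := by
      rw [mul_pow, ← hβI, ← hβI, Ideal.span_singleton_mul_span_singleton, ht,
        ← Ideal.span_singleton_mul_span_singleton, sq]
    have h2 : I p.2 * I q.2 = Ideal.span {t} := by
      refine dvd_antisymm ?_ ?_
      · exact (UniqueFactorizationMonoid.pow_dvd_pow_iff_dvd two_ne_zero).1 h1.dvd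
      · exact (UniqueFactorizationMonoid.pow_dvd_pow_iff_dvd two_ne_zero).1 h1.symm.dvd
    have h3 : idealClass (I p.2 * I q.2) = 1 :=
      (idealClass_eq_one_iff (mul_ne_zero (hI _) (hI _))).2 ⟨t, h2⟩
    rw [idealClass_mul (hI _) (hI _), hIC, hIC] at h3
    have h4 : p.2 = q.2 := Subtype.ext (mul_right_cancel (h3.trans (by
      rw [← sq, q.2.2])).symm).symm
    have h5 : p.1 ≠ q.1 := fun h => hpq (Prod.ext h h4)
    have h6 : β p * β q = ζ * (r q.2 * r q.2) := by
      simp only [β, h4]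
      rcases p with ⟨i, C⟩
      rcases q with ⟨j, D⟩
      cases i <;> cases j <;> simp at h5 ⊢ <;> ring
    have hrK : ((r q.2 : 𝓞 K) : K) ≠ 0 := by simpa using hr q.2
    refine hζ ⟨y / r q.2, ?_⟩
    have h7 : ((β p * β q : 𝓞 K) : K) = ((ζ : 𝓞 K) : K) * (r q.2 * r q.2) := by
      rw [h6]; simp
    rw [hy] at h7
    field_simp
    rw [sq, sq, ← h7]
  · rw [map_mul, toAdd_mul]
    exact (hueven p x).add (hueven q x)
  · rw [symChar_mul ψ (hueven p) (hueven q) hJ]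
    have h1 := hθ p J hJ
    rw [hθpq, hθ q J hJ, Complex.ofReal_inj] at h1
    rw [← h1, symChar_mul_self ψ (hueven q) hJ]

end ClassGroup

end NumberField.Reciprocity

/-! ### No product formula at finite places only -/

namespace NumberField.Reciprocity

open NumberField NumberField.UnitCutoff IsDedekindDomain ClosedPoint Function

section Main

open scoped Classical

universe u

variable {K : Type u} [Field K] [NumberField K]
  (ψ : ∀ x : HeightOneSpectrum (𝓞 K), (κ K x)ˣ →* ℤˣ)

theorem exists_reduction_eq {x : HeightOneSpectrum (𝓞 K)} (hx : ψ x ≠ 1) :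
    ∃ (w : (κ K x)ˣ) (s : 𝓞 K), reduction K x s = w ∧ ψ x w = -1 := by
  obtain ⟨w, hw⟩ : ∃ w, ψ x w ≠ 1 := by
    by_contra! h
    exact hx (MonoidHom.ext h)
  obtain ⟨s, hs⟩ := reduction_surjective (K := K) x (w : κ K x)
  exact ⟨w, s, hs, (Int.units_eq_one_or _).resolve_left hw⟩

/-- A nontrivial sign character of the cyclic group `κ(x)^×` has the squares as its whole kernel. -/
theorem isSquare_of_map_eq_one {x : HeightOneSpectrum (𝓞 K)} (hx : ψ x ≠ 1) {w : (κ K x)ˣ}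
    (hw : ψ x w = 1) : IsSquare w := by
  obtain ⟨w₀, -, -, hw₀⟩ := exists_reduction_eq ψ hx
  have hsq : ∀ v : (κ K x)ˣ, IsSquare v → ψ x v = 1 := by
    rintro _ ⟨v, rfl⟩
    rw [map_mul, Int.units_mul_self]
  rcases isSquare_or_isSquare_mul w w₀ with h | h | h
  · exact h
  · exact absurd (hw₀.symm.trans (hsq _ h)) (by decide)
  · have := hsq _ h
    rw [map_mul, hw, hw₀] at this
    exact absurd this (by decide)

theorem notMem_of_reduction_eq {x : HeightOneSpectrum (𝓞 K)} {r s : 𝓞 K} {w : (κ K x)ˣ}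
    (hs : reduction K x s = w) (hr : r - s ∈ x.asIdeal) :
    reduction K x r = w ∧ r ∉ x.asIdeal := by
  have h : reduction K x r = w := by
    rw [← hs, ← sub_eq_zero, ← map_sub, reduction_eq_zero_iff]
    exact hr
  refine ⟨h, fun h1 => w.ne_zero ?_⟩
  rw [← h, reduction_eq_zero_iff]
  exact h1

theorem lead_eq {x : HeightOneSpectrum (𝓞 K)} {r : 𝓞 K} {c : Kˣ} (hc : (c : K) = r)
    {w : (κ K x)ˣ} (hr : reduction K x r = w) (hrx : r ∉ x.asIdeal) : lead x c = w := by
  ext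
  rw [coe_leadCoeff_eq_reduction x _ hc hrx, hr]

/-- The product of the primes in `oddSet` serves as conductor: `symChar_span` makes the values on
principal ideals depend only on residues, with no condition at the real places. A generator that is
1 modulo all these primes but `y`, and has sign `-1` at `y`, gives the value `-1`. -/
theorem exists_tsum_symChar_le (hrec : ∀ a c : Kˣ, ∏ᶠ x, ψ x (tame x a c) = 1) {a : Kˣ}
    (ha : (oddSet ψ a).Nonempty) : ∃ C : ℝ, ∀ s : ℝ, 1 < s → s ≤ 2 →
      ∑' I, symChar ψ a I * (Ideal.absNorm I : ℝ) ^ (-s) ≤ C := by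
  obtain ⟨y, hy⟩ := ha
  let Z := (finite_oddSet ψ a).toFinset
  have hZ : ∀ x, x ∈ Z ↔ x ∈ oddSet ψ a := fun x => Set.Finite.mem_toFinset _
  let 𝔪 : Ideal (𝓞 K) := ∏ x ∈ Z, x.asIdeal
  have h𝔪 : 𝔪 ≠ ⊥ := Finset.prod_ne_zero_iff.2 fun x _ => x.ne_bot
  have hle : ∀ x ∈ oddSet ψ a, 𝔪 ≤ x.asIdeal := fun x hx =>
    Ideal.le_of_dvd (Finset.dvd_prod_of_mem _ ((hZ x).2 hx))
  have hzero : ∀ r : 𝓞 K, (∃ x ∈ oddSet ψ a, r ∈ x.asIdeal) → symChar ψ a (Ideal.span {r}) = 0 := by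
    rintro r ⟨x, hx, hr⟩
    exact symChar_eq_zero ψ hx (Ideal.dvd_span_singleton.2 hr)
  refine exists_tsum_char_le (symChar ψ a) 𝔪 h𝔪 (abs_symChar_le ψ a) ?_ ?_ ?_
  · intro I hI
    refine IsCoprime.prod_right fun x hx => ?_
    rw [Ideal.isCoprime_iff_sup_eq, sup_comm]
    refine x.isMaximal.out.2 _ (left_lt_sup.2 fun h => hI ?_)
    exact symChar_eq_zero ψ ((hZ x).1 hx) (Ideal.dvd_iff_le.2 h)
  · intro c d hcd
    have hmem : ∀ x ∈ oddSet ψ a, (c ∈ x.asIdeal ↔ d ∈ x.asIdeal) := fun x hx => by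
      have h := hle x hx hcd
      exact ⟨fun h1 => by simpa using sub_mem h1 h, fun h1 => by simpa using add_mem h h1⟩
    by_cases hc : ∃ x ∈ oddSet ψ a, c ∈ x.asIdeal
    · obtain ⟨x, hx, hcx⟩ := hc
      rw [hzero c ⟨x, hx, hcx⟩, hzero d ⟨x, hx, (hmem x hx).1 hcx⟩]
    · push Not at hc
      have hd : ∀ x ∈ oddSet ψ a, d ∉ x.asIdeal := fun x hx h => hc x hx ((hmem x hx).2 h)
      have hc0 : (c : K) ≠ 0 := by
        have : c ≠ 0 := fun h => hc y hy (by rw [h]; exact zero_mem _)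
        simpa using this
      have hd0 : (d : K) ≠ 0 := by
        have : d ≠ 0 := fun h => hd y hy (by rw [h]; exact zero_mem _)
        simpa using this
      rw [symChar_span ψ hrec a (c := Units.mk0 (c : K) hc0) rfl hc,
        symChar_span ψ hrec a (c := Units.mk0 (d : K) hd0) rfl hd]
      refine finprod_congr fun x => ?_
      split_ifs with hx
      · congr 2
        refine lead_eq rfl ?_ (hc x hx)
        rw [coe_leadCoeff_eq_reduction x _ (r := d) rfl (hd x hx), ← sub_eq_zero, ← map_sub,
          reduction_eq_zero_iff]
        exact hle x hx hcd
      · rfl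
  · obtain ⟨w, s, hs, hw⟩ := exists_reduction_eq ψ hy.1
    obtain ⟨r, hr, hr1⟩ := exists_sub_mem_pow_and_sub_one_mem Z y s 1
    rw [pow_one] at hr
    obtain ⟨h1, h2⟩ := notMem_of_reduction_eq hs hr
    have h3 : ∀ x ∈ oddSet ψ a, x ≠ y → reduction K x r = (1 : (κ K x)ˣ) ∧ r ∉ x.asIdeal :=
      fun x hx hxy => notMem_of_reduction_eq (s := 1) (by simp) (hr1 x ((hZ x).2 hx) hxy)
    have hr0 : (r : K) ≠ 0 := by
      have : r ≠ 0 := fun h => h2 (by rw [h]; exact zero_mem _)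
      simpa using this
    refine ⟨r, ?_⟩
    rw [symChar_span ψ hrec a (c := Units.mk0 (r : K) hr0) rfl fun x hx => by
      by_cases hxy : x = y
      · rw [hxy]; exact h2
      · exact (h3 x hx hxy).2]
    rw [finprod_eq_single _ y fun x hxy => by
      split_ifs with hx
      · rw [lead_eq (r := r) rfl (h3 x hx hxy).1 (h3 x hx hxy).2, map_one, map_one]
      · rfl]
    rw [if_pos hy, lead_eq (r := r) rfl h1 h2, hw]
    simp [signHom]

theorem exists_mem_notMem_sq (x : HeightOneSpectrum (𝓞 K)) :
    ∃ s : 𝓞 K, s ∈ x.asIdeal ∧ s ∉ x.asIdeal ^ 2 := by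
  obtain ⟨s, hs⟩ := x.intValuation_exists_uniformizer
  refine ⟨s, ?_, ?_⟩
  · rw [← x.intValuation_lt_one_iff_mem, hs, ← WithZero.exp_zero, WithZero.exp_lt_exp]
    norm_num
  · rw [← x.intValuation_le_pow_iff_mem, hs, WithZero.exp_le_exp]
    norm_num

/-- An element of order one at `x` and of order zero at `y`. -/
theorem exists_ord_eq_one_and_zero {x y : HeightOneSpectrum (𝓞 K)} (hxy : y ≠ x) :
    ∃ a : Kˣ, (ord x a).toAdd = 1 ∧ (ord y a).toAdd = 0 := by
  obtain ⟨s, hs, hs2⟩ := exists_mem_notMem_sq x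
  obtain ⟨r, hr, hr1⟩ := exists_sub_mem_pow_and_sub_one_mem {y} x s 2
  have h1 : r ∈ x.asIdeal := by
    have := add_mem (Ideal.pow_le_self two_ne_zero hr) hs
    simpa using this
  have h2 : r ∉ x.asIdeal ^ 2 := fun h => hs2 (by simpa using sub_mem h hr)
  have h3 : r ∉ y.asIdeal := fun h => y.isPrime.one_notMem (by
    simpa using sub_mem h (hr1 y (Finset.mem_singleton_self y) hxy))
  have hr0 : (r : K) ≠ 0 := by
    have : r ≠ 0 := fun h => h3 (by rw [h]; exact zero_mem _)
    simpa using this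
  exact ⟨Units.mk0 (r : K) hr0, ord_eq_one_of_notMem_sq x (r := r) rfl h1 h2,
    (ord_eq_zero_iff_notMem y (r := r) rfl).2 h3⟩

/-- There is no product formula for quadratic tame symbols at finite places only. -/
theorem eq_one_of_finprod_tame_eq_one (hrec : ∀ a c : Kˣ, ∏ᶠ x, ψ x (tame x a c) = 1)
    (x : HeightOneSpectrum (𝓞 K)) : ψ x = 1 := by
  by_contra hx
  -- If `x` were the only prime with nontrivial character, the product formula would fail for a
  -- uniformizer at `x` and an element of sign `-1` there.
  obtain ⟨y, hyx, hy⟩ : ∃ y, y ≠ x ∧ ψ y ≠ 1 := by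
    by_contra! h
    obtain ⟨w, s, hs, hw⟩ := exists_reduction_eq ψ hx
    obtain ⟨-, hsx⟩ := notMem_of_reduction_eq (r := s) hs (by simp)
    have hs0 : (s : K) ≠ 0 := by
      have : s ≠ 0 := fun h => hsx (by rw [h]; exact zero_mem _)
      simpa using this
    have h1 := hrec (unif x) (Units.mk0 (s : K) hs0)
    rw [finprod_eq_single _ x fun y hy => by rw [h y hy, MonoidHom.one_apply],
      map_tame_of_odd _ (by rw [ord_unif]; decide)
        ((ord_eq_zero_iff_notMem x (r := s) rfl).2 hsx), lead_eq (r := s) rfl hs hsx, hw] at h1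
    exact absurd h1 (by decide)
  obtain ⟨a, hax, hay⟩ := exists_ord_eq_one_and_zero hyx
  obtain ⟨b, hby, hbx⟩ := exists_ord_eq_one_and_zero hyx.symm
  obtain ⟨β, c, hcβ, hβ, hceven, hc⟩ := exists_not_isSquare_symChar_eq_one ψ hrec
  -- At a prime of `T` not dividing `β`, triviality of the character of `β` means that `β` is a
  -- square modulo the prime; this bounds `T` from above. The characters of `a`, `b`, `a * b`,
  -- trivial off `T`, bound it from below.
  let T : Set (HeightOneSpectrum (𝓞 K)) := {p | ψ p ≠ 1}
  obtain ⟨L, _, _, hL⟩ := exists_tsum_le_log_realZeta β hβ T (by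
    intro p hp _ hβp
    have h1 := hc p.asIdeal p.ne_bot
    rw [symChar, primeChar_asIdeal, symVal_of_notMem ψ (notMem_oddSet ψ hceven p),
      signHom_eq_one_iff] at h1
    obtain ⟨w, hw⟩ := isSquare_of_map_eq_one ψ hp h1
    obtain ⟨r, hr⟩ := reduction_surjective (K := K) p (w : κ K p)
    refine ⟨r, ?_⟩
    rw [← reduction_eq_zero_iff (K := K), map_sub, map_pow, hr,
      ← coe_leadCoeff_eq_reduction p (ord_unif p) hcβ hβp, sub_eq_zero]
    change _ = ((lead p c : (κ K p)ˣ) : κ K p)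
    rw [hw, sq, Units.val_mul])
  let A : Fin 3 → Kˣ := ![a, b, a * b]
  have hxa : x ∈ oddSet ψ a := ⟨hx, by rw [hax]; decide⟩
  have hyb : y ∈ oddSet ψ b := ⟨hy, by rw [hby]; decide⟩
  have hxab : x ∈ oddSet ψ (a * b) := ⟨hx, by rw [map_mul, toAdd_mul, hax, hbx]; decide⟩
  refine false_of_split_of_char L T hL (fun i => symChar ψ (A i))
    (fun i I => abs_symChar_le ψ _ I) (fun i => exists_tsum_symChar_le ψ hrec ?_)
    ((finite_oddSet ψ a).toFinset ∪ (finite_oddSet ψ b).toFinset) ?_ ?_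
  · fin_cases i
    · exact ⟨x, hxa⟩
    · exact ⟨y, hyb⟩
    · exact ⟨x, hxab⟩
  · intro p _ hp i
    have hp1 : ψ p = 1 := not_not.1 hp
    rw [symChar, primeChar_asIdeal, symVal_of_notMem ψ fun h => h.1 hp1, hp1, MonoidHom.one_apply,
      map_one]
  · intro p hp
    simp only [Finset.mem_union, Set.Finite.mem_toFinset, not_or] at hp
    have hpab : p ∉ oddSet ψ (a * b) := by
      intro h
      have h1 : Even (ord p a).toAdd := Int.not_odd_iff_even.1 fun h2 => hp.1 ⟨h.1, h2⟩
      have h2 : Even (ord p b).toAdd := Int.not_odd_iff_even.1 fun h2 => hp.2 ⟨h.1, h2⟩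
      refine Int.not_even_iff_odd.2 h.2 ?_
      rw [map_mul, toAdd_mul]
      exact h1.add h2
    -- For signs `s`, `t` the quantity is `1 + s + t + st = (1 + s)(1 + t)`.
    rw [Fin.sum_univ_three]
    simp only [symChar, primeChar_asIdeal]
    change 0 ≤ 1 + (symVal ψ a p + symVal ψ b p + symVal ψ (a * b) p)
    rw [symVal_of_notMem ψ hp.1, symVal_of_notMem ψ hp.2, symVal_of_notMem ψ hpab, map_mul, map_mul,
      map_mul]
    rcases signHom_eq (ψ p (lead p a)) with h1 | h1 <;>
      rcases signHom_eq (ψ p (lead p b)) with h2 | h2 <;> rw [h1, h2] <;> norm_num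

end Main

end NumberField.Reciprocity

/-! ### Characters of the group of cycles -/

namespace ChowWitt

open NumberField NumberField.Reciprocity IsDedekindDomain ClosedPoint Function

section Characters

open scoped Classical

/-- The sign of an element of order two. -/
noncomputable def torsionSign {A : Type*} [AddCommGroup A] (a : A) : ℤˣ := if a = 0 then 1 else -1

/-- The only element of order two in `ℚ/ℤ` is the class of `1/2`. -/
theorem torsionSign_add {a b : AddCircle (1 : ℚ)} (ha : a + a = 0) (hb : b + b = 0) :
    torsionSign (a + b) = torsionSign a * torsionSign b := by
  have key : ∀ a : AddCircle (1 : ℚ), a + a = 0 → a ≠ 0 → a = ((1 / 2 : ℚ) : AddCircle (1 : ℚ)) := by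
    intro a h h0
    obtain ⟨r, rfl⟩ := QuotientAddGroup.mk_surjective a
    rw [← QuotientAddGroup.mk_add] at h
    obtain ⟨n, hn⟩ := (AddCircle.coe_eq_zero_iff (1 : ℚ)).1 h
    rcases Int.even_or_odd n with ⟨m, hm⟩ | ⟨m, hm⟩
    · refine absurd ((AddCircle.coe_eq_zero_iff (1 : ℚ)).2 ⟨m, ?_⟩) h0
      rw [hm] at hn
      simp only [zsmul_eq_mul, mul_one] at hn ⊢
      push_cast at hn
      linarith
    · rw [← sub_eq_zero]
      refine (AddCircle.coe_eq_zero_iff (1 : ℚ)).2 ⟨m, ?_⟩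
      rw [hm] at hn
      simp only [zsmul_eq_mul, mul_one] at hn ⊢
      push_cast at hn
      linarith
  by_cases ha0 : a = 0
  · simp [torsionSign, ha0]
  by_cases hb0 : b = 0
  · simp [torsionSign, hb0]
  have : a + b = 0 := by
    rw [key b hb hb0, ← key a ha ha0, ha]
  simp [torsionSign, ha0, hb0, this]

theorem torsionSign_sum {ι : Type*} (S : Finset ι) (f : ι → AddCircle (1 : ℚ))
    (hf : ∀ i, f i + f i = 0) : torsionSign (∑ i ∈ S, f i) = ∏ i ∈ S, torsionSign (f i) := by
  have h : ∀ S : Finset ι, ∑ i ∈ S, f i + ∑ i ∈ S, f i = 0 := fun S => by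
    rw [← Finset.sum_add_distrib]
    exact Finset.sum_eq_zero fun i _ => hf i
  induction S using Finset.induction_on with
  | empty => simp [torsionSign]
  | insert i S hi ih => rw [Finset.sum_insert hi, Finset.prod_insert hi,
      torsionSign_add (hf i) (h S), ih]

variable {K : Type*} [Field K] [NumberField K]

/-- The rank one form `⟨u⟩` at `x`, with respect to the chosen uniformizer. -/
noncomputable abbrev angleAt (x : HeightOneSpectrum (𝓞 K)) (u : (κ K x)ˣ) : GW (κ K x) (Nor K x) :=
  GW.angle (dualVec_ne_zero (ord_unif x)) u

/-- The hyperbolic class at `x`. -/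
noncomputable abbrev hypAt (x : HeightOneSpectrum (𝓞 K)) : GW (κ K x) (Nor K x) :=
  GW.hyp (dualVec_ne_zero (ord_unif x))

section Local

variable {A : Type*} [AddCommGroup A] {x : HeightOneSpectrum (𝓞 K)}
  (φ : GW (κ K x) (Nor K x) →+ A)

/-- The variation of a homomorphism on rank one forms. -/
noncomputable def angleDiff (u : (κ K x)ˣ) : A := φ (angleAt x u) - φ (angleAt x 1)

theorem angleDiff_add_self (u : (κ K x)ˣ) : angleDiff φ u + angleDiff φ u = 0 := by
  have h := congrArg φ (GW.angle_add_self (dualVec_ne_zero (ord_unif x)) u)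
  rw [map_add, map_add] at h
  rw [angleDiff, ← add_sub_add_comm, h, sub_self]

theorem neg_angleDiff (u : (κ K x)ˣ) : -angleDiff φ u = angleDiff φ u :=
  neg_eq_of_add_eq_zero_left (angleDiff_add_self φ u)

theorem angleDiff_mul_sq (u v : (κ K x)ˣ) : angleDiff φ (u * v ^ 2) = angleDiff φ u := by
  rw [angleDiff, angleAt, GW.angle_mul_sq, angleDiff]

theorem angleDiff_one : angleDiff φ 1 = 0 := sub_self _

theorem angleDiff_of_isSquare {u : (κ K x)ˣ} (hu : IsSquare u) : angleDiff φ u = 0 := by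
  obtain ⟨v, rfl⟩ := hu
  rw [← angleDiff_one φ, ← angleDiff_mul_sq φ 1 v, one_mul, sq]

/-- One of `u`, `v`, `u * v` is a square because `κ(x)^×` is cyclic; squares do not affect
`angleDiff`, whose values are 2-torsion. -/
theorem angleDiff_mul (u v : (κ K x)ˣ) :
    angleDiff φ (u * v) = angleDiff φ u + angleDiff φ v := by
  rcases isSquare_or_isSquare_mul u v with h | h | h
  · rw [angleDiff_of_isSquare φ h, zero_add]
    obtain ⟨w, rfl⟩ := h
    rw [mul_comm, ← sq, angleDiff_mul_sq]
  · rw [angleDiff_of_isSquare φ h, add_zero]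
    obtain ⟨w, rfl⟩ := h
    rw [← sq, angleDiff_mul_sq]
  · rw [angleDiff_of_isSquare φ h]
    obtain ⟨w, hw⟩ := h
    have h1 : v = u * (u⁻¹ * w) ^ 2 := by
      rw [mul_pow, sq w, ← hw, sq]
      group
    rw [h1, angleDiff_mul_sq, angleDiff_add_self]

/-- The rank one forms generate the group, and here `φ` is constant on them. -/
theorem map_eq_rank_smul (h : ∀ u, angleDiff φ u = 0) (g : GW (κ K x) (Nor K x)) :
    φ g = GW.rank g • φ (angleAt x 1) := by
  have hg : g ∈ AddSubgroup.closure (Set.range (angleAt x)) := by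
    rw [GW.closure_angle (dualVec_ne_zero (ord_unif x)) (exists_smul_dualVec (ord_unif x))]
    trivial
  induction hg using AddSubgroup.closure_induction with
  | mem g hg =>
    obtain ⟨u, rfl⟩ := hg
    rw [GW.rank_angle, one_smul]
    exact sub_eq_zero.1 (h u)
  | zero => simp
  | add a b _ _ ha hb => rw [map_add, map_add, ha, hb, add_smul]
  | neg a _ ha => rw [map_neg, map_neg, ha, neg_smul]

variable {φ}

theorem map_eq_of_ofGW_eq (hφ : φ (hypAt x) = 0) {a b : GW (κ K x) (Nor K x)}
    (h : Witt.ofGW a = Witt.ofGW b) : φ a = φ b := by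
  have h1 := (QuotientAddGroup.eq_zero_iff (a - b)).1 (show Witt.ofGW (a - b) = 0 by
    rw [map_sub, h, sub_self])
  have h2 : AddSubgroup.closure {a : GW (κ K x) (Nor K x) |
      ∃ (ℓ : Nor K x) (hℓ : ℓ ≠ 0), a = GW.hyp (k := κ K x) hℓ} ≤ φ.ker := by
    rw [AddSubgroup.closure_le]
    rintro _ ⟨m, hm, rfl⟩
    obtain ⟨a, ha⟩ := exists_smul_dualVec (ord_unif x) m
    rw [GW.hyp_eq (dualVec_ne_zero (ord_unif x)) hm a ha]
    exact hφ
  have h3 : φ (a - b) = 0 := h2 h1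
  rwa [map_sub, sub_eq_zero] at h3

theorem map_residueHom (hφ : φ (hypAt x) = 0) (u : Kˣ) : φ (residueHom x (KMW.symb₁ u)) =
    if Odd (ord x u).toAdd then φ (angleAt x 1) + angleDiff φ (lead x u) else 0 := by
  have h := ofGW_nEps_leadCoeff (ord_unif x) u
  rw [← residue_symb x (ord_unif x), wittRes] at h
  split_ifs at h ⊢
  · rw [map_eq_of_ofGW_eq hφ h, angleDiff]
    abel
  · rw [map_eq_of_ofGW_eq hφ (h.trans (map_zero _).symm), map_zero]

theorem angleDiff_neg_one (hφ : φ (hypAt x) = 0) :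
    angleDiff φ (-1) = -φ (angleAt x 1) - φ (angleAt x 1) := by
  rw [hypAt, GW.hyp, map_add] at hφ
  rw [angleDiff, eq_neg_of_add_eq_zero_right hφ]

theorem angleDiff_zpow_of_even (u : (κ K x)ˣ) {n : ℤ} (hn : Even n) :
    angleDiff φ (u ^ n) = 0 := by
  obtain ⟨m, rfl⟩ := hn
  exact angleDiff_of_isSquare φ ⟨u ^ m, zpow_add u m m⟩

theorem angleDiff_zpow_of_odd (u : (κ K x)ˣ) {n : ℤ} (hn : Odd n) :
    angleDiff φ (u ^ n) = angleDiff φ u := by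
  obtain ⟨m, rfl⟩ := hn
  rw [zpow_add_one, angleDiff_mul, angleDiff_zpow_of_even u (even_two_mul m), zero_add]

/-- The defect of additivity of the residue is given by the tame symbol. -/
theorem angleDiff_tame (hφ : φ (hypAt x) = 0) (a c : Kˣ) : angleDiff φ (tame x a c) =
    φ (residueHom x (KMW.symb₁ (a * c))) - φ (residueHom x (KMW.symb₁ a)) -
      φ (residueHom x (KMW.symb₁ c)) := by
  rw [map_residueHom hφ, map_residueHom hφ, map_residueHom hφ, tame, angleDiff_mul, angleDiff_mul,
    map_mul, toAdd_mul, map_mul, angleDiff_mul]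
  -- Only the parities of the two orders matter. When both are odd, the sign in the tame symbol
  -- accounts for the term `-2 φ⟨1⟩`, by `angleDiff_neg_one`.
  rcases Int.even_or_odd (ord x a).toAdd with ha | ha <;>
    rcases Int.even_or_odd (ord x c).toAdd with hc | hc
  · rw [if_neg (Int.not_odd_iff_even.2 (ha.add hc)), if_neg (Int.not_odd_iff_even.2 ha),
      if_neg (Int.not_odd_iff_even.2 hc), angleDiff_zpow_of_even _ ha,
      angleDiff_zpow_of_even _ hc, angleDiff_zpow_of_even _ (ha.mul_right _)]
    simp
  · rw [if_pos (ha.add_odd hc), if_neg (Int.not_odd_iff_even.2 ha), if_pos hc,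
      angleDiff_zpow_of_even _ ha, angleDiff_zpow_of_odd _ hc,
      angleDiff_zpow_of_even _ (ha.mul_right _)]
    abel
  · rw [if_pos (ha.add_even hc), if_pos ha, if_neg (Int.not_odd_iff_even.2 hc),
      angleDiff_zpow_of_odd _ ha, angleDiff_zpow_of_even _ hc,
      angleDiff_zpow_of_even _ (hc.mul_left _)]
    abel
  · rw [if_neg (Int.not_odd_iff_even.2 (ha.add_odd hc)), if_pos ha, if_pos hc,
      angleDiff_zpow_of_odd _ ha, angleDiff_zpow_of_odd _ hc, angleDiff_zpow_of_odd _ (ha.mul hc),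
      angleDiff_neg_one hφ]
    simp only [neg_angleDiff, sub_eq_add_neg, neg_add, zero_add]
    abel

end Local

theorem eq_sum_of {z : GWCycles (𝓞 K) K} (S : Finset (HeightOneSpectrum (𝓞 K)))
    (hS : ∀ x ∉ S, z x = 0) :
    z = ∑ x ∈ S, DirectSum.of (fun x => GW (κ K x) (Nor K x)) x (z x) := by
  refine DirectSum.ext fun x => ?_
  rw [DirectSum.sum_apply]
  by_cases hx : x ∈ S
  · rw [Finset.sum_eq_single x (fun y _ hy => DirectSum.of_eq_of_ne _ _ _ hy.symm)
      (fun h => absurd hx h), DirectSum.of_eq_same]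
  · rw [hS x hx, Finset.sum_eq_zero fun y hy => DirectSum.of_eq_of_ne _ _ _
      (show x ≠ y from fun h => hx (h ▸ hy))]

theorem residueHom_eq_zero {x : HeightOneSpectrum (𝓞 K)} {u : Kˣ} (h : (ord x u).toAdd = 0) :
    residueHom x (KMW.symb₁ u) = 0 := by
  rw [residue_symb x (ord_unif x), h]
  simp [GW.nEps]

/-- A cycle of rank zero is a combination of quadratic divisors and hyperbolic cycles. -/
theorem mem_range_sup_range_of_rank_eq_zero (z : GWCycles (𝓞 K) K)
    (hz : ∀ x, GW.rank (z x) = 0) : z ∈ (quadDivisor (𝓞 K) K).range ⊔ (hypCycles (𝓞 K) K).range := by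
  by_contra hN
  set N := (quadDivisor (𝓞 K) K).range ⊔ (hypCycles (𝓞 K) K).range with hNdef
  obtain ⟨ξ, hξ⟩ := CharacterModule.exists_character_apply_ne_zero_of_ne_zero
    (a := (QuotientAddGroup.mk z : GWCycles (𝓞 K) K ⧸ N))
    (fun h => hN ((QuotientAddGroup.eq_zero_iff z).1 h))
  let Φ : GWCycles (𝓞 K) K →+ AddCircle (1 : ℚ) := AddMonoidHom.comp ξ (QuotientAddGroup.mk' N)
  have hΦN : ∀ w ∈ N, Φ w = 0 := fun w hw => by
    change ξ (QuotientAddGroup.mk w) = 0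
    rw [(QuotientAddGroup.eq_zero_iff w).2 hw]
    exact map_zero ξ
  have hΦz : Φ z ≠ 0 := hξ
  let φ : ∀ x : HeightOneSpectrum (𝓞 K), GW (κ K x) (Nor K x) →+ AddCircle (1 : ℚ) :=
    fun x => Φ.comp (DirectSum.of (fun x => GW (κ K x) (Nor K x)) x)
  have hsum : ∀ (w : GWCycles (𝓞 K) K) (S : Finset (HeightOneSpectrum (𝓞 K))),
      (∀ x ∉ S, w x = 0) → Φ w = ∑ x ∈ S, φ x (w x) := fun w S hS => by
    conv_lhs => rw [eq_sum_of S hS, map_sum]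
    rfl
  have hφ : ∀ x, φ x (hypAt x) = 0 := fun x => by
    refine hΦN _ (le_sup_right (α := AddSubgroup _) ⟨Finsupp.single x 1, ?_⟩)
    rw [hypCycles, Finsupp.liftAddHom_apply_single, zmultiplesHom_apply, one_smul]
  let ψ : ∀ x : HeightOneSpectrum (𝓞 K), (κ K x)ˣ →* ℤˣ := fun x =>
    { toFun := fun u => torsionSign (angleDiff (φ x) u)
      map_one' := by rw [angleDiff_one, torsionSign, if_pos rfl]
      map_mul' := fun u v => by
        rw [angleDiff_mul, torsionSign_add (angleDiff_add_self _ _) (angleDiff_add_self _ _)] }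
  -- `Φ` kills the quadratic divisors of `[a]`, `[c]` and `[ac]`; summing `angleDiff_tame` over the
  -- finitely many relevant points gives the product formula.
  have hrec : ∀ a c : Kˣ, ∏ᶠ x, ψ x (tame x a c) = 1 := by
    intro a c
    let S := (finite_ord_ne (𝓞 K) a).toFinset ∪ (finite_ord_ne (𝓞 K) c).toFinset
    have hS : ∀ x ∉ S, (ord x a).toAdd = 0 ∧ (ord x c).toAdd = 0 := fun x hx => by
      simpa [S] using hx
    have hu : ∀ u : Kˣ, (∀ x ∉ S, (ord x u).toAdd = 0) →
        ∑ x ∈ S, φ x (residueHom x (KMW.symb₁ u)) = 0 := by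
      intro u hu
      have h := hsum (quadDivisor (𝓞 K) K (KMW.symb₁ u)) S fun x hx => by
        rw [quadDivisor_apply, residueHom_eq_zero (hu x hx)]
      rw [hΦN _ (le_sup_left (α := AddSubgroup _) ⟨_, rfl⟩)] at h
      simpa only [quadDivisor_apply] using h.symm
    rw [finprod_eq_prod_of_mulSupport_subset (s := S) _ fun x hx => by
      by_contra h
      have h0 := hS x h
      exact hx (by simp [tame, h0.1, h0.2])]
    change ∏ x ∈ S, torsionSign (angleDiff (φ x) (tame x a c)) = 1
    rw [← torsionSign_sum S _ fun x => angleDiff_add_self _ _]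
    simp only [angleDiff_tame (hφ _)]
    rw [Finset.sum_sub_distrib, Finset.sum_sub_distrib, hu a fun x hx => (hS x hx).1,
      hu c fun x hx => (hS x hx).2, hu (a * c) fun x hx => by
        rw [map_mul, toAdd_mul, (hS x hx).1, (hS x hx).2, add_zero]]
    simp [torsionSign]
  have hψ := eq_one_of_finprod_tame_eq_one ψ hrec
  have hzero : ∀ x u, angleDiff (φ x) u = 0 := by
    intro x u
    have h : torsionSign (angleDiff (φ x) u) = 1 := DFunLike.congr_fun (hψ x) u
    by_contra h0
    rw [torsionSign, if_neg h0] at h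
    exact absurd h (by decide)
  refine hΦz ?_
  rw [hsum z (DFinsupp.finite_support z).toFinset fun x hx => by simpa using hx]
  exact Finset.sum_eq_zero fun x _ => by rw [map_eq_rank_smul _ (hzero x), hz, zero_smul]

end Characters

end ChowWitt

/-! ### Exactness and finiteness -/

namespace ChowWitt

open NumberField NumberField.UnitCutoff NumberField.Reciprocity IsDedekindDomain ClosedPoint Function

section Exactness

variable {K : Type*} [Field K] [NumberField K]

/-- The divisor of an ideal. -/
noncomputable def idealCycle {I : Ideal (𝓞 K)} (hI : I ≠ ⊥) : ZeroCycles (𝓞 K) :=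
  Finsupp.ofSupportFinite (fun x => (expo x I : ℤ)) <| by
    refine (Ideal.finite_factors hI).subset fun x hx => ?_
    exact (expo_ne_zero_iff x hI).1 fun h => hx (by simp [h])

theorem idealCycle_apply {I : Ideal (𝓞 K)} (hI : I ≠ ⊥) (x : HeightOneSpectrum (𝓞 K)) :
    idealCycle hI x = expo x I := rfl

theorem idealCycle_mul {I J : Ideal (𝓞 K)} (hI : I ≠ ⊥) (hJ : J ≠ ⊥) (hIJ : I * J ≠ ⊥) :
    idealCycle hIJ = idealCycle hI + idealCycle hJ := by
  ext x
  rw [Finsupp.add_apply, idealCycle_apply, idealCycle_apply, idealCycle_apply, expo_mul x hI hJ,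
    Nat.cast_add]

theorem CH1.mk_eq_zero_iff {d : ZeroCycles (𝓞 K)} :
    CH1.mk (𝓞 K) K d = 0 ↔ ∃ u : Kˣ, divisor (𝓞 K) K (Additive.ofMul u) = d :=
  (QuotientAddGroup.eq_zero_iff d).trans ⟨fun ⟨u, hu⟩ => ⟨u.toMul, hu⟩, fun ⟨_, hu⟩ => ⟨_, hu⟩⟩

theorem CH1.mk_idealCycle_eq_zero {I : Ideal (𝓞 K)} (hI : I ≠ ⊥) (h : idealClass I = 1) :
    CH1.mk (𝓞 K) K (idealCycle hI) = 0 := by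
  obtain ⟨r, hr⟩ := ((idealClass_eq_one_iff hI).1 h).principal
  rw [Ideal.submodule_span_eq] at hr
  subst hr
  have hr0 : (r : K) ≠ 0 := by
    have : r ≠ 0 := fun h0 => hI (by simp [h0])
    simpa using this
  refine CH1.mk_eq_zero_iff.2 ⟨Units.mk0 (r : K) hr0, ?_⟩
  ext x
  rw [divisor_apply, idealCycle_apply, ord_eq_expo x (r := r) rfl]

variable (K) in
-- The class of an ideal's divisor depends only on the ideal class, so the class group maps to
-- `CH^1`. The image is closed under negation because ideal classes have inverses, and it contains
-- the closed points, which generate.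
theorem finite_CH1 : Finite (CH1 (𝓞 K) K) := by
  classical
  choose J hJ hJC using exists_idealClass_eq (K := K)
  let g : ClassGroup (𝓞 K) → CH1 (𝓞 K) K := fun C => CH1.mk (𝓞 K) K (idealCycle (hJ C))
  have hinv : ∀ (I : Ideal (𝓞 K)) (hI : I ≠ ⊥),
      CH1.mk (𝓞 K) K (idealCycle hI) + g (idealClass I)⁻¹ = 0 := by
    intro I hI
    have h := mul_ne_zero hI (hJ (idealClass I)⁻¹)
    rw [← map_add, ← idealCycle_mul hI (hJ _) h]
    exact CH1.mk_idealCycle_eq_zero h (by rw [idealClass_mul hI (hJ _), hJC, mul_inv_cancel])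
  have hg : ∀ (I : Ideal (𝓞 K)) (hI : I ≠ ⊥),
      CH1.mk (𝓞 K) K (idealCycle hI) = g (idealClass I) := by
    intro I hI
    have h1 := hinv _ (hJ (idealClass I))
    rw [hJC] at h1
    exact add_right_cancel ((hinv I hI).trans h1.symm)
  let S : AddSubgroup (CH1 (𝓞 K) K) :=
    { carrier := Set.range g
      zero_mem' := ⟨1, by
        rw [← CH1.mk_idealCycle_eq_zero (K := K) top_ne_bot idealClass_top, hg, idealClass_top]⟩
      add_mem' := by
        rintro _ _ ⟨C, rfl⟩ ⟨D, rfl⟩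
        exact ⟨_, by rw [← hg _ (mul_ne_zero (hJ C) (hJ D)), idealCycle_mul (hJ C) (hJ D),
          map_add]⟩
      neg_mem' := by
        rintro _ ⟨C, rfl⟩
        exact ⟨_, eq_neg_of_add_eq_zero_right (hinv _ (hJ C))⟩ }
  refine Finite.of_surjective g fun a => ?_
  obtain ⟨d, rfl⟩ := QuotientAddGroup.mk_surjective a
  change CH1.mk (𝓞 K) K d ∈ S
  induction d using Finsupp.induction_linear with
  | zero => rw [map_zero]; exact zero_mem S
  | add d e hd he => rw [map_add]; exact add_mem hd he
  | single x n =>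
    have h : Finsupp.single x n = n • idealCycle x.ne_bot := by
      ext y
      rw [Finsupp.smul_apply, idealCycle_apply, expo_asIdeal, Finsupp.single_apply]
      simp [eq_comm]
    rw [h, map_zsmul]
    exact zsmul_mem (by rw [hg]; exact ⟨_, rfl⟩) n

theorem exists_rankCycle (z : GWCycles (𝓞 K) K) :
    ∃ d : ZeroCycles (𝓞 K), ∀ x, GW.rank (z x) = d x :=
  ⟨Finsupp.ofSupportFinite (fun x => GW.rank (z x)) ((DFinsupp.finite_support z).subset
    fun x hx h => hx (by simp [h])), fun x => rfl⟩

theorem exists_rank_eq (d : ZeroCycles (𝓞 K)) :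
    ∃ z : GWCycles (𝓞 K) K, ∀ x, GW.rank (z x) = d x := by
  classical
  refine ⟨DirectSum.mk (fun x : HeightOneSpectrum (𝓞 K) => GW (κ K x) (Nor K x)) d.support
    fun x => d x.1 • angleAt x.1 1, fun x => ?_⟩
  by_cases hx : x ∈ d.support
  · rw [DirectSum.mk_apply_of_mem hx, map_zsmul, GW.rank_angle, smul_eq_mul, mul_one]
  · rw [DirectSum.mk_apply_of_notMem hx, map_zero]
    simpa [eq_comm] using hx

theorem exists_mk_eq (a : ModN (CH1 (𝓞 K) K) 2) :
    ∃ d : ZeroCycles (𝓞 K), ModN.mkQ 2 (CH1.mk (𝓞 K) K d) = a := by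
  obtain ⟨b, rfl⟩ := Submodule.mkQ_surjective _ a
  obtain ⟨d, rfl⟩ := QuotientAddGroup.mk_surjective b
  exact ⟨d, rfl⟩

theorem mkQ_eq_zero_iff {G : Type*} [AddCommGroup G] (a : G) :
    ModN.mkQ 2 a = 0 ↔ ∃ b : G, a = 2 • b := by
  change Submodule.mkQ _ a = 0 ↔ _
  rw [Submodule.mkQ_apply, Submodule.Quotient.mk_eq_zero, LinearMap.mem_range]
  refine exists_congr fun b => ?_
  rw [LinearMap.lsmul_apply, eq_comm]
  norm_num [two_smul]

variable (K) in
theorem modHMap_surjective : Surjective (modHMap (𝓞 K) K) := by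
  intro a
  obtain ⟨d, rfl⟩ := exists_mk_eq a
  obtain ⟨z, hz⟩ := exists_rank_eq (K := K) d
  exact ⟨ChowWitt1.mk (𝓞 K) K z, modHCycles_eq (𝓞 K) K z d hz⟩

theorem modHMap_hypMap (a : CH1 (𝓞 K) K) : modHMap (𝓞 K) K (hypMap (𝓞 K) K a) = 0 := by
  obtain ⟨d, rfl⟩ := QuotientAddGroup.mk_surjective a
  change modHCycles (𝓞 K) K (hypCycles (𝓞 K) K d) = 0
  rw [modHCycles_eq (𝓞 K) K _ (2 • d) fun x => by
    rw [hypCycles_apply, map_zsmul, GW.rank_hyp]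
    simp [mul_comm], mkQ_eq_zero_iff]
  exact ⟨CH1.mk (𝓞 K) K d, map_nsmul _ _ _⟩

theorem mem_range_hypMap_of_modHMap_eq_zero {w : ChowWitt1 (𝓞 K) K}
    (hw : modHMap (𝓞 K) K w = 0) : w ∈ Set.range (hypMap (𝓞 K) K) := by
  obtain ⟨z, rfl⟩ := QuotientAddGroup.mk_surjective w
  obtain ⟨d, hd⟩ := exists_rankCycle z
  have h1 : modHCycles (𝓞 K) K z = 0 := hw
  rw [modHCycles_eq (𝓞 K) K z d hd, mkQ_eq_zero_iff] at h1
  obtain ⟨b, hb⟩ := h1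
  obtain ⟨e, rfl⟩ := QuotientAddGroup.mk_surjective b
  have h2 : CH1.mk (𝓞 K) K (d - 2 • e) = 0 := by
    rw [map_sub, map_nsmul, hb]
    exact sub_self _
  obtain ⟨u, hu⟩ := CH1.mk_eq_zero_iff.1 h2
  -- Since `d - 2 • e` is the divisor of `u`, subtracting the residues of `[u]` and `h · e` makes
  -- the rank vanish at every point.
  have h3 := mem_range_sup_range_of_rank_eq_zero
    (z - quadDivisor (𝓞 K) K (KMW.symb₁ u) - hypCycles (𝓞 K) K e) fun x => by
      have h4 := DFunLike.congr_fun hu x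
      rw [divisor_apply, Finsupp.sub_apply, Finsupp.smul_apply] at h4
      rw [DirectSum.sub_apply, DirectSum.sub_apply, map_sub, map_sub, hd, quadDivisor_apply,
        rank_residueHom_symb, hypCycles_apply, map_zsmul, GW.rank_hyp, h4]
      simp
      ring
  obtain ⟨_, ⟨α, rfl⟩, _, ⟨f, rfl⟩, hαf⟩ := AddSubgroup.mem_sup.1 h3
  refine ⟨CH1.mk (𝓞 K) K (f + e), ?_⟩
  change ChowWitt1.mk (𝓞 K) K (hypCycles (𝓞 K) K (f + e)) = ChowWitt1.mk (𝓞 K) K z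
  rw [← sub_eq_zero, ← map_sub]
  refine (QuotientAddGroup.eq_zero_iff _).2 ⟨-(α + KMW.symb₁ u), ?_⟩
  rw [map_neg, map_add, map_add]
  have h5 : z = quadDivisor (𝓞 K) K α + hypCycles (𝓞 K) K f + hypCycles (𝓞 K) K e +
      quadDivisor (𝓞 K) K (KMW.symb₁ u) := by
    rw [hαf]
    abel
  rw [h5]
  abel

end Exactness

end ChowWitt

open NumberField in
theorem mainTheorem10 (K : Type*) [Field K] [NumberField K] :
    Function.Exact (ChowWitt.hypMap (𝓞 K) K) (ChowWitt.modHMap (𝓞 K) K) ∧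
      Function.Surjective (ChowWitt.modHMap (𝓞 K) K) ∧
      Finite (ChowWitt.ChowWitt1 (𝓞 K) K) := by
  have hexact : Function.Exact (ChowWitt.hypMap (𝓞 K) K) (ChowWitt.modHMap (𝓞 K) K) := by
    refine fun w => ⟨ChowWitt.mem_range_hypMap_of_modHMap_eq_zero, ?_⟩
    rintro ⟨a, rfl⟩
    exact ChowWitt.modHMap_hypMap a
  refine ⟨hexact, ChowWitt.modHMap_surjective K, ?_⟩
  have h1 := ChowWitt.finite_CH1 K
  have h2 : Finite (ModN (ChowWitt.CH1 (𝓞 K) K) 2) :=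
    Finite.of_surjective _ (Submodule.mkQ_surjective _)
  -- By exactness this kernel is the image of the finite group `CH^1`, and the quotient by it embeds
  -- in the finite group `CH^1 / 2`.
  have h3 : Finite (ChowWitt.modHMap (𝓞 K) K).ker :=
    (Set.finite_range (ChowWitt.hypMap (𝓞 K) K)).subset fun w hw => (hexact w).1 hw
  have h4 : Finite (ChowWitt.ChowWitt1 (𝓞 K) K ⧸ (ChowWitt.modHMap (𝓞 K) K).ker) :=
    Finite.of_injective _ (QuotientAddGroup.kerLift_injective (ChowWitt.modHMap (𝓞 K) K))
  exact Finite.of_addSubgroup_quotient (ChowWitt.modHMap (𝓞 K) K).ker
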